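/- Let $\Omega=\prod_{i=1}^3(0,L_i)$ with $L_i>0$, let $\nu_0,\kappa_2>0$ and $T\in(0,\infty]$. For $m\in\mathbb N$ let $\mathcal V^m$ be the space of restrictions to $\Omega$ of functions in $H^m_{loc}(\mathbb R^3)$ that are $L_i$-periodic in the $i$-th variable ($i=1,2,3$), and let $\dot{\mathcal V}^m_{div}$ be the space of vector fields $v\in(\mathcal V^m)^3$ with $\operatorname{div}v=0$ and $\int_\Omega v\,dx=0$. Let $\mathcal X(T)$ be the set of triples $(v,\omega,b)$ with $v\in L^2_{loc}([0,T);\dot{\mathcal V}^3_{div})$ and $\omega,b\in L^2_{loc}([0,T);\mathcal V^3)$, all five components of which belong to $H^1_{loc}([0,T);H^1(\Omega))$. Write $D(v)$ for the symmetric part of $\nabla v$, $(\cdot,\cdot)$ for the inner product of $L^2(\Omega)$ and $\mu=b/\omega$. Assume that $\omega_0,b_0\in\mathcal V^2$, $v_0\in\dot{\mathcal V}^2_{div}$ and that there are numbers $b_{\min},\omega_{\min},\omega_{\max}>0$ with $$b_{\min}\le b_0(x),\qquad \omega_{\min}\le\omega_0(x)\le\omega_{\max}\qquad\text{on }\Omega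 .$$ Let $(v,\omega,b)\in\mathcal X(T)$ satisfy $v|_{t=0}=v_0$, $\omega|_{t=0}=\omega_0$, $b|_{t=0}=b_0$ and, for almost all $t\in(0,T)$, $$(v_t,w)-(v\otimes v,\nabla w)+2\nu_0(\mu D(v),D(w))=0\quad\text{for all }w\in\dot{\mathcal V}^1_{div},$$ $$(\omega_t,z)-(\omega v,\nabla z)+(\mu\nabla\omega,\nabla z)=-\kappa_2(\omega^2,z)\quad\text{for all }z\in\mathcal V^1,$$ $$(b_t,q)-(bv,\nabla q)+(\mu\nabla b,\nabla q)=-(b\omega,q)+(\mu|D(v)|^2,q)\quad\text{for all }q\in\mathcal V^1 .$$ Then $\omega$ and $b$ have representatives that are continuous on $\overline\Omega\times[0,T)$, and these satisfy, for all $(x,t)\in\overline\Omega\times[0,T)$, $$\frac{\omega_{\min}}{1+\kappa_2\omega_{\min}t}\le\omega(x,t)\le\frac{\omega_{\max}}{1+\kappa_2\omega_{\max}t},\qquad \frac{b_{\min}}{(1+\kappa_2\omega_{\max}t)^{1/\kappa_2}}\le b(x,t).$$ -/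

import Mathlib

open MeasureTheory Filter Topology Set
open scoped ENNReal

namespace Kolmogorov

/-- Three-dimensional Euclidean space. -/
abbrev E3 : Type := EuclideanSpace ℝ (Fin 3)

/-- The `i`-th classical partial derivative of a scalar function. -/
noncomputable def partialD (i : Fin 3) (φ : E3 → ℝ) (x : E3) : ℝ :=
  fderiv ℝ φ x (EuclideanSpace.single i 1)

/-- `g` is the weak `i`-th partial derivative of `f` on the open set `U`. -/
def HasWeakDeriv (U : Set E3) (i : Fin 3) (f g : E3 → ℝ) : Prop :=
  LocallyIntegrableOn f U volume ∧ LocallyIntegrableOn g U volume ∧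
    ∀ φ : E3 → ℝ, ContDiff ℝ (⊤ : ℕ∞) φ → HasCompactSupport φ → tsupport φ ⊆ U →
      ∫ x in U, f x * partialD i φ x = - ∫ x in U, g x * φ x

open Classical in
/-- The weak `i`-th partial derivative on `U` (unique up to a null subset of `U`); the value is
`0` if there is none. -/
noncomputable def weakDeriv (U : Set E3) (i : Fin 3) (f : E3 → ℝ) : E3 → ℝ :=
  if h : ∃ g, HasWeakDeriv U i f g then h.choose else 0

/-- The Sobolev space `H^m(U) = W^{m,2}(U)`. -/
def MemH (U : Set E3) : ℕ → (E3 → ℝ) → Prop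
  | 0, f => MemLp f 2 (volume.restrict U)
  | m + 1, f => MemLp f 2 (volume.restrict U) ∧
      ∀ i : Fin 3, ∃ g, HasWeakDeriv U i f g ∧ MemH U m g

/-- The square of the norm of `H^m(U)`: the sum of the squares of the `L²(U)` norms of all weak
partial derivatives of order at most `m` (one summand for each order of differentiation). -/
noncomputable def sqNormH (U : Set E3) : ℕ → (E3 → ℝ) → ℝ≥0∞
  | 0, f => ∫⁻ x in U, ‖f x‖ₑ ^ 2
  | m + 1, f => (∫⁻ x in U, ‖f x‖ₑ ^ 2) + ∑ i : Fin 3, sqNormH U m (weakDeriv U i f)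

/-- The space `H^m_loc(ℝ³)`. -/
def MemHloc (m : ℕ) (f : E3 → ℝ) : Prop :=
  ∀ R : ℝ, MemH (Metric.ball 0 R) m f

/-- The box `Ω = (0, L₁) × (0, L₂) × (0, L₃)`. -/
def box (L : Fin 3 → ℝ) : Set E3 := {x | ∀ i, 0 < x i ∧ x i < L i}

/-- Periodicity with period `L i` in the `i`-th direction, for classes of functions modulo
equality almost everywhere. -/
def IsPeriodic (L : Fin 3 → ℝ) (F : E3 → ℝ) : Prop :=
  ∀ (i : Fin 3) (k : ℤ), (fun x => F (x + EuclideanSpace.single i (k * L i))) =ᵐ[volume] F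

/-- The space `V^m` of restrictions to `Ω` of the periodic functions in `H^m_loc(ℝ³)`. -/
def MemV (L : Fin 3 → ℝ) (m : ℕ) (f : E3 → ℝ) : Prop :=
  ∃ F : E3 → ℝ, MemHloc m F ∧ IsPeriodic L F ∧ f =ᵐ[volume.restrict (box L)] F

/-- The space of vector fields with components in `V^m`, with zero divergence and zero mean
on `Ω`. -/
def MemVdiv (L : Fin 3 → ℝ) (m : ℕ) (w : E3 → E3) : Prop :=
  (∀ i, MemV L m (fun x => w x i)) ∧
    (∀ᵐ x ∂volume.restrict (box L), ∑ i, weakDeriv (box L) i (fun y => w y i) x = 0) ∧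
    ∀ i, ∫ x in box L, w x i = 0

/-- The open time interval `(0, T)`, where `T = ∞` is allowed. -/
def timeIoo (T : EReal) : Set ℝ := {t | 0 < t ∧ (t : EReal) < T}

/-- The half-open time interval `[0, T)`, where `T = ∞` is allowed. -/
def timeIco (T : EReal) : Set ℝ := {t | 0 ≤ t ∧ (t : EReal) < T}

/-- Lebesgue measure on `(0, T) × Ω` (time is the first variable). -/
noncomputable def cylMeasure (L : Fin 3 → ℝ) (T : EReal) : Measure (ℝ × E3) :=
  (volume.restrict (timeIoo T)).prod (volume.restrict (box L))

/-- The space `L²_loc([0, T); H^m(Ω))`: square integrability in time holds on `(0, τ)` for every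
`τ < T`. -/
def MemL2locH (L : Fin 3 → ℝ) (T : EReal) (m : ℕ) (u : ℝ → E3 → ℝ) : Prop :=
  AEStronglyMeasurable (fun p : ℝ × E3 => u p.1 p.2) (cylMeasure L T) ∧
    (∀ᵐ t ∂volume.restrict (timeIoo T), MemH (box L) m (u t)) ∧
    ∀ τ ∈ timeIoo T, ∫⁻ t in Ioo 0 τ, sqNormH (box L) m (u t) < ∞

/-- The space `L²_loc([0, T); V^m)`; the norm of `V^m` is that of `H^m(Ω)`. -/
def MemL2locV (L : Fin 3 → ℝ) (T : EReal) (m : ℕ) (u : ℝ → E3 → ℝ) : Prop :=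
  MemL2locH L T m u ∧ ∀ᵐ t ∂volume.restrict (timeIoo T), MemV L m (u t)

/-- The space `L²_loc([0, T); V^m_div)` of divergence free vector fields of zero mean. -/
def MemL2locVdiv (L : Fin 3 → ℝ) (T : EReal) (m : ℕ) (v : ℝ → E3 → E3) : Prop :=
  (∀ i, MemL2locH L T m (fun t x => v t x i)) ∧
    ∀ᵐ t ∂volume.restrict (timeIoo T), MemVdiv L m (v t)

/-- `w` is the weak time derivative of `u` on `(0, T)`, both being in `L²_loc([0, T); L²(Ω))`. -/
def HasTimeDeriv (L : Fin 3 → ℝ) (T : EReal) (u w : ℝ → E3 → ℝ) : Prop :=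
  MemL2locH L T 0 u ∧ MemL2locH L T 0 w ∧
    ∀ η : ℝ → ℝ, ContDiff ℝ (⊤ : ℕ∞) η → HasCompactSupport η → tsupport η ⊆ timeIoo T →
      ∀ᵐ x ∂volume.restrict (box L),
        ∫ t in timeIoo T, deriv η t * u t x = - ∫ t in timeIoo T, η t * w t x

open Classical in
/-- The weak time derivative (unique up to a null subset of `(0, T) × Ω`); the value is `0` if
there is none. -/
noncomputable def timeDeriv (L : Fin 3 → ℝ) (T : EReal) (u : ℝ → E3 → ℝ) : ℝ → E3 → ℝ :=
  if h : ∃ w, HasTimeDeriv L T u w then h.choose else 0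

/-- The space `H¹_loc([0, T); H¹(Ω))`. -/
def MemH1locH1 (L : Fin 3 → ℝ) (T : EReal) (u : ℝ → E3 → ℝ) : Prop :=
  MemL2locH L T 1 u ∧ ∃ w, HasTimeDeriv L T u w ∧ MemL2locH L T 1 w

/-- The solution space `𝒳(T)`. -/
structure MemX (L : Fin 3 → ℝ) (T : EReal) (v : ℝ → E3 → E3) (ω b : ℝ → E3 → ℝ) : Prop where
  v_space : MemL2locVdiv L T 3 v
  om_space : MemL2locV L T 3 ω
  b_space : MemL2locV L T 3 b
  v_time : ∀ i, MemH1locH1 L T (fun t x => v t x i)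
  om_time : MemH1locH1 L T ω
  b_time : MemH1locH1 L T b

/-- The initial condition `u|_{t=0} = u₀`: `u(t) → u₀` in `L²(Ω)` as `t → 0⁺` off a null set of
times, that is, the representative of `u` in `C([0, T); L²(Ω))` has the value `u₀` at `t = 0`. -/
def HasInitialValue (L : Fin 3 → ℝ) (u : ℝ → E3 → ℝ) (u₀ : E3 → ℝ) : Prop :=
  Tendsto (fun t => eLpNorm (fun x => u t x - u₀ x) 2 (volume.restrict (box L)))
    (ae volume ⊓ 𝓝[>] 0) (𝓝 0)

/-- The entry `D(w)ᵢⱼ` of the symmetric part of the weak gradient on `Ω`. -/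
noncomputable def symGrad (L : Fin 3 → ℝ) (w : E3 → E3) (i j : Fin 3) (x : E3) : ℝ :=
  (weakDeriv (box L) i (fun y => w y j) x + weakDeriv (box L) j (fun y => w y i) x) / 2

/-- `(v, ω, b) ∈ 𝒳(T)` is a solution of Kolmogorov's system
`v_t + div(v ⊗ v) - 2ν₀ div((b/ω) D(v)) = -∇p`, `div v = 0`,
`ω_t + div(ω v) - div((b/ω) ∇ω) = -κ₂ ω²`,
`b_t + div(b v) - div((b/ω) ∇b) = -b ω + (b/ω) |D(v)|²`
with periodic boundary conditions and initial data `(v₀, ω₀, b₀)`. -/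
structure IsSolution (L : Fin 3 → ℝ) (ν₀ κ₂ : ℝ) (T : EReal) (v₀ : E3 → E3) (ω₀ b₀ : E3 → ℝ)
    (v : ℝ → E3 → E3) (ω b : ℝ → E3 → ℝ) : Prop where
  mem_X : MemX L T v ω b
  eq_v : ∀ᵐ t ∂volume.restrict (timeIoo T), ∀ w : E3 → E3, MemVdiv L 1 w →
    (∫ x in box L, ∑ i, timeDeriv L T (fun s y => v s y i) t x * w x i)
      - (∫ x in box L, ∑ i, ∑ j, v t x i * v t x j * weakDeriv (box L) j (fun y => w y i) x)
      + 2 * ν₀ * (∫ x in box L, b t x / ω t x *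
          ∑ i, ∑ j, symGrad L (v t) i j x * symGrad L w i j x) = 0
  eq_om : ∀ᵐ t ∂volume.restrict (timeIoo T), ∀ z : E3 → ℝ, MemV L 1 z →
    (∫ x in box L, timeDeriv L T ω t x * z x)
      - (∫ x in box L, ∑ i, ω t x * v t x i * weakDeriv (box L) i z x)
      + (∫ x in box L, b t x / ω t x *
          ∑ i, weakDeriv (box L) i (ω t) x * weakDeriv (box L) i z x)
      = - κ₂ * ∫ x in box L, ω t x ^ 2 * z x
  eq_b : ∀ᵐ t ∂volume.restrict (timeIoo T), ∀ q : E3 → ℝ, MemV L 1 q →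
    (∫ x in box L, timeDeriv L T b t x * q x)
      - (∫ x in box L, ∑ i, b t x * v t x i * weakDeriv (box L) i q x)
      + (∫ x in box L, b t x / ω t x *
          ∑ i, weakDeriv (box L) i (b t) x * weakDeriv (box L) i q x)
      = - (∫ x in box L, b t x * ω t x * q x)
        + ∫ x in box L, b t x / ω t x * (∑ i, ∑ j, symGrad L (v t) i j x ^ 2) * q x
  init_v : ∀ i, HasInitialValue L (fun t x => v t x i) (fun x => v₀ x i)
  init_om : HasInitialValue L ω ω₀
  init_b : HasInitialValue L b b₀

end Kolmogorov

/-!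
The bounds are comparison principles: the constants in space `m / (1 + κ₂ m t)` solve
`y' = -κ₂ y²`, and `b_min / (1 + κ₂ ω_max t) ^ (1 / κ₂)` solves `β' = -β y` for the upper bound `y`
of `ω`. Transport does not contribute to comparison since `v` is divergence free, diffusion
contributes with a sign as long as `b / ω ≥ 0`, and the production term `(b / ω) |D(v)|²` is
nonnegative and only lower bounds are claimed for `b`.

*Sobolev's embedding.* Weak derivatives of periodic functions may be integrated by parts over the
box (`integral_weakDeriv_mul_of_boxPeriodic`), so Fourier coefficients diagonalize them, and with
Parseval's identity the norm of `V^m` controls the coefficients with the weights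
`(1 + lam L k) ^ m` (`MemV.tsum_weight_coef_le`). Since the sum of `(1 + lam L k) ^ (-2)` over the
lattice converges, members of `V³` have periodic `C¹` representatives (`MemV.exists_contDiff`).

*Continuity in time and space.* Membership in `V³` is only assumed for the functions `u = ω, b`,
while their time derivatives lie in `H¹(Ω)`. These still are periodic, in the sense that they may
be integrated by parts without boundary terms (`HasTimeDeriv.ae_integral_mul_partialD`). A Sobolev
inequality in time for each Fourier coefficient, on an interval of length comparable to
`1 / (1 + lam L k)`, then makes the suprema of the coefficients over compact time intervals summable
(`exists_summable_bound`). The Fourier series is the continuous representative, and at almost every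
point of space it is a primitive of the weak time derivative (`HasTimeDeriv.ae_eq_add_integral`).

*Comparison.* At almost every time the equations are tested with `Z(u(t))`, where
`Z(ξ) = σ (σ (ξ - y(t)))₊²` with `σ = ±1` is `C¹` and nondecreasing (`exists_integral_mul_le`). The
chain rule for the primitive in time then shows that the integral over the box of
`(σ (u - y))₊³` stays zero (`nonpos_of_integral_mul_sq_nonpos`, `le_of_ae_integral_le`).

The equations do not exclude beforehand that `ω` or `b` vanishes, which would make the sign of the
diffusion fail. However, positivity on `(0, s)` implies the bounds on `[0, s]`
(`IsSolution.bounds_of_pos`), and these are strictly positive, so there is no first time at which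
the minimum of `ω` and `b` over the compact closure of the box fails to be positive.
-/

namespace Kolmogorov

/-! ### Weak derivatives -/

section WeakDerivatives

variable {U V : Set E3} {i : Fin 3} {f f' g g' : E3 → ℝ}

lemma integrable_mul_of_tsupport_subset {φ : E3 → ℝ} (hf : LocallyIntegrableOn f U volume)
    (hφ : Continuous φ) (hc : HasCompactSupport φ) (hs : tsupport φ ⊆ U) :
    Integrable (fun x => f x * φ x) := by
  have h1 : IntegrableOn (fun x => f x * φ x) (tsupport φ) :=
    (hf.integrableOn_compact_subset hs hc).mul_continuousOn hφ.continuousOn hc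
  refine (integrableOn_iff_integrable_of_support_subset ?_).1 h1
  exact (Function.support_mul_subset_right _ _).trans (subset_tsupport φ)

lemma setIntegral_mul_eq_integral {φ : E3 → ℝ} (hs : tsupport φ ⊆ U) :
    ∫ x in U, f x * φ x = ∫ x, f x * φ x := by
  refine setIntegral_eq_integral_of_forall_compl_eq_zero fun x hx => ?_
  rw [image_eq_zero_of_notMem_tsupport (fun h => hx (hs h)), mul_zero]

lemma tsupport_partialD_subset (i : Fin 3) (φ : E3 → ℝ) : tsupport (partialD i φ) ⊆ tsupport φ :=
  tsupport_fderiv_apply_subset ℝ _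

lemma hasCompactSupport_partialD {φ : E3 → ℝ} (h : HasCompactSupport φ) (i : Fin 3) :
    HasCompactSupport (partialD i φ) :=
  h.fderiv_apply ℝ _

lemma continuous_partialD {φ : E3 → ℝ} (h : ContDiff ℝ 1 φ) (i : Fin 3) :
    Continuous (partialD i φ) :=
  (h.continuous_fderiv one_ne_zero).clm_apply continuous_const

/-- Weak derivatives are unique almost everywhere. -/
lemma HasWeakDeriv.unique (hU : IsOpen U) (h : HasWeakDeriv U i f g) (h' : HasWeakDeriv U i f g') :
    g =ᵐ[volume.restrict U] g' := by
  have key := hU.ae_eq_zero_of_integral_contDiff_smul_eq_zero (h.2.1.sub h'.2.1) (μ := volume) ?_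
  · rw [EventuallyEq, ae_restrict_iff' hU.measurableSet]
    filter_upwards [key] with x hx hxU
    exact sub_eq_zero.1 (hx hxU)
  · intro φ hφ hc hs
    have h1 := (h.2.2 φ hφ hc hs).symm.trans (h'.2.2 φ hφ hc hs)
    rw [setIntegral_mul_eq_integral hs, setIntegral_mul_eq_integral hs] at h1
    have e : ∀ x, φ x • (g - g') x = g x * φ x - g' x * φ x := fun x => by
      simp only [Pi.sub_apply, smul_eq_mul]; ring
    simp_rw [e]
    rw [integral_sub (integrable_mul_of_tsupport_subset h.2.1 hφ.continuous hc hs)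
      (integrable_mul_of_tsupport_subset h'.2.1 hφ.continuous hc hs)]
    linarith

lemma HasWeakDeriv.congr (h : HasWeakDeriv U i f g) (hf : f =ᵐ[volume.restrict U] f')
    (hg : g =ᵐ[volume.restrict U] g') : HasWeakDeriv U i f' g' := by
  refine ⟨h.1.congr hf, h.2.1.congr hg, fun φ hφ hc hs => ?_⟩
  have h1 : ∫ x in U, f' x * partialD i φ x = ∫ x in U, f x * partialD i φ x :=
    integral_congr_ae (by filter_upwards [hf] with x hx; rw [hx])
  have h2 : ∫ x in U, g' x * φ x = ∫ x in U, g x * φ x :=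
    integral_congr_ae (by filter_upwards [hg] with x hx; rw [hx])
  rw [h1, h2, h.2.2 φ hφ hc hs]

lemma HasWeakDeriv.mono (h : HasWeakDeriv V i f g) (hUV : U ⊆ V) : HasWeakDeriv U i f g := by
  refine ⟨h.1.mono_set hUV, h.2.1.mono_set hUV, fun φ hφ hc hs => ?_⟩
  have := h.2.2 φ hφ hc (hs.trans hUV)
  rw [setIntegral_mul_eq_integral (hs.trans hUV),
    setIntegral_mul_eq_integral (((tsupport_partialD_subset i φ).trans hs).trans hUV)] at this
  rw [setIntegral_mul_eq_integral hs,
    setIntegral_mul_eq_integral ((tsupport_partialD_subset i φ).trans hs), this]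

lemma HasWeakDeriv.weakDeriv_spec (h : HasWeakDeriv U i f g) :
    HasWeakDeriv U i f (weakDeriv U i f) := by
  have hex : ∃ g, HasWeakDeriv U i f g := ⟨g, h⟩
  rw [weakDeriv, dif_pos hex]
  exact hex.choose_spec

lemma HasWeakDeriv.weakDeriv_ae_eq (hU : IsOpen U) (h : HasWeakDeriv U i f g) :
    weakDeriv U i f =ᵐ[volume.restrict U] g :=
  h.weakDeriv_spec.unique hU h

lemma hasWeakDeriv_of_contDiff (hf : ContDiff ℝ 1 f) (U : Set E3) (i : Fin 3) :
    HasWeakDeriv U i f (partialD i f) := by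
  refine ⟨hf.continuous.locallyIntegrable.locallyIntegrableOn U,
    (continuous_partialD hf i).locallyIntegrable.locallyIntegrableOn U, fun φ hφ hc hs => ?_⟩
  rw [setIntegral_mul_eq_integral hs,
    setIntegral_mul_eq_integral ((tsupport_partialD_subset i φ).trans hs)]
  have hφ1 : ContDiff ℝ 1 φ := hφ.of_le (by exact_mod_cast le_top)
  refine integral_mul_fderiv_eq_neg_fderiv_mul_of_integrable ?_ ?_ ?_
    (fun x _ => hf.differentiable one_ne_zero x) (fun x _ => hφ1.differentiable one_ne_zero x)
  · exact ((continuous_partialD hf i).mul hφ.continuous).integrable_of_hasCompactSupport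
      hc.mul_left
  · exact (hf.continuous.mul (continuous_partialD hφ1 i)).integrable_of_hasCompactSupport
      (hasCompactSupport_partialD hc i).mul_left
  · exact (hf.continuous.mul hφ.continuous).integrable_of_hasCompactSupport hc.mul_left

lemma MemH.memLp {m : ℕ} (h : MemH U m f) : MemLp f 2 (volume.restrict U) := by
  cases m with
  | zero => exact h
  | succ m => exact h.1

lemma MemH.congr {m : ℕ} (h : MemH U m f) (hff' : f =ᵐ[volume.restrict U] f') : MemH U m f' := by
  cases m with
  | zero => exact (memLp_congr_ae hff').1 h
  | succ m =>
    refine ⟨(memLp_congr_ae hff').1 h.1, fun i => ?_⟩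
    obtain ⟨g, hg, hm⟩ := h.2 i
    exact ⟨g, hg.congr hff' (ae_eq_refl _), hm⟩

lemma MemH.mono_set {m : ℕ} (h : MemH V m f) (hUV : U ⊆ V) : MemH U m f := by
  induction m generalizing f with
  | zero => exact MemLp.mono_measure (Measure.restrict_mono hUV le_rfl) h
  | succ m ih =>
    refine ⟨MemLp.mono_measure (Measure.restrict_mono hUV le_rfl) h.1, fun i => ?_⟩
    obtain ⟨g, hg, hm⟩ := h.2 i
    exact ⟨g, hg.mono hUV, ih hm⟩

lemma MemH.hasWeakDeriv {m : ℕ} (h : MemH U (m + 1) f) (i : Fin 3) :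
    HasWeakDeriv U i f (weakDeriv U i f) := by
  obtain ⟨g, hg, -⟩ := h.2 i
  exact hg.weakDeriv_spec

lemma MemH.weakDeriv (hU : IsOpen U) {m : ℕ} (h : MemH U (m + 1) f) (i : Fin 3) :
    MemH U m (weakDeriv U i f) := by
  obtain ⟨g, hg, hm⟩ := h.2 i
  exact hm.congr (hg.weakDeriv_ae_eq hU).symm

lemma lintegral_sq_le_sqNormH (U : Set E3) (m : ℕ) (f : E3 → ℝ) :
    ∫⁻ x in U, ‖f x‖ₑ ^ 2 ≤ sqNormH U m f := by
  cases m with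
  | zero => exact le_rfl
  | succ m => exact le_self_add

lemma sum_sqNormH_le (U : Set E3) (m : ℕ) (f : E3 → ℝ) :
    ∑ i, sqNormH U m (weakDeriv U i f) ≤ sqNormH U (m + 1) f :=
  le_add_self

lemma lintegral_sq_lt_top {α : Type*} [MeasurableSpace α] {μ : Measure α}
    {F : Type*} [NormedAddCommGroup F] {f : α → F} (h : MemLp f 2 μ) :
    ∫⁻ x, ‖f x‖ₑ ^ 2 ∂μ < ∞ := by
  have := lintegral_rpow_enorm_lt_top_of_eLpNorm_lt_top (p := 2) (by simp) (by simp) h.2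
  simpa using this

lemma memLp_two_of_lintegral_sq {α : Type*} [MeasurableSpace α] {μ : Measure α}
    {F : Type*} [NormedAddCommGroup F] {f : α → F} (hf : AEStronglyMeasurable f μ)
    (h : ∫⁻ x, ‖f x‖ₑ ^ 2 ∂μ < ∞) : MemLp f 2 μ := by
  refine ⟨hf, ?_⟩
  rw [eLpNorm_lt_top_iff_lintegral_rpow_enorm_lt_top (by simp) (by simp)]
  simpa using h

lemma MemH.sqNormH_lt_top (hU : IsOpen U) {m : ℕ} (h : MemH U m f) : sqNormH U m f < ∞ := by
  induction m generalizing f with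
  | zero => exact lintegral_sq_lt_top h
  | succ m ih =>
    exact ENNReal.add_lt_top.2 ⟨lintegral_sq_lt_top h.memLp,
      ENNReal.sum_lt_top.2 fun i _ => ih (h.weakDeriv hU i)⟩

end WeakDerivatives

/-! ### The period lattice -/

section Lattice

open scoped Pointwise

variable {L : Fin 3 → ℝ}

lemma isOpen_box (L : Fin 3 → ℝ) : IsOpen (box L) := by
  have : box L = ⋂ i, {x : E3 | 0 < x i ∧ x i < L i} := by ext x; simp [box]
  rw [this]
  refine isOpen_iInter_of_finite fun i => ?_
  have h : Continuous fun x : E3 => x i := by fun_prop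
  exact (isOpen_lt continuous_const h).inter (isOpen_lt h continuous_const)

lemma box_subset_ball (L : Fin 3 → ℝ) : ∃ R : ℝ, 0 < R ∧ box L ⊆ Metric.ball 0 R := by
  refine ⟨∑ i, |L i| + 1, by positivity, fun x hx => ?_⟩
  rw [mem_ball_zero_iff]
  have h1 : ‖x‖ ≤ ∑ i, |x i| := by
    rw [EuclideanSpace.norm_eq, Real.sqrt_le_left (by positivity)]
    simp only [Real.norm_eq_abs]
    exact Finset.sum_sq_le_sq_sum_of_nonneg fun i _ => abs_nonneg _
  have h2 : ∑ i, |x i| ≤ ∑ i, |L i| := Finset.sum_le_sum fun i _ => by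
    rw [abs_of_pos (hx i).1]
    exact (hx i).2.le.trans (le_abs_self _)
  linarith

lemma isBounded_box (L : Fin 3 → ℝ) : Bornology.IsBounded (box L) := by
  obtain ⟨R, -, h⟩ := box_subset_ball L
  exact Metric.isBounded_ball.subset h

instance (L : Fin 3 → ℝ) : IsFiniteMeasure (volume.restrict (box L)) :=
  ⟨by simpa using (isBounded_box L).measure_lt_top⟩

/-- The basis `Lᵢ eᵢ` of `ℝ³`, which spans the lattice of periods. -/
noncomputable def periodBasis (hL : ∀ i, 0 < L i) : Module.Basis (Fin 3) ℝ E3 :=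
  (EuclideanSpace.basisFun (Fin 3) ℝ).toBasis.isUnitSMul (fun i => (hL i).ne'.isUnit)

lemma periodBasis_apply (hL : ∀ i, 0 < L i) (i : Fin 3) :
    periodBasis hL i = EuclideanSpace.single i (L i) := by
  ext j
  simp [periodBasis, Module.Basis.isUnitSMul_apply]

lemma periodBasis_repr (hL : ∀ i, 0 < L i) (x : E3) (i : Fin 3) :
    (periodBasis hL).repr x i = x i / L i := by
  simp [periodBasis, Module.Basis.repr_isUnitSMul, Units.smul_def, div_eq_inv_mul]

lemma restrict_box_eq (hL : ∀ i, 0 < L i) :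
    volume.restrict (box L) = volume.restrict (ZSpan.fundamentalDomain (periodBasis hL)) := by
  refine Measure.restrict_congr_set ?_
  have h1 : box L = (fun x : E3 => WithLp.ofLp x) ⁻¹' (univ.pi fun i => Ioo 0 (L i)) := by
    ext x; simp [box]
  have h2 : ZSpan.fundamentalDomain (periodBasis hL)
      = (fun x : E3 => WithLp.ofLp x) ⁻¹' (univ.pi fun i => Ico 0 (L i)) := by
    ext x
    simp [ZSpan.mem_fundamentalDomain, periodBasis_repr, div_lt_one, hL, le_div_iff₀]
  rw [h1, h2]
  exact (PiLp.volume_preserving_ofLp (Fin 3)).quasiMeasurePreserving.preimage_ae_eq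
    (Measure.ae_eq_set_pi fun i _ => Ioo_ae_eq_Ico)

/-- Functions on `ℝ³` with exact period `Lᵢ` in the `i`-th direction. -/
def BoxPeriodic {β : Type*} (L : Fin 3 → ℝ) (F : E3 → β) : Prop :=
  ∀ i, Function.Periodic F (EuclideanSpace.single i (L i))

lemma BoxPeriodic.add_mem_span {β : Type*} {F : E3 → β} (hF : BoxPeriodic L F)
    (hL : ∀ i, 0 < L i) {v : E3} (hv : v ∈ Submodule.span ℤ (Set.range (periodBasis hL))) (x : E3) :
    F (x + v) = F x := by
  induction hv using Submodule.span_induction generalizing x with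
  | mem v hv =>
    obtain ⟨i, rfl⟩ := hv
    rw [periodBasis_apply]
    exact hF i x
  | zero => rw [add_zero]
  | add v w _ _ hv hw => rw [← add_assoc, hw, hv]
  | smul n v _ hv =>
    have : Function.Periodic F v := hv
    exact this.zsmul n x

/-- The integral of a periodic function over a translate of the box is the integral over the
box. -/
lemma BoxPeriodic.setIntegral_add {β : Type*} [NormedAddCommGroup β] [NormedSpace ℝ β]
    {F : E3 → β} (hF : BoxPeriodic L F) (hL : ∀ i, 0 < L i) (y : E3) :
    ∫ x in box L, F (x + y) = ∫ x in box L, F x := by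
  rw [restrict_box_eq hL]
  set D := ZSpan.fundamentalDomain (periodBasis hL)
  have hD : IsAddFundamentalDomain (Submodule.span ℤ (Set.range (periodBasis hL))) D volume :=
    ZSpan.isAddFundamentalDomain (periodBasis hL) volume
  have hD' := hD.vadd_of_comm y
  have hinv : ∀ (g : Submodule.span ℤ (Set.range (periodBasis hL))) (x : E3),
      F (g +ᵥ x) = F x := fun g x => by
    have : g +ᵥ x = x + g := add_comm _ _
    rw [this, hF.add_mem_span hL g.2]
  have : VAddInvariantMeasure (Submodule.span ℤ (Set.range (periodBasis hL))) E3 volume :=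
    ⟨fun g s _ => measure_preimage_add volume (g : E3) s⟩
  rw [hD.setIntegral_eq hD' hinv]
  have hmp : MeasurePreserving (fun x : E3 => x + y) volume volume :=
    measurePreserving_add_right volume y
  have := hmp.setIntegral_preimage_emb (measurableEmbedding_addRight y) F (y +ᵥ D)
  rw [← this]
  congr 2
  ext x
  simp [Set.mem_vadd_set, add_comm y]

/-- A function that is periodic up to null sets agrees almost everywhere with a periodic one. -/
lemma IsPeriodic.exists_boxPeriodic {F : E3 → ℝ} (hF : IsPeriodic L F) (hL : ∀ i, 0 < L i) :
    ∃ F' : E3 → ℝ, BoxPeriodic L F' ∧ F =ᵐ[volume] F' := by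
  set b := periodBasis hL
  refine ⟨fun x => F (ZSpan.fract b x), fun i x => ?_, ?_⟩
  · have : EuclideanSpace.single i (L i) ∈ Submodule.span ℤ (Set.range b) :=
      Submodule.subset_span ⟨i, periodBasis_apply hL i⟩
    simp only [ZSpan.fract_add_ZSpan b x this]
  · have hadd : ∀ v ∈ Submodule.span ℤ (Set.range b), (fun x => F (x + v)) =ᵐ[volume] F := by
      intro v hv
      induction hv using Submodule.span_induction with
      | mem v hv =>
        obtain ⟨i, rfl⟩ := hv
        simpa [b, periodBasis_apply] using hF i 1
      | zero => simp
      | add v w _ _ hv hw =>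
        have := (measurePreserving_add_right volume v).quasiMeasurePreserving.ae_eq_comp hw
        filter_upwards [this, hv] with x h1 h2
        simp only [Function.comp_apply] at h1
        rw [← add_assoc, h1, h2]
      | smul n v _ hv =>
        have hneg : (fun x => F (x + -v)) =ᵐ[volume] F := by
          have := (measurePreserving_add_right volume (-v)).quasiMeasurePreserving.ae_eq_comp hv
          filter_upwards [this] with x h1
          simpa using h1.symm
        have hstep : ∀ w, (fun x => F (x + w)) =ᵐ[volume] F → ∀ n : ℕ,
            (fun x => F (x + n • w)) =ᵐ[volume] F := by
          intro w hw n
          induction n with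
          | zero => simp
          | succ n ih =>
            have := (measurePreserving_add_right volume w).quasiMeasurePreserving.ae_eq_comp ih
            filter_upwards [this, hw] with x h1 h2
            simp only [Function.comp_apply] at h1
            rw [succ_nsmul', ← add_assoc, h1, h2]
        obtain ⟨k, rfl | rfl⟩ := n.eq_nat_or_neg
        · simpa using hstep v hv k
        · simpa using hstep (-v) hneg k
    have hall : ∀ᵐ x, ∀ v : Submodule.span ℤ (Set.range b), F (x + v) = F x := by
      have : Countable (Submodule.span ℤ (Set.range b)) := by infer_instance
      exact ae_all_iff.2 fun v => hadd v v.2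
    filter_upwards [hall] with x hx
    have := hx (-ZSpan.floor b x)
    rw [ZSpan.fract_apply, sub_eq_add_neg]
    simpa using this.symm

/-- The members of `V^m` are restrictions of functions in `H^m_loc` that are exactly periodic. -/
lemma MemV.exists_boxPeriodic {m : ℕ} {f : E3 → ℝ} (h : MemV L m f) (hL : ∀ i, 0 < L i) :
    ∃ F : E3 → ℝ, MemHloc m F ∧ BoxPeriodic L F ∧ f =ᵐ[volume.restrict (box L)] F := by
  obtain ⟨F, hF, hper, hf⟩ := h
  obtain ⟨F', hF', hFF'⟩ := hper.exists_boxPeriodic hL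
  exact ⟨F', fun R => (hF R).congr (ae_restrict_of_ae hFF'), hF',
    hf.trans (ae_restrict_of_ae hFF')⟩

end Lattice

/-! ### Fourier series on the box -/

section TorusTransport

noncomputable local instance torusMeasureSpace : MeasureSpace UnitAddCircle :=
  ⟨AddCircle.haarAddCircle⟩

local instance torusProbability : IsProbabilityMeasure (volume : Measure UnitAddCircle) :=
  inferInstanceAs (IsProbabilityMeasure AddCircle.haarAddCircle)

variable {L : Fin 3 → ℝ}

/-- The frequencies `2π kⱼ / Lⱼ`. -/
noncomputable def freq (L : Fin 3 → ℝ) (k : Fin 3 → ℤ) (j : Fin 3) : ℝ :=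
  2 * Real.pi * k j / L j

/-- The character `x ↦ exp(i ∑ⱼ 2π kⱼ xⱼ / Lⱼ)` of `ℝ³ / ∏ Lⱼ ℤ`. -/
noncomputable def character (L : Fin 3 → ℝ) (k : Fin 3 → ℤ) (x : E3) : ℂ :=
  Complex.exp (Complex.I * ((∑ j, freq L k j * x j : ℝ) : ℂ))

/-- The `k`-th Fourier coefficient on the box. -/
noncomputable def fourierCoef (L : Fin 3 → ℝ) (f : E3 → ℂ) (k : Fin 3 → ℤ) : ℂ :=
  ((∏ i, L i)⁻¹ : ℝ) * ∫ x in box L, character L (-k) x * f x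

/-- The section of `ℝ³ → ℝ³ / ∏ Lⱼ ℤ` with values in `∏ (0, Lⱼ]`, on the unit torus. -/
noncomputable def boxSection (L : Fin 3 → ℝ) (y : UnitAddTorus (Fin 3)) : E3 :=
  WithLp.toLp 2 fun i => L i * (AddCircle.equivIoc 1 0 (y i) : ℝ)

lemma measurable_boxSection (L : Fin 3 → ℝ) : Measurable (boxSection L) := by
  refine (WithLp.measurable_toLp 2 _).comp (measurable_pi_lambda _ fun i => ?_)
  exact ((measurable_subtype_coe.comp
    (AddCircle.measurableEquivIoc 1 0).measurable).comp (measurable_pi_apply i)).const_mul _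

lemma map_boxSection (hL : ∀ i, 0 < L i) :
    Measure.map (boxSection L) volume
      = ENNReal.ofReal (∏ i, L i)⁻¹ • volume.restrict (box L) := by
  ext s hs
  have hA : {x : Fin 3 → ℝ | ∀ i, x i ∈ Ioc ((0 : Fin 3 → ℝ) i) ((0 : Fin 3 → ℝ) i + 1)}
      ∩ {x | boxSection L (fun i => (x i : UnitAddCircle)) ∈ s}
      = Matrix.toLin' (Matrix.diagonal L) ⁻¹'
        ((univ.pi fun i => Ioc 0 (L i)) ∩ WithLp.toLp 2 ⁻¹' s) := by
    ext x
    have hT : Matrix.toLin' (Matrix.diagonal L) x = fun i => L i * x i := by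
      ext i; simp [Matrix.mulVec_diagonal]
    have h1 : (∀ i, x i ∈ Ioc ((0 : Fin 3 → ℝ) i) ((0 : Fin 3 → ℝ) i + 1))
        ↔ ∀ i, L i * x i ∈ Ioc 0 (L i) := by
      refine forall_congr' fun i => ?_
      have := hL i
      simp only [Pi.zero_apply, zero_add, mem_Ioc, mul_pos_iff_of_pos_left this]
      rw [mul_le_iff_le_one_right this]
    simp only [mem_inter_iff, mem_ofPred_eq, mem_preimage, hT, Set.mem_pi, mem_univ, true_imp_iff,
      h1]
    refine and_congr_right fun h => ?_
    have h2 : boxSection L (fun i => (x i : UnitAddCircle))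
        = WithLp.toLp 2 fun i => L i * x i := by
      rw [boxSection]
      congr 1
      ext i
      rw [AddCircle.equivIoc_coe_eq (by simpa using h1.2 h i)]
    rw [h2]
  have hmeas : MeasurableSet {x : Fin 3 → ℝ | ∀ i,
      x i ∈ Ioc ((0 : Fin 3 → ℝ) i) ((0 : Fin 3 → ℝ) i + 1)} :=
    MeasurableSet.univ_pi' fun i => measurableSet_Ioc
  have hs' : MeasurableSet {x : Fin 3 → ℝ | boxSection L (fun i => (x i : UnitAddCircle)) ∈ s} :=
    ((measurable_boxSection L).comp (measurable_pi_lambda _ fun i =>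
      AddCircle.measurable_mk'.comp (measurable_pi_apply i))) hs
  have hdet : (Matrix.toLin' (Matrix.diagonal L)).det = ∏ i, L i := by
    rw [LinearMap.det_toLin', Matrix.det_diagonal]
  have hpos : 0 < ∏ i, L i := Finset.prod_pos fun i _ => hL i
  have hbox : volume ((univ.pi fun i => Ioc 0 (L i)) ∩ WithLp.toLp 2 ⁻¹' s)
      = volume (s ∩ box L) := by
    have e : WithLp.toLp 2 ⁻¹' box L = univ.pi fun i => Ioo 0 (L i) := by
      ext x; simp [box]
    rw [← (PiLp.volume_preserving_toLp (Fin 3)).measure_preimage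
      (hs.inter (isOpen_box L).measurableSet).nullMeasurableSet, preimage_inter, e, inter_comm]
    exact measure_congr ((ae_eq_refl _).inter
      (Measure.ae_eq_set_pi fun i _ => Ioo_ae_eq_Ioc.symm))
  rw [Measure.map_apply (measurable_boxSection L) hs, ← lintegral_indicator_one
    (measurable_boxSection L hs), UnitAddTorus.lintegral_preimage _ 0]
  have : ∀ x : Fin 3 → ℝ, (boxSection L ⁻¹' s).indicator (1 : UnitAddTorus (Fin 3) → ℝ≥0∞)
      (fun i => (x i : UnitAddCircle))
      = {x : Fin 3 → ℝ | boxSection L (fun i => (x i : UnitAddCircle)) ∈ s}.indicator 1 x :=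
    fun x => rfl
  simp_rw [this]
  rw [lintegral_indicator_one hs', Measure.restrict_apply hs', inter_comm, hA,
    Measure.addHaar_preimage_linearMap _ (by rw [hdet]; exact hpos.ne'), hdet, hbox,
    abs_of_pos (inv_pos.2 hpos), Measure.smul_apply, Measure.restrict_apply hs, smul_eq_mul]

lemma volume_real_box (hL : ∀ i, 0 < L i) : (volume.restrict (box L)).real univ = ∏ i, L i := by
  have hpos : 0 < ∏ i, L i := Finset.prod_pos fun i _ => hL i
  have h := congrArg (fun μ : Measure E3 => μ.real univ) (map_boxSection hL)
  simp only [measureReal_def, Measure.map_apply (measurable_boxSection L) MeasurableSet.univ,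
    preimage_univ, measure_univ, Measure.smul_apply, smul_eq_mul, ENNReal.toReal_mul,
    ENNReal.toReal_ofReal (inv_pos.2 hpos).le, ENNReal.toReal_one] at h
  rw [measureReal_def]
  field_simp at h
  exact h.symm

lemma mFourier_boxSection (hL : ∀ i, 0 < L i) (k : Fin 3 → ℤ) (y : UnitAddTorus (Fin 3)) :
    UnitAddTorus.mFourier k y = character L k (boxSection L y) := by
  have h : ∀ i, y i = ((AddCircle.equivIoc 1 0 (y i) : ℝ) : UnitAddCircle) := fun i =>
    ((AddCircle.equivIoc 1 0).symm_apply_apply (y i)).symm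
  have h1 : UnitAddTorus.mFourier k y = ∏ i, fourier (k i) (y i) := rfl
  rw [h1, character, Complex.ofReal_sum, Finset.mul_sum, Complex.exp_sum]
  refine Finset.prod_congr rfl fun i _ => ?_
  conv_lhs => rw [h i, fourier_coe_apply]
  have : (L i : ℂ) ≠ 0 := by exact_mod_cast (hL i).ne'
  congr 1
  simp only [boxSection, freq]
  push_cast
  field_simp

/-- Parseval's identity on the box. -/
theorem hasSum_sq_fourierCoef (hL : ∀ i, 0 < L i) {f : E3 → ℂ}
    (hf : MemLp f 2 (volume.restrict (box L))) :
    HasSum (fun k => ‖fourierCoef L f k‖ ^ 2) ((∏ i, L i)⁻¹ * ∫ x in box L, ‖f x‖ ^ 2) := by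
  have hpos : 0 < ∏ i, L i := Finset.prod_pos fun i _ => hL i
  have hae : AEStronglyMeasurable f (Measure.map (boxSection L) volume) := by
    rw [map_boxSection hL]; exact hf.1.smul_measure _
  have hmem : MemLp (f ∘ boxSection L) 2 (volume : Measure (UnitAddTorus (Fin 3))) := by
    rw [← memLp_map_measure_iff hae (measurable_boxSection L).aemeasurable, map_boxSection hL]
    exact hf.smul_measure ENNReal.ofReal_ne_top
  have key := UnitAddTorus.hasSum_sq_mFourierCoeff (hmem.toLp _)
  have hint : ∀ {E : Type} [NormedAddCommGroup E] [NormedSpace ℝ E] (g : E3 → E),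
      AEStronglyMeasurable g (volume.restrict (box L)) →
      ∫ y, g (boxSection L y) = ((∏ i, L i)⁻¹ : ℝ) • ∫ x in box L, g x := by
    intro E _ _ g hg
    rw [← integral_map (measurable_boxSection L).aemeasurable
      (by rw [map_boxSection hL]; exact hg.smul_measure _), map_boxSection hL,
      integral_smul_measure, ENNReal.toReal_ofReal (inv_pos.2 hpos).le]
  have h1 : ∀ k, UnitAddTorus.mFourierCoeff (hmem.toLp _) k = fourierCoef L f k := by
    intro k
    have : UnitAddTorus.mFourierCoeff (hmem.toLp _) k
        = ∫ y, character L (-k) (boxSection L y) * f (boxSection L y) := by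
      refine integral_congr_ae ?_
      filter_upwards [hmem.coeFn_toLp] with y hy
      rw [hy, mFourier_boxSection hL, smul_eq_mul]
      rfl
    rw [this, hint (fun x => character L (-k) x * f x), fourierCoef, Complex.real_smul]
    refine AEStronglyMeasurable.mul ?_ hf.1
    refine Continuous.aestronglyMeasurable ?_
    unfold character; fun_prop
  have h2 : ∫ y, ‖(hmem.toLp _ : UnitAddTorus (Fin 3) → ℂ) y‖ ^ 2
      = (∏ i, L i)⁻¹ * ∫ x in box L, ‖f x‖ ^ 2 := by
    rw [← smul_eq_mul, ← hint (fun x => ‖f x‖ ^ 2) (hf.1.norm.pow 2)]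
    refine integral_congr_ae ?_
    filter_upwards [hmem.coeFn_toLp] with y hy
    rw [hy]; rfl
  simpa only [h1, h2] using key

end TorusTransport

/-! ### Integration by parts for periodic functions -/

section PeriodicIntegration

variable {L : Fin 3 → ℝ}

lemma integrable_mul_comp_sub {P r : E3 → ℝ} (hP : LocallyIntegrable P volume)
    (hr : Continuous r) (hrc : HasCompactSupport r) (L : Fin 3 → ℝ) :
    Integrable (fun p : E3 × E3 => P p.2 * r (p.2 - p.1))
      ((volume.restrict (box L)).prod volume) := by
  obtain ⟨R, hR, hbox⟩ := box_subset_ball L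
  obtain ⟨R', hR'⟩ := hrc.isCompact.isBounded.subset_closedBall (0 : E3)
  set B := Metric.closedBall (0 : E3) (R + R')
  have hB : Integrable (B.indicator P) :=
    (hP.integrableOn_isCompact (isCompact_closedBall _ _)).integrable_indicator
      Metric.isClosed_closedBall.measurableSet
  have h1 : Integrable (fun p : E3 × E3 => (1 : ℝ) * B.indicator P p.2)
      ((volume.restrict (box L)).prod volume) := (integrable_const 1).mul_prod hB
  obtain ⟨C, hC⟩ := hrc.exists_bound_of_continuous hr
  have h2 := h1.mul_bdd (g := fun p : E3 × E3 => r (p.2 - p.1))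
    (hr.comp (continuous_snd.sub continuous_fst)).aestronglyMeasurable
    (Eventually.of_forall fun p => hC _)
  refine h2.congr ?_
  have hmem : ∀ᵐ p : E3 × E3 ∂(volume.restrict (box L)).prod volume, p.1 ∈ box L :=
    Measure.quasiMeasurePreserving_fst.ae (ae_restrict_mem (isOpen_box L).measurableSet)
  filter_upwards [hmem] with p hp
  by_cases hpB : p.2 ∈ B
  · simp [hpB]
  · have : r (p.2 - p.1) = 0 := by
      by_contra hne
      have h3 := hR' (subset_tsupport r (Function.mem_support.2 hne))
      have h4 := hbox hp
      rw [mem_closedBall_zero_iff] at h3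
      rw [mem_ball_zero_iff] at h4
      refine hpB (mem_closedBall_zero_iff.2 ?_)
      have := norm_add_le (p.2 - p.1) p.1
      rw [sub_add_cancel] at this
      linarith
    simp [this]

/-- Averaging the translates of a compactly supported function over the box turns it into a
constant, as far as integration against periodic functions is concerned. -/
lemma BoxPeriodic.integral_mul_comp_sub {P r : E3 → ℝ} (hper : BoxPeriodic L P)
    (hL : ∀ i, 0 < L i) (hP : LocallyIntegrable P volume)
    (hr : Continuous r) (hrc : HasCompactSupport r) :
    ∫ y in box L, ∫ x, P x * r (x - y) = (∫ z, r z) * ∫ x in box L, P x := by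
  have hA := integrable_mul_comp_sub hP hr hrc L
  have hS := (measurePreserving_prod_add (volume.restrict (box L)) (volume : Measure E3))
  have hA' : Integrable (fun p : E3 × E3 => P (p.1 + p.2) * r p.2)
      ((volume.restrict (box L)).prod volume) := by
    have := hS.integrable_comp_of_integrable hA
    refine this.congr (Eventually.of_forall fun p => ?_)
    simp
  have h1 : ∀ y, ∫ x, P x * r (x - y) = ∫ z, P (y + z) * r z := fun y => by
    rw [← integral_add_left_eq_self _ y]
    simp
  simp_rw [h1]
  rw [integral_integral_swap hA', ← integral_mul_const]
  refine integral_congr_ae (Eventually.of_forall fun z => ?_)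
  simp only
  rw [integral_mul_const, hper.setIntegral_add hL z, mul_comm]

lemma integral_partialD_eq_zero {ρ : E3 → ℝ} (hρ : ContDiff ℝ 1 ρ) (hc : HasCompactSupport ρ)
    (i : Fin 3) : ∫ x, partialD i ρ x = 0 := by
  have := integral_mul_fderiv_eq_neg_fderiv_mul_of_integrable (μ := volume)
    (f := fun _ : E3 => (1 : ℝ)) (g := ρ) (v := EuclideanSpace.single i (1 : ℝ))
    (by simp) (((continuous_partialD hρ i).integrable_of_hasCompactSupport
      (hasCompactSupport_partialD hc i)).const_mul 1)
    (by simpa using hρ.continuous.integrable_of_hasCompactSupport hc)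
    (fun x _ => differentiableAt_const _) (fun x _ => hρ.differentiable one_ne_zero x)
  simpa [partialD] using this

lemma BoxPeriodic.partialD {h : E3 → ℝ} (hp : BoxPeriodic L h) (i : Fin 3) :
    BoxPeriodic L (partialD i h) := fun j x => by
  have : (fun y => h (y + EuclideanSpace.single j (L j))) = h := funext fun y => hp j y
  rw [Kolmogorov.partialD, Kolmogorov.partialD, ← fderiv_comp_add_right, this]

/-- Integration by parts over the box: there are no boundary terms for periodic functions. -/
theorem integral_weakDeriv_mul_of_boxPeriodic (hL : ∀ i, 0 < L i) {i : Fin 3} {F G e : E3 → ℝ}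
    (hFG : HasWeakDeriv univ i F G) (hF : BoxPeriodic L F) (hG : BoxPeriodic L G)
    (he : ContDiff ℝ (⊤ : ℕ∞) e) (hper : BoxPeriodic L e) :
    ∫ x in box L, F x * partialD i e x = - ∫ x in box L, G x * e x := by
  obtain ⟨φ⟩ : Nonempty (ContDiffBump (0 : E3)) := inferInstance
  set ρ : E3 → ℝ := φ.normed volume
  have hρ : ContDiff ℝ (⊤ : ℕ∞) ρ := φ.contDiff_normed
  have hρ1 : ContDiff ℝ 1 ρ := φ.contDiff_normed
  have he1 : ContDiff ℝ 1 e := he.of_le (by exact_mod_cast le_top)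
  have hρc : HasCompactSupport ρ := φ.hasCompactSupport_normed
  have hρi : ∫ x, ρ x = 1 := φ.integral_normed
  have hFl : LocallyIntegrable F volume := locallyIntegrableOn_univ.1 hFG.1
  have hGl : LocallyIntegrable G volume := locallyIntegrableOn_univ.1 hFG.2.1
  have hmul : ∀ {P q : E3 → ℝ}, LocallyIntegrable P volume → Continuous q →
      LocallyIntegrable (fun x => P x * q x) volume := by
    intro P q hP hq
    have := (locallyIntegrableOn_univ.2 hP).mul_continuousOn hq.continuousOn
      isOpen_univ.isLocallyClosed
    exact locallyIntegrableOn_univ.1 this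
  have hperD : BoxPeriodic L (partialD i e) := hper.partialD i
  have h1 := BoxPeriodic.integral_mul_comp_sub (L := L) (P := fun x => F x * partialD i e x)
    (fun j x => by simp only [hF j x, hperD j x]) hL (hmul hFl (continuous_partialD he1 i))
    hρ.continuous hρc
  have h2 := BoxPeriodic.integral_mul_comp_sub (L := L) (P := fun x => F x * e x)
    (fun j x => by simp only [hF j x, hper j x]) hL (hmul hFl he.continuous)
    (continuous_partialD hρ1 i) (hasCompactSupport_partialD hρc i)
  have h3 := BoxPeriodic.integral_mul_comp_sub (L := L) (P := fun x => G x * e x)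
    (fun j x => by simp only [hG j x, hper j x]) hL (hmul hGl he.continuous)
    hρ.continuous hρc
  -- The classical product rule is used on `e ρ(· - y)`, and the result is averaged over `y`.
  rw [hρi, one_mul] at h1 h3
  rw [integral_partialD_eq_zero hρ1 hρc, zero_mul] at h2
  have i1 := (integrable_mul_comp_sub (hmul hFl (continuous_partialD he1 i)) hρ.continuous hρc
    L).integral_prod_left
  have i2 := (integrable_mul_comp_sub (hmul hFl he.continuous) (continuous_partialD hρ1 i)
    (hasCompactSupport_partialD hρc i) L).integral_prod_left
  rw [← h1, ← h3, ← add_zero (∫ y in box L, ∫ x, F x * partialD i e x * ρ (x - y)), ← h2,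
    ← integral_add i1 i2, ← integral_neg]
  refine integral_congr_ae (Eventually.of_forall fun y => ?_)
  simp only
  have hρy : ContDiff ℝ (⊤ : ℕ∞) fun x => ρ (x - y) := hρ.comp (contDiff_id.sub contDiff_const)
  have hcy : HasCompactSupport fun x => ρ (x - y) :=
    hρc.comp_homeomorph (Homeomorph.subRight y)
  have hD : ∀ x, partialD i (fun x => e x * ρ (x - y)) x
      = partialD i e x * ρ (x - y) + e x * partialD i ρ (x - y) := fun x => by
    have e1 : HasFDerivAt e (fderiv ℝ e x) x := (he1.differentiable one_ne_zero x).hasFDerivAt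
    have e2 : HasFDerivAt (fun x => ρ (x - y)) (fderiv ℝ ρ (x - y)) x := by
      have := (hρ1.differentiable one_ne_zero (x - y)).hasFDerivAt
      simpa [Function.comp_def] using this.comp x ((hasFDerivAt_id x).sub_const y)
    rw [partialD, (e1.fun_mul e2).fderiv]
    simp [partialD]
    ring
  have key := hFG.2.2 (fun x => e x * ρ (x - y)) (he.mul hρy) hcy.mul_left (subset_univ _)
  simp only [Measure.restrict_univ] at key
  have j1 : Integrable fun x => F x * partialD i e x * ρ (x - y) :=
    integrable_mul_of_tsupport_subset (U := univ) (locallyIntegrableOn_univ.2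
      (hmul hFl (continuous_partialD he1 i))) hρy.continuous hcy (subset_univ _)
  have j2 : Integrable fun x => F x * e x * partialD i ρ (x - y) :=
    integrable_mul_of_tsupport_subset (U := univ) (locallyIntegrableOn_univ.2
      (hmul hFl he.continuous)) ((continuous_partialD hρ1 i).comp
        (continuous_id.sub continuous_const)) ((hasCompactSupport_partialD hρc i).comp_homeomorph
        (Homeomorph.subRight y)) (subset_univ _)
  rw [← integral_add j1 j2]
  simp_rw [hD] at key
  calc _ = ∫ x, F x * (partialD i e x * ρ (x - y) + e x * partialD i ρ (x - y)) := by
        congr 1; ext x; ring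
    _ = _ := by rw [key]; simp only [mul_assoc]

end PeriodicIntegration

/-! ### Fourier coefficients of weak derivatives -/

section FourierWeakDeriv

variable {L : Fin 3 → ℝ}

lemma hasWeakDeriv_univ_of_ball {i : Fin 3} {F G : E3 → ℝ}
    (h : ∀ n : ℕ, HasWeakDeriv (Metric.ball 0 n) i F G) : HasWeakDeriv univ i F G := by
  have hmem : ∀ x : E3, ∃ n : ℕ, x ∈ Metric.ball (0 : E3) n := fun x => by
    obtain ⟨n, hn⟩ := exists_nat_gt ‖x‖
    exact ⟨n, mem_ball_zero_iff.2 hn⟩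
  have hloc : ∀ {g : E3 → ℝ}, (∀ n : ℕ, LocallyIntegrableOn g (Metric.ball 0 n) volume) →
      LocallyIntegrable g volume := by
    intro g hg x
    obtain ⟨n, hn⟩ := hmem x
    have := hg n x hn
    rwa [Metric.isOpen_ball.nhdsWithin_eq hn] at this
  refine ⟨locallyIntegrableOn_univ.2 (hloc fun n => (h n).1),
    locallyIntegrableOn_univ.2 (hloc fun n => (h n).2.1), fun φ hφ hc _ => ?_⟩
  obtain ⟨R, hR⟩ := hc.isCompact.isBounded.subset_ball (0 : E3)
  obtain ⟨n, hn⟩ := exists_nat_ge R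
  have hs : tsupport φ ⊆ Metric.ball (0 : E3) n := hR.trans (Metric.ball_subset_ball hn)
  have key := (h n).2.2 φ hφ hc hs
  rw [setIntegral_mul_eq_integral hs,
    setIntegral_mul_eq_integral ((tsupport_partialD_subset i φ).trans hs)] at key
  simpa using key

lemma HasWeakDeriv.comp_add {i : Fin 3} {F G : E3 → ℝ} (h : HasWeakDeriv univ i F G) (v : E3) :
    HasWeakDeriv univ i (fun x => F (x + v)) (fun x => G (x + v)) := by
  have hloc : ∀ {g : E3 → ℝ}, LocallyIntegrableOn g univ volume →
      LocallyIntegrableOn (fun x => g (x + v)) univ volume := by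
    intro g hg
    rw [locallyIntegrableOn_univ] at hg ⊢
    have := (locallyIntegrable_map_homeomorph (Homeomorph.addRight v) (f := g)
      (μ := volume)).1 (by
        rw [Homeomorph.coe_addRight, (measurePreserving_add_right volume v).map_eq]
        exact hg)
    exact this
  refine ⟨hloc h.1, hloc h.2.1, fun φ hφ hc _ => ?_⟩
  have key := h.2.2 (fun x => φ (x - v)) (hφ.comp (contDiff_id.sub contDiff_const))
    (hc.comp_homeomorph (Homeomorph.subRight v)) (subset_univ _)
  simp only [Measure.restrict_univ] at key ⊢
  have hD : ∀ x, partialD i (fun x => φ (x - v)) x = partialD i φ (x - v) := fun x => by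
    rw [partialD, fderiv_comp_sub, partialD]
  simp_rw [hD] at key
  rw [← integral_add_right_eq_self _ v, ← integral_add_right_eq_self
    (fun x => G x * φ (x - v)) v] at key
  simpa using key

/-- The weak derivatives of a periodic function on all balls are the restrictions of one periodic
function. -/
lemma MemHloc.exists_weakDeriv_univ {m : ℕ} {F : E3 → ℝ} (h : MemHloc (m + 1) F)
    (hF : BoxPeriodic L F) (hL : ∀ i, 0 < L i) (i : Fin 3) :
    ∃ G, HasWeakDeriv univ i F G ∧ BoxPeriodic L G ∧ MemHloc m G := by
  -- On the `n`-th shell, `G` is the weak derivative on the ball of radius `n`.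
  set G : E3 → ℝ := fun x => weakDeriv (Metric.ball 0 ((⌊‖x‖⌋₊ + 1 : ℕ) : ℝ)) i F x
  have hG : ∀ n : ℕ, weakDeriv (Metric.ball 0 (n : ℝ)) i F
      =ᵐ[volume.restrict (Metric.ball 0 (n : ℝ))] G := by
    intro n
    have h1 : ∀ j : ℕ, j ≤ n → ∀ᵐ x, x ∈ Metric.ball (0 : E3) (j : ℝ) →
        weakDeriv (Metric.ball 0 (n : ℝ)) i F x = weakDeriv (Metric.ball 0 (j : ℝ)) i F x := by
      intro j hj
      have := ((((h (n : ℝ)).hasWeakDeriv i).mono (Metric.ball_subset_ball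
        (by exact_mod_cast hj : (j : ℝ) ≤ n))).unique Metric.isOpen_ball
          ((h (j : ℝ)).hasWeakDeriv i))
      rwa [EventuallyEq, ae_restrict_iff' Metric.isOpen_ball.measurableSet] at this
    have h2 : ∀ᵐ x, ∀ j : ℕ, j ≤ n → x ∈ Metric.ball (0 : E3) (j : ℝ) →
        weakDeriv (Metric.ball 0 (n : ℝ)) i F x = weakDeriv (Metric.ball 0 (j : ℝ)) i F x := by
      refine ae_all_iff.2 fun j => ?_
      by_cases hj : j ≤ n
      · filter_upwards [h1 j hj] with x hx _ using hx
      · exact Eventually.of_forall fun x hj' => absurd hj' hj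
    rw [EventuallyEq, ae_restrict_iff' Metric.isOpen_ball.measurableSet]
    filter_upwards [h2] with x hx hxn
    have hlt : ‖x‖ < n := mem_ball_zero_iff.1 hxn
    refine hx _ ?_ ?_
    · exact Nat.succ_le_of_lt ((Nat.floor_lt (norm_nonneg x)).2 hlt)
    · rw [mem_ball_zero_iff]
      exact_mod_cast Nat.lt_floor_add_one ‖x‖
  have hD : HasWeakDeriv univ i F G := hasWeakDeriv_univ_of_ball fun n =>
    ((h n).hasWeakDeriv i).congr (ae_eq_refl _) (hG n)
  have hmem : MemHloc m G := fun R => by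
    obtain ⟨n, hn⟩ := exists_nat_ge R
    exact (((h n).weakDeriv Metric.isOpen_ball i).congr (hG n)).mono_set
      (Metric.ball_subset_ball hn)
  have hper : IsPeriodic L G := fun j k => by
    have h1 := hD.comp_add (EuclideanSpace.single j (k * L j))
    have h2 : (fun x => F (x + EuclideanSpace.single j (k * L j))) = F := by
      ext x
      have h3 : EuclideanSpace.single j (k * L j) = k • EuclideanSpace.single j (L j) := by
        ext l; simp [PiLp.smul_apply]
      have := (hF j).zsmul k x
      rwa [← h3] at this
    rw [h2] at h1
    simpa using h1.unique isOpen_univ hD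
  obtain ⟨G', hG', hGG'⟩ := hper.exists_boxPeriodic hL
  exact ⟨G', hD.congr (ae_eq_refl _) (by simpa using hGG'), hG',
    fun R => (hmem R).congr (ae_restrict_of_ae hGG')⟩

/-- The Fourier coefficients of a real function. -/
noncomputable def coef (L : Fin 3 → ℝ) (f : E3 → ℝ) (k : Fin 3 → ℤ) : ℂ :=
  fourierCoef L (fun x => (f x : ℂ)) k

lemma coef_congr {f g : E3 → ℝ} (h : f =ᵐ[volume.restrict (box L)] g) (k : Fin 3 → ℤ) :
    coef L f k = coef L g k := by
  unfold coef fourierCoef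
  congr 1
  exact integral_congr_ae (by filter_upwards [h] with x hx; rw [hx])

/-- The phase `∑ⱼ 2π kⱼ xⱼ / Lⱼ` of the character with index `k`. -/
noncomputable def phase (L : Fin 3 → ℝ) (k : Fin 3 → ℤ) (x : E3) : ℝ := ∑ j, freq L k j * x j

lemma character_eq (k : Fin 3 → ℤ) (x : E3) :
    character L k x = Real.cos (phase L k x) + Complex.I * Real.sin (phase L k x) := by
  rw [character, phase, mul_comm, Complex.exp_mul_I, Complex.ofReal_cos, Complex.ofReal_sin,
    mul_comm Complex.I]

lemma contDiff_phase (k : Fin 3 → ℤ) {n : WithTop ℕ∞} : ContDiff ℝ n (phase L k) := by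
  unfold phase; fun_prop

lemma hasFDerivAt_phase (k : Fin 3 → ℤ) (x : E3) :
    HasFDerivAt (phase L k) (∑ j, freq L k j • EuclideanSpace.proj (𝕜 := ℝ) j : E3 →L[ℝ] ℝ) x := by
  have : phase L k = (∑ j, freq L k j • EuclideanSpace.proj (𝕜 := ℝ) j : E3 →L[ℝ] ℝ) := by
    ext y; simp [phase]
  rw [this]
  exact ContinuousLinearMap.hasFDerivAt _

lemma sum_proj_single (k : Fin 3 → ℤ) (i : Fin 3) :
    (∑ j, freq L k j • EuclideanSpace.proj (𝕜 := ℝ) j : E3 →L[ℝ] ℝ) (EuclideanSpace.single i 1)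
      = freq L k i := by
  simp

lemma partialD_cos_phase (k : Fin 3 → ℤ) (i : Fin 3) (x : E3) :
    partialD i (fun y => Real.cos (phase L k y)) x = -freq L k i * Real.sin (phase L k x) := by
  rw [partialD, (hasFDerivAt_phase k x).cos.fderiv, _root_.smul_apply,
    sum_proj_single, smul_eq_mul]
  ring

lemma partialD_sin_phase (k : Fin 3 → ℤ) (i : Fin 3) (x : E3) :
    partialD i (fun y => Real.sin (phase L k y)) x = freq L k i * Real.cos (phase L k x) := by
  rw [partialD, (hasFDerivAt_phase k x).sin.fderiv, _root_.smul_apply,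
    sum_proj_single, smul_eq_mul]
  ring

lemma phase_add_single (hL : ∀ i, 0 < L i) (k : Fin 3 → ℤ) (i : Fin 3) (x : E3) :
    phase L k (x + EuclideanSpace.single i (L i)) = phase L k x + k i * (2 * Real.pi) := by
  have : phase L k (EuclideanSpace.single i (L i)) = k i * (2 * Real.pi) := by
    have := (hL i).ne'
    simp [phase, freq]
    field_simp
  rw [← this]
  simp [phase, mul_add, Finset.sum_add_distrib]

lemma boxPeriodic_cos_phase (hL : ∀ i, 0 < L i) (k : Fin 3 → ℤ) :
    BoxPeriodic L fun x => Real.cos (phase L k x) := fun i x => by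
  simp only [phase_add_single hL, Real.cos_add_int_mul_two_pi]

lemma boxPeriodic_sin_phase (hL : ∀ i, 0 < L i) (k : Fin 3 → ℤ) :
    BoxPeriodic L fun x => Real.sin (phase L k x) := fun i x => by
  simp only [phase_add_single hL, Real.sin_add_int_mul_two_pi]

lemma integrable_mul_of_bound {α : Type*} [MeasurableSpace α] {μ : Measure α} {f g : α → ℝ}
    (hf : Integrable f μ) (hg : AEStronglyMeasurable g μ) (C : ℝ) (hC : ∀ x, |g x| ≤ C) :
    Integrable (fun x => f x * g x) μ :=
  hf.mul_bdd hg (Eventually.of_forall hC)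

lemma integral_character_mul {f : E3 → ℝ} (hf : Integrable f (volume.restrict (box L)))
    (k : Fin 3 → ℤ) :
    ∫ x in box L, character L k x * f x
      = ((∫ x in box L, f x * Real.cos (phase L k x) : ℝ) : ℂ)
        + Complex.I * ((∫ x in box L, f x * Real.sin (phase L k x) : ℝ) : ℂ) := by
  have hc := integrable_mul_of_bound hf (g := fun x => Real.cos (phase L k x))
    (Real.continuous_cos.comp (contDiff_phase k (n := 0)).continuous).aestronglyMeasurable 1
    (fun x => Real.abs_cos_le_one _)
  have hs := integrable_mul_of_bound hf (g := fun x => Real.sin (phase L k x))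
    (Real.continuous_sin.comp (contDiff_phase k (n := 0)).continuous).aestronglyMeasurable 1
    (fun x => Real.abs_sin_le_one _)
  rw [← integral_complex_ofReal, ← integral_complex_ofReal, ← integral_const_mul,
    ← integral_add hc.ofReal (hs.ofReal.const_mul _)]
  refine integral_congr_ae (Eventually.of_forall fun x => ?_)
  simp only [character_eq]
  push_cast
  ring

lemma freq_neg (k : Fin 3 → ℤ) (j : Fin 3) : freq L (-k) j = -freq L k j := by
  simp [freq, neg_div]

/-- Integration by parts against the characters determines the Fourier coefficients of a
derivative. -/
lemma coef_eq_of_integral_partialD {f g : E3 → ℝ} {i : Fin 3} {k : Fin 3 → ℤ}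
    (hf : Integrable f (volume.restrict (box L))) (hg : Integrable g (volume.restrict (box L)))
    (h1 : ∫ x in box L, f x * partialD i (fun y => Real.cos (phase L (-k) y)) x
      = - ∫ x in box L, g x * Real.cos (phase L (-k) x))
    (h2 : ∫ x in box L, f x * partialD i (fun y => Real.sin (phase L (-k) y)) x
      = - ∫ x in box L, g x * Real.sin (phase L (-k) x)) :
    coef L g k = Complex.I * freq L k i * coef L f k := by
  unfold coef fourierCoef
  rw [integral_character_mul hf, integral_character_mul hg]
  simp only [partialD_cos_phase, partialD_sin_phase, freq_neg] at h1 h2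
  have e1 : ∫ x in box L, f x * (- -freq L k i * Real.sin (phase L (-k) x))
      = freq L k i * ∫ x in box L, f x * Real.sin (phase L (-k) x) := by
    rw [← integral_const_mul]; congr 1; ext x; ring
  have e2 : ∫ x in box L, f x * (-freq L k i * Real.cos (phase L (-k) x))
      = -freq L k i * ∫ x in box L, f x * Real.cos (phase L (-k) x) := by
    rw [← integral_const_mul]; congr 1; ext x; ring
  rw [e1] at h1
  rw [e2] at h2
  have h1' : ∫ x in box L, g x * Real.cos (phase L (-k) x)
      = -(freq L k i * ∫ x in box L, f x * Real.sin (phase L (-k) x)) := by linarith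
  have h2' : ∫ x in box L, g x * Real.sin (phase L (-k) x)
      = freq L k i * ∫ x in box L, f x * Real.cos (phase L (-k) x) := by linarith
  rw [h1', h2']
  push_cast
  linear_combination (-(∏ i, (L i : ℂ))⁻¹ * freq L k i
    * ((∫ x in box L, f x * Real.sin (phase L (-k) x) : ℝ) : ℂ)) * Complex.I_sq

/-- The weak derivatives of a function in `V^{m+1}` lie in `V^m`, and they may be integrated by
parts over the box against smooth periodic functions. -/
lemma MemV.weakDeriv_spec (hL : ∀ i, 0 < L i) {m : ℕ} {f : E3 → ℝ} (h : MemV L (m + 1) f)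
    (i : Fin 3) : MemV L m (weakDeriv (box L) i f) ∧
      ∀ e : E3 → ℝ, ContDiff ℝ (⊤ : ℕ∞) e → BoxPeriodic L e →
        ∫ x in box L, f x * partialD i e x = - ∫ x in box L, weakDeriv (box L) i f x * e x := by
  obtain ⟨F, hF, hper, hf⟩ := h.exists_boxPeriodic hL
  obtain ⟨G, hFG, hGper, hG⟩ := hF.exists_weakDeriv_univ hper hL i
  have hD : weakDeriv (box L) i f =ᵐ[volume.restrict (box L)] G :=
    ((hFG.mono (subset_univ _)).congr hf.symm (ae_eq_refl _)).weakDeriv_ae_eq (isOpen_box L)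
  have hGP : IsPeriodic L G := fun j n => Eventually.of_forall fun x => by
    have h3 : EuclideanSpace.single j (n * L j) = n • EuclideanSpace.single j (L j) := by
      ext l; simp [PiLp.smul_apply]
    have := (hGper j).zsmul n x
    rwa [← h3] at this
  refine ⟨⟨G, hG, hGP, hD⟩, fun e he hper' => ?_⟩
  have h1 := integral_weakDeriv_mul_of_boxPeriodic hL hFG hper hGper he hper'
  have e1 : ∫ x in box L, f x * partialD i e x = ∫ x in box L, F x * partialD i e x :=
    integral_congr_ae (by filter_upwards [hf] with x hx; rw [hx])
  have e2 : ∫ x in box L, weakDeriv (box L) i f x * e x = ∫ x in box L, G x * e x :=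
    integral_congr_ae (by filter_upwards [hD] with x hx; rw [hx])
  rw [e1, e2, h1]

lemma MemV.memLp {m : ℕ} {f : E3 → ℝ} (h : MemV L m f) : MemLp f 2 (volume.restrict (box L)) := by
  obtain ⟨F, hF, -, hf⟩ := h
  obtain ⟨R, -, hR⟩ := box_subset_ball L
  exact (memLp_congr_ae hf).2 ((hF R).mono_set hR).memLp

lemma contDiff_cos_phase (k : Fin 3 → ℤ) :
    ContDiff ℝ (⊤ : ℕ∞) fun x => Real.cos (phase L k x) :=
  Real.contDiff_cos.comp (contDiff_phase k)

lemma contDiff_sin_phase (k : Fin 3 → ℤ) :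
    ContDiff ℝ (⊤ : ℕ∞) fun x => Real.sin (phase L k x) :=
  Real.contDiff_sin.comp (contDiff_phase k)

lemma MemV.coef_weakDeriv (hL : ∀ i, 0 < L i) {m : ℕ} {f : E3 → ℝ} (h : MemV L (m + 1) f)
    (i : Fin 3) (k : Fin 3 → ℤ) :
    coef L (weakDeriv (box L) i f) k = Complex.I * freq L k i * coef L f k := by
  obtain ⟨h1, h2⟩ := h.weakDeriv_spec hL i
  exact coef_eq_of_integral_partialD (h.memLp.integrable (by norm_num))
    (h1.memLp.integrable (by norm_num))
    (h2 _ (contDiff_cos_phase (-k)) (boxPeriodic_cos_phase hL (-k)))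
    (h2 _ (contDiff_sin_phase (-k)) (boxPeriodic_sin_phase hL (-k)))

end FourierWeakDeriv

/-! ### Absolutely convergent Fourier series -/

section FourierSeries

variable {L : Fin 3 → ℝ}

lemma norm_character (k : Fin 3 → ℤ) (x : E3) : ‖character L k x‖ = 1 := by
  rw [character, mul_comm, Complex.norm_exp_ofReal_mul_I]

lemma continuous_character (k : Fin 3 → ℤ) : Continuous (character L k) := by
  unfold character; fun_prop

lemma character_add (k m : Fin 3 → ℤ) (x : E3) :
    character L (k + m) x = character L k x * character L m x := by
  rw [character, character, character, ← Complex.exp_add]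
  congr 1
  rw [← mul_add, ← Complex.ofReal_add, ← Finset.sum_add_distrib]
  congr 2
  refine Finset.sum_congr rfl fun j _ => ?_
  simp only [freq, Pi.add_apply]
  push_cast
  ring

lemma character_zero (x : E3) : character L 0 x = 1 := by
  simp [character, freq]

lemma integral_character (hL : ∀ i, 0 < L i) (k : Fin 3 → ℤ) :
    ∫ x in box L, character L k x = if k = 0 then ((∏ i, L i : ℝ) : ℂ) else 0 := by
  split_ifs with hk
  · subst hk
    simp [character_zero, ← volume_real_box hL]
  · obtain ⟨i, hi⟩ : ∃ i, k i ≠ 0 := Function.ne_iff.1 hk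
    have hf : freq L k i ≠ 0 := by
      have := (hL i).ne'
      have := Real.pi_ne_zero
      unfold freq
      positivity
    have h0 : HasWeakDeriv univ i (fun _ : E3 => (1 : ℝ)) (fun _ => 0) := by
      have := hasWeakDeriv_of_contDiff (f := fun _ : E3 => (1 : ℝ)) contDiff_const univ i
      have e : partialD i (fun _ : E3 => (1 : ℝ)) = fun _ => 0 := by
        ext x; simp [partialD]
      rwa [e] at this
    have h1 := integral_weakDeriv_mul_of_boxPeriodic hL h0 (fun _ _ => rfl) (fun _ _ => rfl)
      (contDiff_cos_phase k) (boxPeriodic_cos_phase hL k)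
    have h2 := integral_weakDeriv_mul_of_boxPeriodic hL h0 (fun _ _ => rfl) (fun _ _ => rfl)
      (contDiff_sin_phase k) (boxPeriodic_sin_phase hL k)
    simp only [partialD_cos_phase, partialD_sin_phase, one_mul, zero_mul,
      integral_zero, neg_zero, integral_const_mul, mul_eq_zero, neg_eq_zero, hf, false_or] at h1 h2
    have := integral_character_mul (L := L) (f := fun _ => (1 : ℝ)) (integrable_const 1) k
    simpa [h1, h2] using this

/-- The sum of the Fourier series with coefficients `c`. -/
noncomputable def fourierSeries (L : Fin 3 → ℝ) (c : (Fin 3 → ℤ) → ℂ) (x : E3) : ℂ :=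
  ∑' k, c k * character L k x

lemma norm_mul_character (c : ℂ) (k : Fin 3 → ℤ) (x : E3) : ‖c * character L k x‖ = ‖c‖ := by
  rw [norm_mul, norm_character, mul_one]

lemma continuous_fourierSeries {c : (Fin 3 → ℤ) → ℂ} (hc : Summable fun k => ‖c k‖) :
    Continuous (fourierSeries L c) :=
  continuous_tsum (fun k => continuous_const.mul (continuous_character k)) hc
    fun _ _ => (norm_mul_character _ _ _).le

lemma memLp_of_continuous {E : Type*} [NormedAddCommGroup E] {f : E3 → E} (hf : Continuous f) :
    MemLp f 2 (volume.restrict (box L)) := by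
  obtain ⟨R, hR, hbox⟩ := box_subset_ball L
  obtain ⟨C, hC⟩ := (isCompact_closedBall (0 : E3) R).exists_bound_of_continuousOn hf.continuousOn
  refine MemLp.of_bound hf.aestronglyMeasurable C ?_
  filter_upwards [ae_restrict_mem (isOpen_box L).measurableSet] with x hx
  exact hC x (Metric.ball_subset_closedBall (hbox hx))

lemma integrable_of_memLp {E : Type*} [NormedAddCommGroup E] {f : E3 → E}
    (hf : MemLp f 2 (volume.restrict (box L))) : Integrable f (volume.restrict (box L)) :=
  hf.integrable (by norm_num)

lemma integrable_character_mul {f : E3 → ℂ} (hf : Integrable f (volume.restrict (box L)))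
    (k : Fin 3 → ℤ) : Integrable (fun x => character L k x * f x) (volume.restrict (box L)) :=
  hf.bdd_mul (continuous_character k).aestronglyMeasurable
    (Eventually.of_forall fun x => (norm_character k x).le)

lemma fourierCoef_sub {f g : E3 → ℂ} (hf : Integrable f (volume.restrict (box L)))
    (hg : Integrable g (volume.restrict (box L))) (k : Fin 3 → ℤ) :
    fourierCoef L (fun x => f x - g x) k = fourierCoef L f k - fourierCoef L g k := by
  unfold fourierCoef
  rw [← mul_sub, ← integral_sub (integrable_character_mul hf _) (integrable_character_mul hg _)]
  simp only [mul_sub]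

lemma fourierCoef_fourierSeries (hL : ∀ i, 0 < L i) {c : (Fin 3 → ℤ) → ℂ}
    (hc : Summable fun k => ‖c k‖) (k : Fin 3 → ℤ) :
    fourierCoef L (fourierSeries L c) k = c k := by
  have hpos : 0 < ∏ i, L i := Finset.prod_pos fun i _ => hL i
  have h1 : ∀ m x, character L (-k) x * (c m * character L m x)
      = c m * character L (m - k) x := fun m x => by
    rw [sub_eq_neg_add, character_add]; ring
  have hint : ∀ m, Integrable (fun x => c m * character L (m - k) x) (volume.restrict (box L)) :=
    fun m => integrable_of_memLp (memLp_of_continuous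
      (continuous_const.mul (continuous_character _)))
  have hsum : Summable fun m => ∫ x in box L, ‖c m * character L (m - k) x‖ := by
    simp only [norm_mul_character, integral_const, smul_eq_mul]
    exact hc.mul_left _
  have h2 := (hasSum_integral_of_summable_integral_norm hint hsum).tsum_eq
  simp only [integral_const_mul, integral_character hL, sub_eq_zero] at h2
  rw [tsum_eq_single k (fun m hm => by simp [hm]), if_pos rfl] at h2
  unfold fourierCoef fourierSeries
  simp only [← tsum_mul_left, h1]
  rw [← h2]
  have : ((∏ i, L i : ℝ) : ℂ) ≠ 0 := by exact_mod_cast hpos.ne'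
  push_cast at this ⊢
  field_simp

/-- A square integrable function on the box is determined by its Fourier coefficients. -/
lemma ae_eq_of_fourierCoef_eq (hL : ∀ i, 0 < L i) {f g : E3 → ℂ}
    (hf : MemLp f 2 (volume.restrict (box L))) (hg : MemLp g 2 (volume.restrict (box L)))
    (h : ∀ k, fourierCoef L f k = fourierCoef L g k) : f =ᵐ[volume.restrict (box L)] g := by
  have hpos : 0 < ∏ i, L i := Finset.prod_pos fun i _ => hL i
  have h1 := hasSum_sq_fourierCoef hL (hf.sub hg)
  have h2 : ∀ k, fourierCoef L (f - g) k = 0 := fun k => by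
    have := fourierCoef_sub (integrable_of_memLp hf) (integrable_of_memLp hg) k
    rw [h k, sub_self] at this
    exact this
  simp only [h2, norm_zero, ne_eq, OfNat.ofNat_ne_zero, not_false_eq_true, zero_pow] at h1
  have h3 := h1.unique hasSum_zero
  rw [mul_eq_zero, or_iff_right (inv_ne_zero hpos.ne'), integral_eq_zero_iff_of_nonneg
    (fun x => by positivity) ((hf.sub hg).integrable_norm_pow two_ne_zero)] at h3
  filter_upwards [h3] with x hx
  simpa [sub_eq_zero] using hx

lemma ae_eq_fourierSeries (hL : ∀ i, 0 < L i) {f : E3 → ℂ}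
    (hf : MemLp f 2 (volume.restrict (box L))) (hc : Summable fun k => ‖fourierCoef L f k‖) :
    f =ᵐ[volume.restrict (box L)] fourierSeries L (fourierCoef L f) :=
  ae_eq_of_fourierCoef_eq hL hf (memLp_of_continuous (continuous_fourierSeries hc))
    fun k => (fourierCoef_fourierSeries hL hc k).symm

/-- The eigenvalue of `-Δ` for the `k`-th character. -/
noncomputable def lam (L : Fin 3 → ℝ) (k : Fin 3 → ℤ) : ℝ := ∑ i, freq L k i ^ 2

lemma lam_nonneg (k : Fin 3 → ℤ) : 0 ≤ lam L k := Finset.sum_nonneg fun _ _ => sq_nonneg _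

lemma summable_inv_one_add_lam_sq (hL : ∀ i, 0 < L i) :
    Summable fun k => ((1 + lam L k) ^ 2)⁻¹ := by
  have hL' : ∀ i, 0 < 2 * Real.pi / L i := fun i => by
    have := hL i
    positivity
  set b := periodBasis hL'
  set e := (b.restrictScalars ℤ).equivFun
  have hfin : Module.finrank ℤ (Submodule.span ℤ (Set.range b)) = 3 := by
    rw [Module.finrank_eq_card_basis (b.restrictScalars ℤ), Fintype.card_fin]
  have h1 := ZLattice.summable_norm_pow_inv (Submodule.span ℤ (Set.range b)) 4 (by rw [hfin]; simp)
  have h2 := (e.symm.toEquiv.summable_iff).2 h1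
  have hnorm : ∀ k, ‖e.symm k‖ ^ 2 = lam L k := fun k => by
    have : ((e.symm k : Submodule.span ℤ (Set.range b)) : E3)
        = ∑ i, k i • EuclideanSpace.single i (2 * Real.pi / L i) := by
      simp only [e, Module.Basis.equivFun_symm_apply]
      push_cast
      refine Finset.sum_congr rfl fun i _ => ?_
      rw [Module.Basis.restrictScalars_apply, periodBasis_apply]
    rw [Submodule.coe_norm, this, EuclideanSpace.norm_sq_eq, lam]
    refine Finset.sum_congr rfl fun j _ => ?_
    have h5 : (∑ i, k i • EuclideanSpace.single i (2 * Real.pi / L i) : E3) j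
        = k j * (2 * Real.pi / L j) := by simp [Pi.single_apply]
    rw [h5, Real.norm_eq_abs, sq_abs, freq]
    ring
  refine h2.of_norm_bounded_eventually ?_
  have hev : ∀ᶠ k in cofinite, k ≠ (0 : Fin 3 → ℤ) := by simp
  filter_upwards [hev] with k hk
  have hpos : 0 < ‖e.symm k‖ := norm_pos_iff.2 (by simpa using hk)
  have h3 : (0 : ℝ) < ‖e.symm k‖ ^ 4 := by positivity
  simp only [Function.comp_apply, LinearEquiv.coe_toEquiv, inv_pow]
  rw [Real.norm_of_nonneg (by have := lam_nonneg (L := L) k; positivity)]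
  refine inv_anti₀ h3 ?_
  have h4 : ‖e.symm k‖ ^ 4 = lam L k ^ 2 := by rw [← hnorm]; ring
  rw [h4]
  have := lam_nonneg (L := L) k
  nlinarith

lemma summable_of_weighted {s : (Fin 3 → ℤ) → ℝ} (hL : ∀ i, 0 < L i)
    (hs0 : ∀ k, 0 ≤ s k) (hs : Summable fun k => (1 + lam L k) ^ 2 * s k ^ 2) : Summable s := by
  refine Summable.of_nonneg_of_le hs0 (fun k => ?_)
    ((hs.add (summable_inv_one_add_lam_sq hL)).mul_left (1 / 2))
  have h : 0 < 1 + lam L k := by linarith [lam_nonneg (L := L) k]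
  have := sq_nonneg ((1 + lam L k) * s k - (1 + lam L k)⁻¹)
  have h1 : (1 + lam L k) * (1 + lam L k)⁻¹ = 1 := mul_inv_cancel₀ h.ne'
  have h2 : ((1 + lam L k) * s k - (1 + lam L k)⁻¹) ^ 2
      = (1 + lam L k) ^ 2 * s k ^ 2 - 2 * s k * ((1 + lam L k) * (1 + lam L k)⁻¹)
        + ((1 + lam L k) ^ 2)⁻¹ := by rw [← inv_pow]; ring
  rw [h1] at h2
  linarith

/-- Parseval's identity on the box, with values in `[0, ∞]`. -/
lemma tsum_sq_coef (hL : ∀ i, 0 < L i) {f : E3 → ℝ} (hf : MemLp f 2 (volume.restrict (box L))) :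
    ∑' k, ‖coef L f k‖ₑ ^ 2 = ENNReal.ofReal (∏ i, L i)⁻¹ * ∫⁻ x in box L, ‖f x‖ₑ ^ 2 := by
  have hpos : 0 < ∏ i, L i := Finset.prod_pos fun i _ => hL i
  have h1 := hasSum_sq_fourierCoef hL (f := fun x => (f x : ℂ)) hf.ofReal
  have h2 : ∫⁻ x in box L, ‖f x‖ₑ ^ 2 = ENNReal.ofReal (∫ x in box L, ‖(f x : ℂ)‖ ^ 2) := by
    rw [ofReal_integral_eq_lintegral_ofReal]
    · refine lintegral_congr fun x => ?_
      rw [ENNReal.ofReal_pow (norm_nonneg _), Complex.norm_real, ofReal_norm]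
    · exact hf.ofReal.integrable_norm_pow two_ne_zero
    · exact Eventually.of_forall fun x => by positivity
  rw [h2, ← ENNReal.ofReal_mul (inv_pos.2 hpos).le, ← h1.tsum_eq,
    ENNReal.ofReal_tsum_of_nonneg (fun k => by positivity) h1.summable]
  refine tsum_congr fun k => ?_
  rw [ENNReal.ofReal_pow (norm_nonneg _), ofReal_norm]
  rfl

lemma sqNormH_le_succ (U : Set E3) (m : ℕ) (f : E3 → ℝ) :
    sqNormH U m f ≤ sqNormH U (m + 1) f := by
  induction m generalizing f with
  | zero => exact lintegral_sq_le_sqNormH U 1 f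
  | succ m ih =>
    exact add_le_add_right (Finset.sum_le_sum fun i _ => ih _) _

lemma MemHloc.pred {m : ℕ} {f : E3 → ℝ} (h : MemHloc (m + 1) f) : MemHloc m f := by
  have key : ∀ {U : Set E3} {m : ℕ} {f : E3 → ℝ}, MemH U (m + 1) f → MemH U m f := by
    intro U m
    induction m with
    | zero => exact fun h => h.1
    | succ m ih => exact fun h => ⟨h.1, fun i => (h.2 i).imp fun g hg => ⟨hg.1, ih hg.2⟩⟩
  exact fun R => key (h R)

lemma MemV.pred {m : ℕ} {f : E3 → ℝ} (h : MemV L (m + 1) f) : MemV L m f := by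
  obtain ⟨F, hF, hper, hf⟩ := h
  exact ⟨F, hF.pred, hper, hf⟩

lemma tsum_weight_coef_succ_le {m : ℕ} {f : E3 → ℝ} {g : Fin 3 → E3 → ℝ}
    (hg : ∀ i k, coef L (g i) k = Complex.I * freq L k i * coef L f k) :
    ∑' k, ENNReal.ofReal ((1 + lam L k) ^ (m + 1)) * ‖coef L f k‖ₑ ^ 2
      = (∑' k, ENNReal.ofReal ((1 + lam L k) ^ m) * ‖coef L f k‖ₑ ^ 2)
        + ∑ i, ∑' k, ENNReal.ofReal ((1 + lam L k) ^ m) * ‖coef L (g i) k‖ₑ ^ 2 := by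
  rw [← Summable.tsum_finsetSum (fun i _ => ENNReal.summable), ← ENNReal.tsum_add]
  refine tsum_congr fun k => ?_
  have h1 : ∀ i, ‖coef L (g i) k‖ₑ ^ 2 = ENNReal.ofReal (freq L k i ^ 2) * ‖coef L f k‖ₑ ^ 2 := by
    intro i
    rw [hg, enorm_mul, enorm_mul, mul_pow, mul_pow]
    have h3 : ‖Complex.I‖ₑ = 1 := by rw [← ofReal_norm]; simp
    have h4 : ‖(freq L k i : ℂ)‖ₑ ^ 2 = ENNReal.ofReal (freq L k i ^ 2) := by
      rw [← ofReal_norm, ← ENNReal.ofReal_pow (norm_nonneg _), Complex.norm_real,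
        Real.norm_eq_abs, sq_abs]
    rw [h3, h4, one_pow, one_mul]
  have hl : 0 ≤ lam L k := lam_nonneg k
  simp only [h1]
  rw [← Finset.mul_sum, ← Finset.sum_mul, ← ENNReal.ofReal_sum_of_nonneg
    (fun i _ => sq_nonneg _), ← mul_assoc, ← add_mul, ← ENNReal.ofReal_mul (by positivity),
    ← ENNReal.ofReal_add (by positivity) (mul_nonneg (by positivity)
      (Finset.sum_nonneg fun _ _ => sq_nonneg _))]
  congr 2
  rw [show ∑ i, freq L k i ^ 2 = lam L k from rfl]
  ring

/-- The norm of `V^m` controls the Fourier coefficients with the weights `(1 + lam L k) ^ m`. -/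
lemma MemV.tsum_weight_coef_le (hL : ∀ i, 0 < L i) {m : ℕ} {f : E3 → ℝ} (h : MemV L m f) :
    ∑' k, ENNReal.ofReal ((1 + lam L k) ^ m) * ‖coef L f k‖ₑ ^ 2
      ≤ 2 ^ m * ENNReal.ofReal (∏ i, L i)⁻¹ * sqNormH (box L) m f := by
  induction m generalizing f with
  | zero =>
    simp only [pow_zero, ENNReal.ofReal_one, one_mul]
    exact (tsum_sq_coef hL h.memLp).le
  | succ m ih =>
    rw [tsum_weight_coef_succ_le (g := fun i => weakDeriv (box L) i f)
      (h.coef_weakDeriv hL)]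
    set C := ENNReal.ofReal (∏ i, L i)⁻¹
    calc _ ≤ 2 ^ m * C * sqNormH (box L) m f
          + ∑ i, 2 ^ m * C * sqNormH (box L) m (weakDeriv (box L) i f) :=
          add_le_add (ih h.pred) (Finset.sum_le_sum fun i _ => ih (h.weakDeriv_spec hL i).1)
      _ ≤ 2 ^ m * C * sqNormH (box L) (m + 1) f + 2 ^ m * C * sqNormH (box L) (m + 1) f := by
          rw [← Finset.mul_sum]
          gcongr
          · exact sqNormH_le_succ _ _ _
          · exact sum_sqNormH_le _ _ _
      _ = 2 ^ (m + 1) * C * sqNormH (box L) (m + 1) f := by ring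

lemma summable_of_tsum_enorm {w : (Fin 3 → ℤ) → ℝ} {c : (Fin 3 → ℤ) → ℂ} (hw : ∀ k, 0 ≤ w k)
    (h : ∑' k, ENNReal.ofReal (w k) * ‖c k‖ₑ ^ 2 < ∞) : Summable fun k => w k * ‖c k‖ ^ 2 := by
  have h1 : ∀ k, ENNReal.ofReal (w k) * ‖c k‖ₑ ^ 2 = ENNReal.ofReal (w k * ‖c k‖ ^ 2) := fun k => by
    rw [ENNReal.ofReal_mul (hw k), ENNReal.ofReal_pow (norm_nonneg _), ofReal_norm]
  simp only [h1] at h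
  have := ENNReal.summable_toReal h.ne
  refine this.congr fun k => ?_
  rw [ENNReal.toReal_ofReal (mul_nonneg (hw k) (sq_nonneg _))]

lemma character_add_single (hL : ∀ i, 0 < L i) (k : Fin 3 → ℤ) (i : Fin 3) (x : E3) :
    character L k (x + EuclideanSpace.single i (L i)) = character L k x := by
  rw [character_eq, character_eq]
  simp only [phase_add_single hL, Real.cos_add_int_mul_two_pi, Real.sin_add_int_mul_two_pi]

lemma boxPeriodic_fourierSeries (hL : ∀ i, 0 < L i) (c : (Fin 3 → ℤ) → ℂ) :
    BoxPeriodic L (fourierSeries L c) := fun i x => by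
  simp only [fourierSeries, character_add_single hL]

lemma contDiff_fourierSeries {c : (Fin 3 → ℤ) → ℂ} (hc : Summable fun k => ‖c k‖)
    (hc' : Summable fun k => Real.sqrt (1 + lam L k) * ‖c k‖) :
    ContDiff ℝ 1 (fourierSeries L c) := by
  have hD : ∀ k x, HasFDerivAt (fun y => c k * character L k y)
      (c k • (character L k x • (Complex.I • (Complex.ofRealCLM.comp
        (∑ j, freq L k j • EuclideanSpace.proj (𝕜 := ℝ) j : E3 →L[ℝ] ℝ))))) x := fun k x => by
    have h1 := Complex.ofRealCLM.hasFDerivAt.comp x (hasFDerivAt_phase (L := L) k x)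
    have h2 := ((h1.const_smul Complex.I).cexp).const_smul (c k)
    exact h2
  have hn : ∀ k x, ‖c k • (character L k x • (Complex.I • (Complex.ofRealCLM.comp
        (∑ j, freq L k j • EuclideanSpace.proj (𝕜 := ℝ) j : E3 →L[ℝ] ℝ))))‖
      ≤ 3 * (Real.sqrt (1 + lam L k) * ‖c k‖) := fun k x => by
    rw [norm_smul, norm_smul, norm_smul, norm_character, Complex.norm_I, one_mul, one_mul, mul_comm,
      ← mul_assoc]
    refine mul_le_mul_of_nonneg_right ?_ (norm_nonneg _)
    have h1 : ‖(∑ j, freq L k j • EuclideanSpace.proj (𝕜 := ℝ) j : E3 →L[ℝ] ℝ)‖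
        ≤ 3 * Real.sqrt (1 + lam L k) := by
      refine (norm_sum_le _ _).trans ?_
      have h2 : ∀ j ∈ (Finset.univ : Finset (Fin 3)),
          ‖freq L k j • (EuclideanSpace.proj (𝕜 := ℝ) j : E3 →L[ℝ] ℝ)‖
            ≤ Real.sqrt (1 + lam L k) := fun j _ => by
        rw [norm_smul]
        have h3 : ‖(EuclideanSpace.proj (𝕜 := ℝ) j : E3 →L[ℝ] ℝ)‖ ≤ 1 :=
          ContinuousLinearMap.opNorm_le_bound _ zero_le_one fun v => by
            rw [one_mul]; exact PiLp.norm_apply_le v j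
        have h4 : ‖freq L k j‖ ≤ Real.sqrt (1 + lam L k) := by
          refine Real.abs_le_sqrt ?_
          have : freq L k j ^ 2 ≤ lam L k := Finset.single_le_sum
            (f := fun i => freq L k i ^ 2) (fun _ _ => sq_nonneg _) (Finset.mem_univ j)
          linarith
        calc _ ≤ ‖freq L k j‖ * 1 := by gcongr
          _ ≤ _ := by rwa [mul_one]
      refine (Finset.sum_le_sum h2).trans ?_
      simp
    refine (ContinuousLinearMap.opNorm_comp_le _ _).trans ?_
    rw [Complex.ofRealCLM_norm, one_mul]
    exact h1
  have hu := hc'.mul_left 3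
  have h0 : Summable fun k => c k * character L k 0 :=
    Summable.of_norm (by simpa only [norm_mul_character] using hc)
  have hF := fun x => hasFDerivAt_tsum hu hD hn h0 x
  refine contDiff_one_iff_fderiv.2 ⟨fun x => (hF x).differentiableAt, ?_⟩
  have : fderiv ℝ (fourierSeries L c) = fun x => ∑' k, (c k • (character L k x • (Complex.I •
      (Complex.ofRealCLM.comp (∑ j, freq L k j • EuclideanSpace.proj (𝕜 := ℝ) j :
        E3 →L[ℝ] ℝ))))) := funext fun x => (hF x).fderiv
  rw [this]
  refine continuous_tsum (fun k => ?_) hu hn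
  exact ((continuous_character k).smul continuous_const).const_smul (c k)

/-- Sobolev's embedding: the members of `V³` have continuously differentiable periodic
representatives. -/
theorem MemV.exists_contDiff (hL : ∀ i, 0 < L i) {f : E3 → ℝ} (h : MemV L 3 f) :
    ∃ F : E3 → ℝ, ContDiff ℝ 1 F ∧ BoxPeriodic L F ∧ f =ᵐ[volume.restrict (box L)] F := by
  have hfin : sqNormH (box L) 3 f < ∞ := by
    obtain ⟨F, hF, -, hf⟩ := h
    obtain ⟨R, -, hR⟩ := box_subset_ball L
    exact MemH.sqNormH_lt_top (isOpen_box L) (((hF R).mono_set hR).congr hf.symm)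
  have hpos : ∀ k, 0 < 1 + lam L k := fun k => by linarith [lam_nonneg (L := L) k]
  have h3 : Summable fun k => (1 + lam L k) ^ 3 * ‖coef L f k‖ ^ 2 :=
    summable_of_tsum_enorm (fun k => by have := hpos k; positivity)
      ((h.tsum_weight_coef_le hL).trans_lt (ENNReal.mul_lt_top
        (ENNReal.mul_lt_top (by simp) (by simp)) hfin))
  have hc' : Summable fun k => Real.sqrt (1 + lam L k) * ‖coef L f k‖ := by
    refine summable_of_weighted hL (fun k => by positivity) (h3.congr fun k => ?_)
    rw [mul_pow, Real.sq_sqrt (hpos k).le]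
    ring
  have hc : Summable fun k => ‖coef L f k‖ := by
    refine Summable.of_nonneg_of_le (fun k => norm_nonneg _) (fun k => ?_) hc'
    refine le_mul_of_one_le_left (norm_nonneg _) ?_
    rw [Real.one_le_sqrt]
    linarith [lam_nonneg (L := L) k]
  refine ⟨fun x => (fourierSeries L (coef L f) x).re,
    Complex.reCLM.contDiff.comp (contDiff_fourierSeries hc hc'), fun i x => ?_, ?_⟩
  · simp only [boxPeriodic_fourierSeries hL _ i x]
  · filter_upwards [ae_eq_fourierSeries hL (f := fun x => (f x : ℂ)) h.memLp.ofReal hc] with x hx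
    exact congrArg Complex.re hx

end FourierSeries

/-! ### Weak time derivatives and primitives -/

section WeakTimeDerivative

variable {T : EReal}

lemma isOpen_timeIoo (T : EReal) : IsOpen (timeIoo T) :=
  isOpen_Ioi.inter (isOpen_Iio.preimage continuous_coe_real_ereal)

lemma exists_mem_timeIoo (hT : 0 < T) : ∃ τ, τ ∈ timeIoo T := by
  obtain ⟨τ, h1, h2⟩ := EReal.lt_iff_exists_real_btwn.1 hT
  exact ⟨τ, by exact_mod_cast h1, h2⟩

lemma exists_gt_mem_timeIoo {t : ℝ} (ht : t ∈ timeIco T) : ∃ τ ∈ timeIoo T, t < τ := by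
  obtain ⟨τ, h1, h2⟩ := EReal.lt_iff_exists_real_btwn.1 ht.2
  have h3 : t < τ := by exact_mod_cast h1
  exact ⟨τ, ⟨ht.1.trans_lt h3, h2⟩, h3⟩

lemma mem_timeIoo_of_le {s t : ℝ} (ht : t ∈ timeIoo T) (hs : 0 < s) (hst : s ≤ t) :
    s ∈ timeIoo T :=
  ⟨hs, lt_of_le_of_lt (by exact_mod_cast hst) ht.2⟩

lemma timeIoo_subset_timeIco : timeIoo T ⊆ timeIco T := fun _ h => ⟨h.1.le, h.2⟩

lemma Ioo_subset_timeIoo {τ : ℝ} (hτ : τ ∈ timeIoo T) : Ioo 0 τ ⊆ timeIoo T := fun _ hs =>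
  mem_timeIoo_of_le hτ hs.1 hs.2.le

lemma exists_Icc_of_isCompact (hT : 0 < T) {K : Set ℝ} (hK : IsCompact K) (hKT : K ⊆ timeIoo T) :
    ∃ a b, a ∈ timeIoo T ∧ b ∈ timeIoo T ∧ a ≤ b ∧ K ⊆ Icc a b := by
  obtain ⟨τ, hτ⟩ := exists_mem_timeIoo hT
  rcases K.eq_empty_or_nonempty with rfl | hne
  · exact ⟨τ, τ, hτ, hτ, le_rfl, empty_subset _⟩
  · obtain ⟨a, ha⟩ := hK.exists_isLeast hne
    obtain ⟨b, hb⟩ := hK.exists_isGreatest hne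
    exact ⟨a, b, hKT ha.1, hKT hb.1, ha.2 hb.1, fun x hx => ⟨ha.2 hx, hb.2 hx⟩⟩

lemma exists_tsupport_subset_Ioo (hT : 0 < T) {K : Set ℝ} (hK : IsCompact K)
    (hKT : K ⊆ timeIoo T) : ∃ τ ∈ timeIoo T, K ⊆ Ioo 0 τ := by
  obtain ⟨a, b, ha, hb, -, hab⟩ := exists_Icc_of_isCompact hT hK hKT
  obtain ⟨τ, hτ, hbτ⟩ := exists_gt_mem_timeIoo (timeIoo_subset_timeIco hb)
  exact ⟨τ, hτ, fun x hx => ⟨ha.1.trans_le (hab hx).1, (hab hx).2.trans_lt hbτ⟩⟩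

lemma ae_Ioo_of_ae_timeIoo {p : ℝ → Prop} {τ : ℝ} (hτ : τ ∈ timeIoo T)
    (h : ∀ᵐ t ∂volume.restrict (timeIoo T), p t) : ∀ᵐ t ∂volume.restrict (Ioo 0 τ), p t :=
  ae_mono (Measure.restrict_mono (Ioo_subset_timeIoo hτ) le_rfl) h

lemma setIntegral_timeIoo_eq {E : Type*} [NormedAddCommGroup E] [NormedSpace ℝ E] {τ : ℝ}
    (hτ : τ ∈ timeIoo T) {φ : ℝ → E} (hφ : ∀ t, t ∉ Ioo 0 τ → φ t = 0) :
    ∫ t in timeIoo T, φ t = ∫ t in Ioo 0 τ, φ t := by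
  rw [setIntegral_eq_integral_of_forall_compl_eq_zero
      (fun t ht => hφ t fun h => ht (Ioo_subset_timeIoo hτ h)),
    setIntegral_eq_integral_of_forall_compl_eq_zero (fun t ht => hφ t ht)]

lemma setIntegral_Ioo_eq_intervalIntegral {E : Type*} [NormedAddCommGroup E] [NormedSpace ℝ E]
    {τ : ℝ} (hτ : 0 ≤ τ) (φ : ℝ → E) : ∫ t in Ioo 0 τ, φ t = ∫ t in (0)..τ, φ t := by
  rw [intervalIntegral.integral_of_le hτ, integral_Ioc_eq_integral_Ioo]

lemma intervalIntegrable_of_Ioo {E : Type*} [NormedAddCommGroup E] {g : ℝ → E} {τ : ℝ}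
    (hg : IntegrableOn g (Ioo 0 τ)) (hτ : 0 ≤ τ) : IntervalIntegrable g volume 0 τ := by
  rw [intervalIntegrable_iff_integrableOn_Ioc_of_le hτ, integrableOn_Ioc_iff_integrableOn_Ioo]
  exact hg

/-- A test function with vanishing integral is the derivative of a test function. -/
lemma exists_primitive_test {η : ℝ → ℝ} {a b : ℝ} (hη : ContDiff ℝ (⊤ : ℕ∞) η)
    (hs : tsupport η ⊆ Icc a b) (hab : a ≤ b) (hint : ∫ t, η t = 0) :
    ∃ ζ : ℝ → ℝ, ContDiff ℝ (⊤ : ℕ∞) ζ ∧ tsupport ζ ⊆ Icc a b ∧ deriv ζ = η := by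
  have hz : ∀ t, t ∉ Icc a b → η t = 0 := fun t ht =>
    image_eq_zero_of_notMem_tsupport fun h => ht (hs h)
  have hD : ∀ t, HasDerivAt (fun t => ∫ s in a..t, η s) (η t) t := fun t =>
    intervalIntegral.integral_hasDerivAt_right (hη.continuous.intervalIntegrable _ _)
      (hη.continuous.stronglyMeasurableAtFilter _ _) hη.continuous.continuousAt
  have hderiv : deriv (fun t => ∫ s in a..t, η s) = η := funext fun t => (hD t).deriv
  refine ⟨fun t => ∫ s in a..t, η s, ?_, ?_, hderiv⟩
  · exact contDiff_infty_iff_deriv.2 ⟨fun t => (hD t).differentiableAt, by rw [hderiv]; exact hη⟩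
  · refine closure_minimal (fun t ht => ?_) isClosed_Icc
    by_contra hn
    refine ht ?_
    rcases lt_or_ge t a with h | h
    · refine intervalIntegral.integral_zero_ae (Eventually.of_forall fun s hs' => ?_)
      rw [uIoc_of_ge h.le] at hs'
      rcases hs'.2.eq_or_lt with rfl | h2
      · by_contra h3
        have h4 : ∀ᶠ u in 𝓝[<] s, η u ≠ 0 :=
          (hη.continuous.continuousAt.eventually_ne h3).filter_mono nhdsWithin_le_nhds
        obtain ⟨u, hu, hus⟩ := (h4.and self_mem_nhdsWithin).exists
        exact hu (hz u fun h => absurd h.1 (not_le.2 hus))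
      · exact hz s fun h => absurd h.1 (not_le.2 h2)
    · have hb : b < t := by
        by_contra h3
        exact hn ⟨h, not_lt.1 h3⟩
      show ∫ s in a..t, η s = 0
      rw [← hint, intervalIntegral.integral_of_le h,
        setIntegral_eq_integral_of_ae_compl_eq_zero]
      have : ∀ᵐ s : ℝ, s ≠ a := by simp [ae_iff, measure_singleton]
      filter_upwards [this] with s hsa hs'
      refine hz s fun h4 => hs' ⟨lt_of_le_of_ne h4.1 (Ne.symm hsa), h4.2.trans hb.le⟩

/-- A locally integrable function whose distributional derivative vanishes is constant. -/
lemma ae_eq_const_of_integral_deriv_mul (hT : 0 < T) {h : ℝ → ℝ}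
    (hh : ∀ τ ∈ timeIoo T, IntegrableOn h (Ioo 0 τ))
    (hzero : ∀ η : ℝ → ℝ, ContDiff ℝ (⊤ : ℕ∞) η → HasCompactSupport η → tsupport η ⊆ timeIoo T →
      ∫ t, deriv η t * h t = 0) :
    ∃ c : ℝ, ∀ᵐ t ∂volume.restrict (timeIoo T), h t = c := by
  have hloc : LocallyIntegrableOn h (timeIoo T) volume := fun t ht => by
    obtain ⟨τ, hτ, htτ⟩ := exists_gt_mem_timeIoo (timeIoo_subset_timeIco ht)
    exact ⟨Ioo 0 τ, mem_nhdsWithin_of_mem_nhds (isOpen_Ioo.mem_nhds ⟨ht.1, htτ⟩), hh τ hτ⟩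
  have hint : ∀ {η : ℝ → ℝ}, ContDiff ℝ (⊤ : ℕ∞) η → HasCompactSupport η →
      tsupport η ⊆ timeIoo T → Integrable fun t => η t * h t := by
    intro η hη hc hs
    have h1 : IntegrableOn (fun t => η t * h t) (tsupport η) :=
      (hloc.integrableOn_compact_subset hs hc).continuousOn_mul hη.continuous.continuousOn hc
    refine (integrableOn_iff_integrable_of_support_subset ?_).1 h1
    exact (Function.support_mul_subset_left _ _).trans (subset_tsupport η)
  obtain ⟨τ, hτ⟩ := exists_mem_timeIoo hT
  obtain ⟨ε, hε, hball⟩ := Metric.isOpen_iff.1 (isOpen_timeIoo T) τ hτ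
  -- A test function is the sum of one of vanishing integral and a multiple of a fixed test
  -- function `η₀` of integral one.
  let ρ : ContDiffBump τ := ⟨ε / 4, ε / 2, by linarith, by linarith⟩
  have hρ : Metric.closedBall τ ρ.rOut ⊆ timeIoo T :=
    (Metric.closedBall_subset_ball (half_lt_self hε)).trans hball
  set η₀ : ℝ → ℝ := ρ.normed volume
  have hη₀ : ContDiff ℝ (⊤ : ℕ∞) η₀ := ρ.contDiff_normed
  have hc₀ : HasCompactSupport η₀ := ρ.hasCompactSupport_normed
  have hi₀ : ∫ t, η₀ t = 1 := ρ.integral_normed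
  have hs₀ : tsupport η₀ ⊆ timeIoo T := by
    rw [ρ.tsupport_normed_eq]; exact hρ
  set c := ∫ t, η₀ t * h t
  have hc : LocallyIntegrableOn (fun t => h t - c) (timeIoo T) volume :=
    hloc.sub ((locallyIntegrable_const c).locallyIntegrableOn _)
  refine ⟨c, ?_⟩
  have key := (isOpen_timeIoo T).ae_eq_zero_of_integral_contDiff_smul_eq_zero hc ?_
  · rw [ae_restrict_iff' (isOpen_timeIoo T).measurableSet]
    filter_upwards [key] with t ht hmem
    exact sub_eq_zero.1 (ht hmem)
  · intro η hη hcη hsη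
    set J := ∫ t, η t
    have hθ : ContDiff ℝ (⊤ : ℕ∞) fun t => η t - J * η₀ t := hη.sub (contDiff_const.mul hη₀)
    obtain ⟨a, b, ha, hb, hab, hK⟩ := exists_Icc_of_isCompact hT (hcη.union hc₀)
      (union_subset hsη hs₀)
    have hsθ : tsupport (fun t => η t - J * η₀ t) ⊆ Icc a b := by
      refine closure_minimal (fun t ht => ?_) isClosed_Icc
      by_contra hn
      have h1 : η t = 0 := image_eq_zero_of_notMem_tsupport fun h => hn (hK (Or.inl h))
      have h2 : η₀ t = 0 := image_eq_zero_of_notMem_tsupport fun h => hn (hK (Or.inr h))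
      exact ht (by simp [h1, h2])
    have hiη : Integrable η := hη.continuous.integrable_of_hasCompactSupport hcη
    have hiη₀ : Integrable η₀ := hη₀.continuous.integrable_of_hasCompactSupport hc₀
    have hJ : ∫ t, (η t - J * η₀ t) = 0 := by
      rw [integral_sub hiη (hiη₀.const_mul _), integral_const_mul, hi₀, mul_one, sub_self]
    obtain ⟨ζ, hζ, hsζ, hdζ⟩ := exists_primitive_test hθ hsθ hab hJ
    have hIcc : Icc a b ⊆ timeIoo T := fun t ht => mem_timeIoo_of_le hb (ha.1.trans_le ht.1) ht.2
    have h0 := hzero ζ hζ (isCompact_Icc.of_isClosed_subset (isClosed_tsupport _) hsζ)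
      (hsζ.trans hIcc)
    rw [hdζ] at h0
    have e : ∀ t, (η t - J * η₀ t) * h t = η t * h t - J * (η₀ t * h t) := fun t => by ring
    simp_rw [e] at h0
    rw [integral_sub (hint hη hcη hsη) ((hint hη₀ hc₀ hs₀).const_mul _), integral_const_mul] at h0
    have e2 : ∀ t, η t • (h t - c) = η t * h t - c * η t := fun t => by
      rw [smul_eq_mul]; ring
    simp_rw [e2]
    rw [integral_sub (hint hη hcη hsη) (hiη.const_mul _), integral_const_mul]
    linarith

/-- A function with the integrable distributional derivative `g` is a primitive of `g`. -/
theorem exists_eq_const_add_integral (hT : 0 < T) {f g : ℝ → ℝ}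
    (hf : ∀ τ ∈ timeIoo T, IntegrableOn f (Ioo 0 τ))
    (hg : ∀ τ ∈ timeIoo T, IntegrableOn g (Ioo 0 τ))
    (h : ∀ η : ℝ → ℝ, ContDiff ℝ (⊤ : ℕ∞) η → HasCompactSupport η → tsupport η ⊆ timeIoo T →
      ∫ t in timeIoo T, deriv η t * f t = - ∫ t in timeIoo T, η t * g t) :
    ∃ c : ℝ, ∀ᵐ t ∂volume.restrict (timeIoo T), f t = c + ∫ s in (0)..t, g s := by
  set G : ℝ → ℝ := fun t => ∫ s in (0)..t, g s
  have hGc : ∀ τ ∈ timeIoo T, ContinuousOn G (Icc 0 τ) := fun τ hτ => by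
    have := intervalIntegral.continuousOn_primitive_interval'
      (intervalIntegrable_of_Ioo (hg τ hτ) hτ.1.le) left_mem_uIcc
    rwa [uIcc_of_le hτ.1.le] at this
  have hG : ∀ τ ∈ timeIoo T, IntegrableOn G (Ioo 0 τ) := fun τ hτ =>
    ((hGc τ hτ).integrableOn_Icc).mono_set Ioo_subset_Icc_self
  suffices hzero : ∀ η : ℝ → ℝ, ContDiff ℝ (⊤ : ℕ∞) η → HasCompactSupport η →
      tsupport η ⊆ timeIoo T → ∫ t, deriv η t * (f t - G t) = 0 by
    obtain ⟨c, hc⟩ := ae_eq_const_of_integral_deriv_mul hT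
      (fun τ hτ => (hf τ hτ).sub (hG τ hτ)) hzero
    refine ⟨c, ?_⟩
    filter_upwards [hc] with t ht
    have ht' : f t - G t = c := ht
    linarith
  · intro η hη hcη hsη
    obtain ⟨τ, hτ, hsτ⟩ := exists_tsupport_subset_Ioo hT hcη hsη
    have hz : ∀ t, t ∉ Ioo 0 τ → η t = 0 := fun t ht =>
      image_eq_zero_of_notMem_tsupport fun h => ht (hsτ h)
    have hη1 : ContDiff ℝ 1 η := hη.of_le (by exact_mod_cast le_top)
    have hdc : Continuous (deriv η) := hη1.continuous_deriv le_rfl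
    have hz' : ∀ t, t ∉ Ioo 0 τ → deriv η t = 0 := fun t ht =>
      image_eq_zero_of_notMem_tsupport fun h => ht (hsτ (tsupport_deriv_subset h))
    have h1 := h η hη hcη hsη
    rw [setIntegral_timeIoo_eq hτ (fun t ht => by rw [hz' t ht, zero_mul]),
      setIntegral_timeIoo_eq hτ (fun t ht => by rw [hz t ht, zero_mul])] at h1
    have hgi := intervalIntegrable_of_Ioo (hg τ hτ) hτ.1.le
    have hac := hgi.absolutelyContinuousOnInterval_intervalIntegral (c := 0) left_mem_uIcc
    have hacη : AbsolutelyContinuousOnInterval η 0 τ :=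
      hη1.contDiffOn.absolutelyContinuousOnInterval
    have h2 := hacη.integral_mul_deriv_eq_deriv_mul hac
    rw [hz τ (fun h => lt_irrefl _ h.2), hz 0 (fun h => lt_irrefl _ h.1), zero_mul, zero_mul,
      sub_zero, zero_sub] at h2
    have h3 : ∫ t in (0)..τ, η t * deriv (fun x => ∫ v in (0)..x, g v) t
        = ∫ t in (0)..τ, η t * g t := by
      refine intervalIntegral.integral_congr_ae ?_
      filter_upwards [hgi.ae_hasDerivAt_integral] with t ht hmem
      rw [(ht (uIoc_subset_uIcc hmem) 0 left_mem_uIcc).deriv]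
    rw [h3] at h2
    have hb : ∀ {q : ℝ → ℝ}, IntegrableOn q (Ioo 0 τ) →
        IntegrableOn (fun t => deriv η t * q t) (Ioo 0 τ) := by
      intro q hq
      obtain ⟨C, hC⟩ := hcη.deriv.exists_bound_of_continuous hdc
      exact hq.bdd_mul hdc.aestronglyMeasurable (Eventually.of_forall hC)
    rw [← setIntegral_eq_integral_of_forall_compl_eq_zero (s := Ioo 0 τ)
      (fun t ht => by rw [hz' t ht, zero_mul])]
    simp only [mul_sub]
    rw [integral_sub (hb (hf τ hτ)) (hb (hG τ hτ)), h1,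
      setIntegral_Ioo_eq_intervalIntegral hτ.1.le, setIntegral_Ioo_eq_intervalIntegral hτ.1.le, h2]
    simp [G]

end WeakTimeDerivative

/-! ### Pairings with fixed functions of space -/

section Pairing

variable {L : Fin 3 → ℝ} {T : EReal} {m : ℕ} {u w : ℝ → E3 → ℝ}

/-- Lebesgue measure on `(0, τ) × Ω`. -/
noncomputable abbrev cyl (L : Fin 3 → ℝ) (τ : ℝ) : Measure (ℝ × E3) :=
  (volume.restrict (Ioo 0 τ)).prod (volume.restrict (box L))

lemma cyl_le_cylMeasure {τ : ℝ} (hτ : τ ∈ timeIoo T) : cyl L τ ≤ cylMeasure L T :=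
  Measure.prod_mono (Measure.restrict_mono (Ioo_subset_timeIoo hτ) le_rfl) le_rfl

lemma MemL2locH.memLp_cyl (hu : MemL2locH L T m u) {τ : ℝ} (hτ : τ ∈ timeIoo T) :
    MemLp (fun p : ℝ × E3 => u p.1 p.2) 2 (cyl L τ) := by
  have hae : AEStronglyMeasurable (fun p : ℝ × E3 => u p.1 p.2) (cyl L τ) :=
    hu.1.mono_measure (cyl_le_cylMeasure hτ)
  refine memLp_two_of_lintegral_sq hae ?_
  rw [lintegral_prod _ (hae.enorm.pow_const 2)]
  exact (lintegral_mono fun t => lintegral_sq_le_sqNormH _ _ _).trans_lt (hu.2.2 τ hτ)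

lemma MemL2locH.integrable_cyl (hu : MemL2locH L T m u) {τ : ℝ} (hτ : τ ∈ timeIoo T) :
    Integrable (fun p : ℝ × E3 => u p.1 p.2) (cyl L τ) :=
  (hu.memLp_cyl hτ).integrable (by norm_num)

lemma MemL2locH.ae_memLp (hu : MemL2locH L T m u) :
    ∀ᵐ t ∂volume.restrict (timeIoo T), MemLp (u t) 2 (volume.restrict (box L)) := by
  filter_upwards [hu.2.1] with t ht using ht.memLp

lemma MemL2locH.integrable_mul_cyl (hu : MemL2locH L T m u) {τ : ℝ} (hτ : τ ∈ timeIoo T)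
    {η : ℝ → ℝ} (hη : Continuous η) {C : ℝ} (hC : ∀ t, |η t| ≤ C) {ψ : E3 → ℝ}
    (hψ : Continuous ψ) {D : ℝ} (hD : ∀ x ∈ box L, |ψ x| ≤ D) :
    Integrable (fun p : ℝ × E3 => η p.1 * (u p.1 p.2 * ψ p.2)) (cyl L τ) := by
  have hmem : ∀ᵐ p : ℝ × E3 ∂cyl L τ, p.2 ∈ box L :=
    Measure.quasiMeasurePreserving_snd.ae (ae_restrict_mem (isOpen_box L).measurableSet)
  refine Integrable.bdd_mul (c := C) (Integrable.mul_bdd (c := D) (hu.integrable_cyl hτ)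
    (hψ.comp continuous_snd).aestronglyMeasurable ?_)
    (hη.comp continuous_fst).aestronglyMeasurable (Eventually.of_forall fun p => hC p.1)
  filter_upwards [hmem] with p hp using hD _ hp

lemma MemL2locH.integrableOn_pairing (hu : MemL2locH L T m u) {τ : ℝ} (hτ : τ ∈ timeIoo T)
    {ψ : E3 → ℝ} (hψ : Continuous ψ) {D : ℝ} (hD : ∀ x ∈ box L, |ψ x| ≤ D) :
    IntegrableOn (fun t => ∫ x in box L, u t x * ψ x) (Ioo 0 τ) := by
  have := (hu.integrable_mul_cyl hτ (η := fun _ => 1) continuous_const (C := 1) (by simp) hψ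
    hD).integral_prod_left
  simpa [IntegrableOn] using this

/-- The pairing of `u` with a fixed function of space has the pairing of `w` as its weak
derivative, if `u` has the weak time derivative `w`. -/
lemma HasTimeDeriv.integral_deriv_mul_pairing (h : HasTimeDeriv L T u w) (hT : 0 < T)
    {ψ : E3 → ℝ} (hψ : Continuous ψ) {D : ℝ} (hD : ∀ x ∈ box L, |ψ x| ≤ D) {η : ℝ → ℝ}
    (hη : ContDiff ℝ (⊤ : ℕ∞) η) (hc : HasCompactSupport η) (hs : tsupport η ⊆ timeIoo T) :
    ∫ t in timeIoo T, deriv η t * ∫ x in box L, u t x * ψ x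
      = - ∫ t in timeIoo T, η t * ∫ x in box L, w t x * ψ x := by
  obtain ⟨τ, hτ, hsτ⟩ := exists_tsupport_subset_Ioo hT hc hs
  have hη1 : ContDiff ℝ 1 η := hη.of_le (by exact_mod_cast le_top)
  have hdc : Continuous (deriv η) := hη1.continuous_deriv le_rfl
  have hz : ∀ t, t ∉ Ioo 0 τ → η t = 0 := fun t ht =>
    image_eq_zero_of_notMem_tsupport fun h => ht (hsτ h)
  have hz' : ∀ t, t ∉ Ioo 0 τ → deriv η t = 0 := fun t ht =>
    image_eq_zero_of_notMem_tsupport fun h => ht (hsτ (tsupport_deriv_subset h))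
  obtain ⟨C, hC⟩ := hc.exists_bound_of_continuous hη.continuous
  obtain ⟨C', hC'⟩ := hc.deriv.exists_bound_of_continuous hdc
  have hswap : ∀ {q : ℝ → E3 → ℝ} {ζ : ℝ → ℝ}, (∀ t, t ∉ Ioo 0 τ → ζ t = 0) →
      Integrable (fun p : ℝ × E3 => ζ p.1 * (q p.1 p.2 * ψ p.2)) (cyl L τ) →
      ∫ t in timeIoo T, ζ t * ∫ x in box L, q t x * ψ x
        = ∫ x in box L, (∫ t in timeIoo T, ζ t * q t x) * ψ x := by
    intro q ζ hζ hint
    rw [setIntegral_timeIoo_eq hτ (fun t ht => by rw [hζ t ht, zero_mul])]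
    have e : ∀ x, ∫ t in timeIoo T, ζ t * q t x = ∫ t in Ioo 0 τ, ζ t * q t x := fun x =>
      setIntegral_timeIoo_eq hτ (fun t ht => by rw [hζ t ht, zero_mul])
    simp_rw [e, ← integral_const_mul, ← integral_mul_const]
    rw [integral_integral_swap hint]
    simp only [mul_assoc]
  rw [hswap hz' (h.1.integrable_mul_cyl hτ hdc hC' hψ hD),
    hswap hz (h.2.1.integrable_mul_cyl hτ hη.continuous hC hψ hD), ← integral_neg]
  refine integral_congr_ae ?_
  filter_upwards [h.2.2 η hη hc hs] with x hx
  rw [hx, neg_mul]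

lemma HasTimeDeriv.exists_pairing_eq (h : HasTimeDeriv L T u w) (hT : 0 < T)
    {ψ : E3 → ℝ} (hψ : Continuous ψ) {D : ℝ} (hD : ∀ x ∈ box L, |ψ x| ≤ D) :
    ∃ c : ℝ, ∀ᵐ t ∂volume.restrict (timeIoo T), ∫ x in box L, u t x * ψ x
      = c + ∫ s in (0)..t, ∫ x in box L, w s x * ψ x :=
  exists_eq_const_add_integral hT (fun _ hτ => h.1.integrableOn_pairing hτ hψ hD)
    (fun _ hτ => h.2.1.integrableOn_pairing hτ hψ hD)
    fun _ hη hc hs => h.integral_deriv_mul_pairing hT hψ hD hη hc hs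

lemma coef_eq_pairing {f : E3 → ℝ} (hf : Integrable f (volume.restrict (box L)))
    (k : Fin 3 → ℤ) :
    coef L f k = ((∏ i, L i)⁻¹ : ℝ) *
      (((∫ x in box L, f x * Real.cos (phase L (-k) x) : ℝ) : ℂ)
        + Complex.I * ((∫ x in box L, f x * Real.sin (phase L (-k) x) : ℝ) : ℂ)) := by
  rw [coef, fourierCoef, integral_character_mul hf]

lemma MemL2locH.integrable_mul_coef_cyl (hu : MemL2locH L T m u) {τ : ℝ} (hτ : τ ∈ timeIoo T)
    (k : Fin 3 → ℤ) :
    Integrable (fun p : ℝ × E3 => character L (-k) p.2 * (u p.1 p.2 : ℂ)) (cyl L τ) :=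
  (hu.integrable_cyl hτ).ofReal.bdd_mul
    ((continuous_character (-k)).comp continuous_snd).aestronglyMeasurable
    (Eventually.of_forall fun p => (norm_character (-k) p.2).le)

lemma MemL2locH.integrableOn_coef (hu : MemL2locH L T m u) {τ : ℝ} (hτ : τ ∈ timeIoo T)
    (k : Fin 3 → ℤ) : IntegrableOn (fun t => coef L (u t) k) (Ioo 0 τ) :=
  ((hu.integrable_mul_coef_cyl hτ k).integral_prod_left).const_mul _

/-- The Fourier coefficients of a function with a weak time derivative are primitives of the
Fourier coefficients of that derivative. -/
theorem HasTimeDeriv.exists_coef_eq (h : HasTimeDeriv L T u w) (hT : 0 < T) (k : Fin 3 → ℤ) :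
    ∃ c : ℂ, ∀ᵐ t ∂volume.restrict (timeIoo T),
      coef L (u t) k = c + ∫ s in (0)..t, coef L (w s) k := by
  have hcos : Continuous fun x => Real.cos (phase L (-k) x) := (contDiff_cos_phase _).continuous
  have hsin : Continuous fun x => Real.sin (phase L (-k) x) := (contDiff_sin_phase _).continuous
  have hcb : ∀ x ∈ box L, |Real.cos (phase L (-k) x)| ≤ 1 := fun x _ => Real.abs_cos_le_one _
  have hsb : ∀ x ∈ box L, |Real.sin (phase L (-k) x)| ≤ 1 := fun x _ => Real.abs_sin_le_one _
  obtain ⟨c, hc⟩ := h.exists_pairing_eq hT hcos hcb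
  obtain ⟨d, hd⟩ := h.exists_pairing_eq hT hsin hsb
  refine ⟨((∏ i, L i)⁻¹ : ℝ) * (c + Complex.I * d), ?_⟩
  have hw := h.2.1.ae_memLp
  filter_upwards [hc, hd, h.1.ae_memLp, ae_restrict_mem (isOpen_timeIoo T).measurableSet]
    with t h1 h2 hut htT
  have e : ∫ s in (0)..t, coef L (w s) k
      = ∫ s in (0)..t, ((∏ i, L i)⁻¹ : ℝ) *
        (((∫ x in box L, w s x * Real.cos (phase L (-k) x) : ℝ) : ℂ)
        + Complex.I * ((∫ x in box L, w s x * Real.sin (phase L (-k) x) : ℝ) : ℂ)) := by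
    rw [← setIntegral_Ioo_eq_intervalIntegral htT.1.le,
      ← setIntegral_Ioo_eq_intervalIntegral htT.1.le]
    refine integral_congr_ae ?_
    filter_upwards [ae_Ioo_of_ae_timeIoo htT hw] with s hs
    exact coef_eq_pairing (integrable_of_memLp hs) k
  have i1 : IntervalIntegrable
      (fun s => ((∫ x in box L, w s x * Real.cos (phase L (-k) x) : ℝ) : ℂ)) volume 0 t :=
    intervalIntegrable_of_Ioo
      (Integrable.ofReal (h.2.1.integrableOn_pairing htT hcos hcb)) htT.1.le
  have i2 : IntervalIntegrable
      (fun s => ((∫ x in box L, w s x * Real.sin (phase L (-k) x) : ℝ) : ℂ)) volume 0 t :=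
    intervalIntegrable_of_Ioo
      (Integrable.ofReal (h.2.1.integrableOn_pairing htT hsin hsb)) htT.1.le
  rw [e, coef_eq_pairing (integrable_of_memLp hut), h1, h2, intervalIntegral.integral_const_mul,
    intervalIntegral.integral_add i1 (i2.const_mul _),
    intervalIntegral.integral_const_mul]
  simp only [intervalIntegral.integral_ofReal]
  push_cast
  ring

end Pairing

/-! ### Periodicity of the time derivative -/

section Cutoff

variable {L : Fin 3 → ℝ}

/-- Smooth functions with values in `[0, 1]` and compact support in the box that converge to `1`
there. -/
noncomputable def cutoff (L : Fin 3 → ℝ) (n : ℕ) (x : E3) : ℝ :=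
  ∏ i, Real.smoothTransition ((n + 1) * x i - 1) * Real.smoothTransition ((n + 1) * (L i - x i) - 1)

lemma contDiff_cutoff (n : ℕ) : ContDiff ℝ (⊤ : ℕ∞) (cutoff L n) := by
  unfold cutoff
  refine contDiff_prod fun i _ => ?_
  exact (Real.smoothTransition.contDiff.comp (by fun_prop)).mul
    (Real.smoothTransition.contDiff.comp (by fun_prop))

lemma tsupport_cutoff_subset (n : ℕ) : tsupport (cutoff L n) ⊆ box L := by
  have hcl : IsClosed {x : E3 | ∀ i, 0 ≤ (n + 1) * x i - 1 ∧ 0 ≤ (n + 1) * (L i - x i) - 1} := by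
    simp only [ofPred_forall, ofPred_and]
    refine isClosed_iInter fun i => ?_
    exact (isClosed_le continuous_const (by fun_prop)).inter
      (isClosed_le continuous_const (by fun_prop))
  refine (closure_minimal (fun x hx i => ?_) hcl).trans fun x hx i => ?_
  · have hne := Finset.prod_ne_zero_iff.1 (Function.mem_support.1 hx) i (Finset.mem_univ i)
    constructor
    · by_contra h
      exact hne (by rw [Real.smoothTransition.zero_of_nonpos (not_le.1 h).le, zero_mul])
    · by_contra h
      exact hne (by rw [Real.smoothTransition.zero_of_nonpos (not_le.1 h).le, mul_zero])
  · obtain ⟨h1, h2⟩ := hx i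
    have hn : (0 : ℝ) < n + 1 := by positivity
    exact ⟨pos_of_mul_pos_right (by linarith : 0 < ((n : ℝ) + 1) * x i) hn.le,
      sub_pos.1 (pos_of_mul_pos_right (by linarith : 0 < ((n : ℝ) + 1) * (L i - x i)) hn.le)⟩

lemma hasCompactSupport_cutoff (n : ℕ) : HasCompactSupport (cutoff L n) :=
  Metric.isCompact_of_isClosed_isBounded (isClosed_tsupport _)
    ((isBounded_box L).subset (tsupport_cutoff_subset n))

lemma abs_cutoff_le (n : ℕ) (x : E3) : |cutoff L n x| ≤ 1 := by
  have h : ∀ i : Fin 3, 0 ≤ Real.smoothTransition ((n + 1) * x i - 1)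
      * Real.smoothTransition ((n + 1) * (L i - x i) - 1) := fun i =>
    mul_nonneg (Real.smoothTransition.nonneg _) (Real.smoothTransition.nonneg _)
  unfold cutoff
  rw [abs_of_nonneg (Finset.prod_nonneg fun i _ => h i)]
  exact Finset.prod_le_one (fun i _ => h i) fun i _ =>
    mul_le_one₀ (Real.smoothTransition.le_one _) (Real.smoothTransition.nonneg _)
      (Real.smoothTransition.le_one _)

lemma tendsto_cutoff {x : E3} (hx : x ∈ box L) :
    Tendsto (fun n => cutoff L n x) atTop (𝓝 1) := by
  have h1 : ∀ {a : ℝ}, 0 < a → ∀ᶠ n : ℕ in atTop, Real.smoothTransition ((n + 1) * a - 1) = 1 := by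
    intro a ha
    have ht : Tendsto (fun n : ℕ => ((n : ℝ) + 1) * a - 1) atTop atTop :=
      tendsto_atTop_add_const_right _ _ ((tendsto_atTop_add_const_right _ _
        tendsto_natCast_atTop_atTop).atTop_mul_const ha)
    filter_upwards [ht.eventually_ge_atTop 1] with n hn
    exact Real.smoothTransition.one_of_one_le hn
  have h2 : ∀ᶠ n : ℕ in atTop, ∀ i : Fin 3, Real.smoothTransition ((n + 1) * x i - 1)
      * Real.smoothTransition ((n + 1) * (L i - x i) - 1) = 1 := by
    rw [eventually_all]
    intro i
    filter_upwards [h1 (hx i).1, h1 (sub_pos.2 (hx i).2)] with n ha hb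
    rw [ha, hb, one_mul]
  refine tendsto_const_nhds.congr' ?_
  filter_upwards [h2] with n hn
  unfold cutoff
  rw [Finset.prod_congr rfl fun i _ => hn i, Finset.prod_const_one]

lemma tendsto_integral_mul_cutoff {g e : E3 → ℝ} (hg : Integrable g (volume.restrict (box L)))
    (he : Continuous e) (hb : ∀ x, |e x| ≤ 1) :
    Tendsto (fun n => ∫ x in box L, g x * (cutoff L n x * e x)) atTop
      (𝓝 (∫ x in box L, g x * e x)) := by
  refine tendsto_integral_of_dominated_convergence (fun x => ‖g x‖) (fun n => ?_) hg.norm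
    (fun n => Eventually.of_forall fun x => ?_) ?_
  · exact hg.1.mul ((contDiff_cutoff n).continuous.mul he).aestronglyMeasurable
  · rw [norm_mul, norm_mul, Real.norm_eq_abs (cutoff L n x), Real.norm_eq_abs (e x)]
    exact mul_le_of_le_one_right (norm_nonneg _)
      (mul_le_one₀ (abs_cutoff_le n x) (abs_nonneg _) (hb x))
  · filter_upwards [ae_restrict_mem (isOpen_box L).measurableSet] with x hx
    have := ((tendsto_cutoff hx).mul_const (e x)).const_mul (g x)
    rwa [one_mul] at this

/-- The Cauchy-Schwarz inequality against the constant `1`. -/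
lemma sq_lintegral_le {α : Type*} [MeasurableSpace α] {μ : Measure α} {f : α → ℝ≥0∞}
    (hf : AEMeasurable f μ) : (∫⁻ x, f x ∂μ) ^ 2 ≤ μ univ * ∫⁻ x, f x ^ 2 ∂μ := by
  have h := ENNReal.lintegral_mul_le_Lp_mul_Lq μ Real.HolderConjugate.two_two hf
    (aemeasurable_const (b := (1 : ℝ≥0∞)))
  have h2 := pow_le_pow_left₀ zero_le h 2
  simp only [Pi.mul_apply, mul_one, ENNReal.one_rpow, lintegral_const, one_mul, mul_pow] at h2
  have e : ∀ a : ℝ≥0∞, (a ^ (1 / 2 : ℝ)) ^ 2 = a := fun a => by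
    rw [← ENNReal.rpow_natCast, ← ENNReal.rpow_mul]; norm_num
  rw [e, e, mul_comm] at h2
  simpa using h2

lemma sq_enorm_integral_mul_le {g ψ : E3 → ℝ}
    (hg : AEStronglyMeasurable g (volume.restrict (box L)))
    (hψ : ∀ x, |ψ x| ≤ 1) :
    ‖∫ x in box L, g x * ψ x‖ₑ ^ 2 ≤ volume (box L) * ∫⁻ x in box L, ‖g x‖ₑ ^ 2 := by
  have h1 : ‖∫ x in box L, g x * ψ x‖ₑ ≤ ∫⁻ x in box L, ‖g x‖ₑ := by
    refine (enorm_integral_le_lintegral_enorm _).trans (lintegral_mono fun x => ?_)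
    rw [enorm_mul]
    refine mul_le_of_le_one_right zero_le ?_
    rw [← ofReal_norm, Real.norm_eq_abs]
    exact ENNReal.ofReal_le_one.2 (hψ x)
  refine (pow_le_pow_left₀ zero_le h1 2).trans ((sq_lintegral_le hg.enorm).trans ?_)
  rw [Measure.restrict_apply_univ]

/-- Dominated convergence for integrals in time, where the bound `S` on the squares need not be
measurable. -/
lemma tendsto_integral_of_sq_le {τ : ℝ} {A : ℕ → ℝ → ℝ} {A' η : ℝ → ℝ} {S : ℝ → ℝ≥0∞} {C : ℝ≥0∞}
    (hA : ∀ n, AEStronglyMeasurable (A n) (volume.restrict (Ioo 0 τ)))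
    (hlim : ∀ᵐ t ∂volume.restrict (Ioo 0 τ), Tendsto (fun n => A n t) atTop (𝓝 (A' t)))
    (hC : C ≠ ∞) (hS : ∫⁻ t in Ioo 0 τ, S t < ∞)
    (hb : ∀ n, ∀ᵐ t ∂volume.restrict (Ioo 0 τ), ‖A n t‖ₑ ^ 2 ≤ C * S t)
    (hη : Continuous η) {D : ℝ} (hD : ∀ t, |η t| ≤ D) :
    IntegrableOn A' (Ioo 0 τ) ∧
    Tendsto (fun n => ∫ t in Ioo 0 τ, η t * A n t) atTop (𝓝 (∫ t in Ioo 0 τ, η t * A' t)) := by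
  set N : ℝ → ℝ≥0∞ := fun t => ⨆ n, ‖A n t‖ₑ ^ 2
  have hNm : AEMeasurable N (volume.restrict (Ioo 0 τ)) :=
    AEMeasurable.iSup fun n => (hA n).enorm.pow_const 2
  have hNle : ∀ᵐ t ∂volume.restrict (Ioo 0 τ), N t ≤ C * S t := by
    filter_upwards [ae_all_iff.2 hb] with t ht using iSup_le ht
  have hNfin : ∫⁻ t in Ioo 0 τ, N t ≠ ∞ := by
    refine ((lintegral_mono_ae hNle).trans_lt ?_).ne
    rw [lintegral_const_mul' _ _ hC]
    exact ENNReal.mul_lt_top hC.lt_top hS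
  have hbint : Integrable (fun t => 1 + (N t).toReal) (volume.restrict (Ioo 0 τ)) :=
    (integrable_const 1).add (integrable_toReal_of_lintegral_ne_top hNm hNfin)
  have hbound : ∀ᵐ t ∂volume.restrict (Ioo 0 τ), ∀ n, |A n t| ≤ 1 + (N t).toReal := by
    filter_upwards [ae_lt_top' hNm hNfin] with t ht n
    have h1 : ‖A n t‖ₑ ^ 2 ≤ N t := le_iSup (fun n => ‖A n t‖ₑ ^ 2) n
    have h2 := ENNReal.toReal_mono ht.ne h1
    rw [ENNReal.toReal_pow, toReal_enorm, Real.norm_eq_abs] at h2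
    nlinarith [sq_nonneg (|A n t| - 1)]
  have hA'm : AEStronglyMeasurable A' (volume.restrict (Ioo 0 τ)) :=
    aestronglyMeasurable_of_tendsto_ae atTop hA hlim
  refine ⟨hbint.mono' hA'm ?_, ?_⟩
  · filter_upwards [hlim, hbound] with t h1 h2
    exact le_of_tendsto h1.norm (Eventually.of_forall fun n => h2 n)
  · refine tendsto_integral_of_dominated_convergence (fun t => D * (1 + (N t).toReal))
      (fun n => hη.aestronglyMeasurable.mul (hA n)) (hbint.const_mul D) (fun n => ?_) ?_
    · filter_upwards [hbound] with t ht
      rw [norm_mul, Real.norm_eq_abs, Real.norm_eq_abs]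
      exact mul_le_mul (hD t) (ht n) (abs_nonneg _) ((abs_nonneg _).trans (hD t))
    · filter_upwards [hlim] with t ht using ht.const_mul _

variable {T : EReal} {u w : ℝ → E3 → ℝ}

/-- The time derivative `w` of a periodic function `u` may be integrated by parts over the box
against smooth periodic functions, if it has weak derivatives in space: the boundary terms are
the time derivatives of those of `u`, which vanish. -/
lemma HasTimeDeriv.ae_integral_mul_partialD (h : HasTimeDeriv L T u w) (hT : 0 < T)
    (hL : ∀ i, 0 < L i) (hu : MemL2locH L T 1 u)
    (huV : ∀ᵐ t ∂volume.restrict (timeIoo T), MemV L 1 (u t))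
    (hw : MemL2locH L T 1 w) (i : Fin 3) {e : E3 → ℝ} (he : ContDiff ℝ (⊤ : ℕ∞) e)
    (hper : BoxPeriodic L e) (hb : ∀ x, |e x| ≤ 1) :
    ∀ᵐ t ∂volume.restrict (timeIoo T), ∫ x in box L, w t x * partialD i e x
      = - ∫ x in box L, weakDeriv (box L) i (w t) x * e x := by
  have he1 : ContDiff ℝ 1 e := he.of_le (by exact_mod_cast le_top)
  -- The identity for `ψₙ = cutoff L n * e` holds because `ψₙ` is supported in the box. The term of
  -- `∂ᵢ (cutoff L n)` has no obvious limit, but its limit is the time derivative of the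
  -- corresponding limit for `u`, which is known from the periodicity of `u`.
  set ψ : ℕ → E3 → ℝ := fun n x => cutoff L n x * e x
  have hψ : ∀ n, ContDiff ℝ (⊤ : ℕ∞) (ψ n) := fun n => (contDiff_cutoff n).mul he
  have hψ1 : ∀ n, ContDiff ℝ 1 (ψ n) := fun n => (hψ n).of_le (by exact_mod_cast le_top)
  have hψc : ∀ n, HasCompactSupport (ψ n) := fun n => (hasCompactSupport_cutoff n).mul_right
  have hψs : ∀ n, tsupport (ψ n) ⊆ box L := fun n =>
    (tsupport_mul_subset_left).trans (tsupport_cutoff_subset n)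
  have hψb : ∀ n x, |ψ n x| ≤ 1 := fun n x => by
    simp only [ψ, abs_mul]
    exact mul_le_one₀ (abs_cutoff_le n x) (abs_nonneg _) (hb x)
  have hbd : ∀ {q : E3 → ℝ}, Continuous q → ∃ D, ∀ x ∈ box L, |q x| ≤ D := by
    intro q hq
    obtain ⟨R, -, hR⟩ := box_subset_ball L
    obtain ⟨D, hD⟩ := (isCompact_closedBall (0 : E3) R).exists_bound_of_continuousOn hq.continuousOn
    exact ⟨D, fun x hx => hD x (Metric.ball_subset_closedBall (hR hx))⟩
  have hcψ : ∀ n, Continuous (partialD i (ψ n)) := fun n => continuous_partialD (hψ1 n) i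
  have hce : Continuous (partialD i e) := continuous_partialD he1 i
  obtain ⟨De, hDe⟩ := hbd hce
  choose D hD using fun n => hbd (hcψ n)
  -- The pairings with `∂ᵢ ψₙ`, for a fixed time.
  have hpair : ∀ {q : ℝ → E3 → ℝ}, MemL2locH L T 1 q →
      ∀ᵐ t ∂volume.restrict (timeIoo T), (∀ n, ∫ x in box L, q t x * partialD i (ψ n) x
        = - ∫ x in box L, weakDeriv (box L) i (q t) x * ψ n x)
        ∧ MemLp (weakDeriv (box L) i (q t)) 2 (volume.restrict (box L)) := by
    intro q hq
    filter_upwards [hq.2.1] with t ht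
    exact ⟨fun n => (ht.hasWeakDeriv i).2.2 _ (hψ n) (hψc n) (hψs n),
      (ht.weakDeriv (isOpen_box L) i).memLp⟩
  have hlim : ∀ {q : ℝ → E3 → ℝ}, MemL2locH L T 1 q →
      ∀ᵐ t ∂volume.restrict (timeIoo T),
        Tendsto (fun n => ∫ x in box L, q t x * partialD i (ψ n) x) atTop
          (𝓝 (- ∫ x in box L, weakDeriv (box L) i (q t) x * e x)) := by
    intro q hq
    filter_upwards [hpair hq] with t ht
    simp only [ht.1]
    exact (tendsto_integral_mul_cutoff (integrable_of_memLp ht.2) he.continuous hb).neg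
  have hsq : ∀ {q : ℝ → E3 → ℝ}, MemL2locH L T 1 q → ∀ n,
      ∀ᵐ t ∂volume.restrict (timeIoo T), ‖∫ x in box L, q t x * partialD i (ψ n) x‖ₑ ^ 2
        ≤ volume (box L) * sqNormH (box L) 1 (q t) := by
    intro q hq n
    filter_upwards [hpair hq] with t ht
    rw [ht.1, enorm_neg]
    refine (sq_enorm_integral_mul_le ht.2.1 (hψb n)).trans ?_
    gcongr
    refine le_trans ?_ (sum_sqNormH_le (box L) 0 (q t))
    exact Finset.single_le_sum (f := fun j => sqNormH (box L) 0 (weakDeriv (box L) j (q t)))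
      (fun _ _ => zero_le) (Finset.mem_univ i)
  have hvol : volume (box L) ≠ ∞ := (isBounded_box L).measure_lt_top.ne
  have hconv : ∀ {q : ℝ → E3 → ℝ}, MemL2locH L T 1 q → ∀ τ ∈ timeIoo T, ∀ {ζ : ℝ → ℝ},
      Continuous ζ → ∀ {B : ℝ}, (∀ t, |ζ t| ≤ B) →
      IntegrableOn (fun t => - ∫ x in box L, weakDeriv (box L) i (q t) x * e x) (Ioo 0 τ) ∧
      Tendsto (fun n => ∫ t in Ioo 0 τ, ζ t * ∫ x in box L, q t x * partialD i (ψ n) x) atTop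
        (𝓝 (∫ t in Ioo 0 τ, ζ t * - ∫ x in box L, weakDeriv (box L) i (q t) x * e x)) := by
    intro q hq τ hτ ζ hζ B hB
    exact tendsto_integral_of_sq_le
      (fun n => (hq.integrableOn_pairing hτ (hcψ n) (hD n)).aestronglyMeasurable)
      (ae_Ioo_of_ae_timeIoo hτ (hlim hq)) hvol (hq.2.2 τ hτ)
      (fun n => ae_Ioo_of_ae_timeIoo hτ (hsq hq n)) hζ hB
  set d : ℝ → ℝ := fun t => - ∫ x in box L, weakDeriv (box L) i (w t) x * e x
  set p : ℝ → ℝ := fun t => ∫ x in box L, w t x * partialD i e x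
  have hdint : ∀ τ ∈ timeIoo T, IntegrableOn d (Ioo 0 τ) := fun τ hτ =>
    (hconv hw τ hτ (ζ := fun _ => 0) continuous_const (B := 0) (by simp)).1
  have hpint : ∀ τ ∈ timeIoo T, IntegrableOn p (Ioo 0 τ) := fun τ hτ =>
    hw.integrableOn_pairing hτ hce hDe
  have hloc : LocallyIntegrableOn (fun t => p t - d t) (timeIoo T) volume := fun t ht => by
    obtain ⟨τ, hτ, htτ⟩ := exists_gt_mem_timeIoo (timeIoo_subset_timeIco ht)
    exact ⟨Ioo 0 τ, mem_nhdsWithin_of_mem_nhds (isOpen_Ioo.mem_nhds ⟨ht.1, htτ⟩),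
      (hpint τ hτ).sub (hdint τ hτ)⟩
  have key := (isOpen_timeIoo T).ae_eq_zero_of_integral_contDiff_smul_eq_zero hloc ?_
  · rw [ae_restrict_iff' (isOpen_timeIoo T).measurableSet]
    filter_upwards [key] with t ht hmem
    exact sub_eq_zero.1 (ht hmem)
  · intro η hη hc hs
    obtain ⟨τ, hτ, hsτ⟩ := exists_tsupport_subset_Ioo hT hc hs
    have hη1 : ContDiff ℝ 1 η := hη.of_le (by exact_mod_cast le_top)
    have hdc : Continuous (deriv η) := hη1.continuous_deriv le_rfl
    have hz : ∀ t, t ∉ Ioo 0 τ → η t = 0 := fun t ht =>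
      image_eq_zero_of_notMem_tsupport fun h => ht (hsτ h)
    have hz' : ∀ t, t ∉ Ioo 0 τ → deriv η t = 0 := fun t ht =>
      image_eq_zero_of_notMem_tsupport fun h => ht (hsτ (tsupport_deriv_subset h))
    obtain ⟨B, hB⟩ := hc.exists_bound_of_continuous hη.continuous
    obtain ⟨B', hB'⟩ := hc.deriv.exists_bound_of_continuous hdc
    have t1 := (hconv hu τ hτ hdc hB').2
    have t2 := (hconv hw τ hτ hη.continuous hB).2
    have hIoo : ∀ {ζ q : ℝ → ℝ}, (∀ t, t ∉ Ioo 0 τ → ζ t = 0) →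
        ∫ t in timeIoo T, ζ t * q t = ∫ t in Ioo 0 τ, ζ t * q t := fun hζ =>
      setIntegral_timeIoo_eq hτ (fun t ht => by rw [hζ t ht, zero_mul])
    have heq : ∀ n, ∫ t in Ioo 0 τ, deriv η t * ∫ x in box L, u t x * partialD i (ψ n) x
        = - ∫ t in Ioo 0 τ, η t * ∫ x in box L, w t x * partialD i (ψ n) x := fun n => by
      rw [← hIoo hz', ← hIoo hz]
      exact h.integral_deriv_mul_pairing hT (hcψ n) (hD n) hη hc hs
    simp only [heq] at t1
    have t3 := tendsto_nhds_unique t1 t2.neg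
    have t4 : ∫ t in Ioo 0 τ, deriv η t * - ∫ x in box L, weakDeriv (box L) i (u t) x * e x
        = ∫ t in Ioo 0 τ, deriv η t * ∫ x in box L, u t x * partialD i e x := by
      refine integral_congr_ae ?_
      filter_upwards [ae_Ioo_of_ae_timeIoo hτ huV] with t ht
      rw [(ht.weakDeriv_spec hL i).2 e he hper]
    have t5 := h.integral_deriv_mul_pairing hT hce hDe hη hc hs
    rw [hIoo hz', hIoo hz, ← t4, t3] at t5
    have hi1 : IntegrableOn (fun t => η t * p t) (Ioo 0 τ) :=
      (hpint τ hτ).bdd_mul hη.continuous.aestronglyMeasurable (Eventually.of_forall hB)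
    have hi2 : IntegrableOn (fun t => η t * d t) (Ioo 0 τ) :=
      (hdint τ hτ).bdd_mul hη.continuous.aestronglyMeasurable (Eventually.of_forall hB)
    rw [← setIntegral_eq_integral_of_forall_compl_eq_zero (s := Ioo 0 τ)
      (fun t ht => by rw [hz t ht, zero_smul])]
    simp only [smul_eq_mul, mul_sub]
    rw [integral_sub hi1 hi2]
    simp only [p, d]
    linarith

lemma HasTimeDeriv.ae_coef_weakDeriv (h : HasTimeDeriv L T u w) (hT : 0 < T)
    (hL : ∀ i, 0 < L i) (hu : MemL2locH L T 1 u)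
    (huV : ∀ᵐ t ∂volume.restrict (timeIoo T), MemV L 1 (u t)) (hw : MemL2locH L T 1 w) :
    ∀ᵐ t ∂volume.restrict (timeIoo T), ∀ i k,
      coef L (weakDeriv (box L) i (w t)) k = Complex.I * freq L k i * coef L (w t) k := by
  refine ae_all_iff.2 fun i => ae_all_iff.2 fun k => ?_
  filter_upwards [hw.2.1, h.ae_integral_mul_partialD hT hL hu huV hw i (contDiff_cos_phase (-k))
    (boxPeriodic_cos_phase hL (-k)) (fun x => Real.abs_cos_le_one _),
    h.ae_integral_mul_partialD hT hL hu huV hw i (contDiff_sin_phase (-k))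
    (boxPeriodic_sin_phase hL (-k)) (fun x => Real.abs_sin_le_one _)] with t ht h1 h2
  exact coef_eq_of_integral_partialD (integrable_of_memLp ht.memLp)
    (integrable_of_memLp (ht.weakDeriv (isOpen_box L) i).memLp) h1 h2

/-- The Fourier coefficients of the time derivative with the weights `1 + lam L k` are controlled by
the norm of `H¹(Ω)`. -/
lemma HasTimeDeriv.ae_tsum_weight_coef_le (h : HasTimeDeriv L T u w) (hT : 0 < T)
    (hL : ∀ i, 0 < L i) (hu : MemL2locH L T 1 u)
    (huV : ∀ᵐ t ∂volume.restrict (timeIoo T), MemV L 1 (u t)) (hw : MemL2locH L T 1 w) :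
    ∀ᵐ t ∂volume.restrict (timeIoo T),
      ∑' k, ENNReal.ofReal (1 + lam L k) * ‖coef L (w t) k‖ₑ ^ 2
        ≤ ENNReal.ofReal (∏ i, L i)⁻¹ * sqNormH (box L) 1 (w t) := by
  filter_upwards [hw.2.1, h.ae_coef_weakDeriv hT hL hu huV hw] with t ht hc
  have h1 := tsum_weight_coef_succ_le (m := 0) hc
  simp only [zero_add, pow_one, pow_zero, ENNReal.ofReal_one, one_mul] at h1
  rw [h1, tsum_sq_coef hL ht.memLp]
  simp only [tsum_sq_coef hL (ht.weakDeriv (isOpen_box L) _).memLp]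
  rw [← Finset.mul_sum, ← mul_add]
  rfl

end Cutoff

/-! ### Continuity in time -/

section Continuity

variable {L : Fin 3 → ℝ} {T : EReal} {u w : ℝ → E3 → ℝ}

lemma _root_.ENNReal.add_sq_le_two_mul (a b : ℝ≥0∞) : (a + b) ^ 2 ≤ 2 * (a ^ 2 + b ^ 2) := by
  induction a using ENNReal.recTopCoe with
  | top => simp
  | coe a =>
    induction b using ENNReal.recTopCoe with
    | top => simp
    | coe b => exact_mod_cast (add_sq_le : (a + b) ^ 2 ≤ 2 * (a ^ 2 + b ^ 2))

/-- The one-dimensional Sobolev inequality on an interval of length `δ` about `t`, with explicit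
dependence on `δ`. -/
lemma sq_enorm_le_of_eq_primitive {F g : ℝ → ℂ} {c : ℂ} {τ δ t : ℝ} (hδ : 0 < δ) (hδτ : δ ≤ τ)
    (hg : IntegrableOn g (Ioo 0 τ)) (hF : ∀ t ∈ Icc 0 τ, F t = c + ∫ s in (0)..t, g s)
    (ht : t ∈ Icc 0 τ) :
    ENNReal.ofReal δ * ‖F t‖ₑ ^ 2 ≤ 2 * (∫⁻ s in Ioo 0 τ, ‖F s‖ₑ ^ 2)
      + 2 * ENNReal.ofReal δ ^ 2 * ∫⁻ s in Ioo 0 τ, ‖g s‖ₑ ^ 2 := by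
  obtain ⟨a, ha0, haτ, hat, hta⟩ : ∃ a, 0 ≤ a ∧ a + δ ≤ τ ∧ a ≤ t ∧ t ≤ a + δ := by
    rcases le_total t (τ - δ) with h | h
    · exact ⟨t, ht.1, by linarith, le_rfl, by linarith⟩
    · exact ⟨τ - δ, by linarith, by linarith, h, by linarith [ht.2]⟩
  have hτ : 0 ≤ τ := ht.1.trans ht.2
  have hsub : Ioo a (a + δ) ⊆ Ioo 0 τ := Ioo_subset_Ioo ha0 haτ
  have hvol : volume (Ioo a (a + δ)) = ENNReal.ofReal δ := by simp
  have hint : ∀ s ∈ Icc 0 τ, IntervalIntegrable g volume 0 s := fun s hs =>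
    (intervalIntegrable_of_Ioo hg hτ).mono_set (by
      rw [uIcc_of_le hs.1, uIcc_of_le hτ]; exact Icc_subset_Icc_right hs.2)
  have hcs : (∫⁻ r in Ioo a (a + δ), ‖g r‖ₑ) ^ 2
      ≤ ENNReal.ofReal δ * ∫⁻ r in Ioo 0 τ, ‖g r‖ₑ ^ 2 := by
    refine (sq_lintegral_le (hg.mono_set hsub).1.enorm).trans ?_
    rw [Measure.restrict_apply_univ, hvol]
    gcongr
  have key : ∀ s ∈ Ioo a (a + δ), ‖F t‖ₑ ^ 2
      ≤ 2 * ‖F s‖ₑ ^ 2 + 2 * (ENNReal.ofReal δ * ∫⁻ r in Ioo 0 τ, ‖g r‖ₑ ^ 2) := fun s hs => by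
    have hs' : s ∈ Icc 0 τ := Ioo_subset_Icc_self (hsub hs)
    have h1 : F t = F s + ∫ r in s..t, g r := by
      rw [hF t ht, hF s hs', ← intervalIntegral.integral_interval_sub_left (hint t ht) (hint s hs')]
      ring
    have h2 : ‖∫ r in s..t, g r‖ₑ ≤ ∫⁻ r in Ioo a (a + δ), ‖g r‖ₑ := by
      have h3 : ‖∫ r in s..t, g r‖ₑ ≤ ∫⁻ r in Ioc a (a + δ), ‖g r‖ₑ := by
        rw [← ofReal_norm, intervalIntegral.norm_intervalIntegral_eq, ofReal_norm]
        refine (enorm_integral_le_lintegral_enorm _).trans (lintegral_mono_set ?_)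
        rcases le_total s t with hst | hst
        · rw [uIoc_of_le hst]; exact Ioc_subset_Ioc hs.1.le hta
        · rw [uIoc_of_ge hst]; exact Ioc_subset_Ioc hat hs.2.le
      rwa [restrict_Ioo_eq_restrict_Ioc]
    calc ‖F t‖ₑ ^ 2 ≤ (‖F s‖ₑ + ∫⁻ r in Ioo a (a + δ), ‖g r‖ₑ) ^ 2 := by
          rw [h1]; gcongr; exact (enorm_add_le _ _).trans (by gcongr)
      _ ≤ _ := (ENNReal.add_sq_le_two_mul _ _).trans (by rw [mul_add]; gcongr)
  have h5 := setLIntegral_mono' (μ := volume) measurableSet_Ioo key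
  rw [setLIntegral_const, hvol, lintegral_add_right _ measurable_const, setLIntegral_const, hvol,
    lintegral_const_mul' _ _ (by simp)] at h5
  rw [mul_comm]
  refine h5.trans (add_le_add (by gcongr) (le_of_eq (by ring)))

lemma continuousOn_timeIco_prod {X Y : Type*} [TopologicalSpace X] [TopologicalSpace Y]
    {f : ℝ × X → Y} {S : Set X} (h : ∀ τ ∈ timeIoo T, ContinuousOn f (Icc 0 τ ×ˢ S)) :
    ContinuousOn f (timeIco T ×ˢ S) := fun p hp => by
  obtain ⟨τ, hτ, hlt⟩ := exists_gt_mem_timeIoo hp.1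
  refine (h τ hτ p ⟨⟨hp.1.1, hlt.le⟩, hp.2⟩).mono_of_mem_nhdsWithin ?_
  have : Iio τ ×ˢ univ ∈ 𝓝 p := (isOpen_Iio.prod isOpen_univ).mem_nhds ⟨hlt, mem_univ _⟩
  filter_upwards [self_mem_nhdsWithin, mem_nhdsWithin_of_mem_nhds this] with q hq hq'
  exact ⟨⟨hq.1.1, hq'.1.le⟩, hq.2⟩

lemma continuousOn_timeIco {Y : Type*} [TopologicalSpace Y]
    {f : ℝ → Y} (h : ∀ τ ∈ timeIoo T, ContinuousOn f (Icc 0 τ)) :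
    ContinuousOn f (timeIco T) := fun t ht => by
  obtain ⟨τ, hτ, hlt⟩ := exists_gt_mem_timeIoo ht
  refine (h τ hτ t ⟨ht.1, hlt.le⟩).mono_of_mem_nhdsWithin ?_
  filter_upwards [self_mem_nhdsWithin, mem_nhdsWithin_of_mem_nhds (Iio_mem_nhds hlt)] with s hs hs'
  exact ⟨hs.1, le_of_lt hs'⟩

lemma Icc_subset_timeIco {τ : ℝ} (hτ : τ ∈ timeIoo T) : Icc 0 τ ⊆ timeIco T := fun _ ht =>
  ⟨ht.1, lt_of_le_of_lt (by exact_mod_cast ht.2) hτ.2⟩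

lemma continuousOn_primitive_Icc {E : Type*} [NormedAddCommGroup E] [NormedSpace ℝ E] {g : ℝ → E}
    {τ : ℝ} (hτ : 0 ≤ τ) (hg : IntegrableOn g (Ioo 0 τ)) :
    ContinuousOn (fun t => ∫ s in (0)..t, g s) (Icc 0 τ) := by
  have := intervalIntegral.continuousOn_primitive_interval (a := 0) (b := τ) (f := g)
    (μ := volume) (by rw [uIcc_of_le hτ, integrableOn_Icc_iff_integrableOn_Ioo]; exact hg)
  rwa [uIcc_of_le hτ] at this

/-- The Fourier coefficients of a function in `L²_loc([0, T); V³)` with a time derivative in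
`L²_loc([0, T); H¹(Ω))` have summable suprema on compact intervals of time. This interpolates
between `L²(V³)` for the function and `L²(H¹)` for the derivative: the exponent `2` of
`1 + lam L k` obtained for the square of the supremum exceeds `3/2`, which makes the sum over the
lattice converge. -/
lemma exists_summable_bound (hT : 0 < T) (hL : ∀ i, 0 < L i) (hu : MemL2locV L T 3 u)
    (hu1 : MemL2locH L T 1 u) (h : HasTimeDeriv L T u w) (hw : MemL2locH L T 1 w)
    {c : (Fin 3 → ℤ) → ℂ} (hc : ∀ k, ∀ᵐ t ∂volume.restrict (timeIoo T),
      coef L (u t) k = c k + ∫ s in (0)..t, coef L (w s) k) {τ : ℝ} (hτ : τ ∈ timeIoo T) :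
    ∃ M : (Fin 3 → ℤ) → ℝ, Summable M ∧
      ∀ k, ∀ t ∈ Icc 0 τ, ‖c k + ∫ s in (0)..t, coef L (w s) k‖ ≤ M k := by
  have hτ0 : 0 < τ := hτ.1
  have hpos : ∀ k, 0 < 1 + lam L k := fun k => by linarith [lam_nonneg (L := L) k]
  set F : (Fin 3 → ℤ) → ℝ → ℂ := fun k t => c k + ∫ s in (0)..t, coef L (w s) k
  have hwint : ∀ k, IntegrableOn (fun s => coef L (w s) k) (Ioo 0 τ) := hw.integrableOn_coef hτ
  have hFc : ∀ k, ContinuousOn (F k) (Icc 0 τ) := fun k =>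
    continuousOn_const.add (continuousOn_primitive_Icc hτ0.le (hwint k))
  have huV : ∀ᵐ t ∂volume.restrict (timeIoo T), MemV L 1 (u t) := by
    filter_upwards [hu.2] with t ht using ht.pred.pred
  set A : (Fin 3 → ℤ) → ℝ≥0∞ := fun k =>
    ENNReal.ofReal ((1 + lam L k) ^ 3) * ∫⁻ s in Ioo 0 τ, ‖F k s‖ₑ ^ 2
  set B : (Fin 3 → ℤ) → ℝ≥0∞ := fun k =>
    ENNReal.ofReal (1 + lam L k) * ∫⁻ s in Ioo 0 τ, ‖coef L (w s) k‖ₑ ^ 2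
  have hFm : ∀ k, AEMeasurable (fun s => ‖F k s‖ₑ ^ 2) (volume.restrict (Ioo 0 τ)) := fun k =>
    ((((hFc k).mono Ioo_subset_Icc_self).aestronglyMeasurable measurableSet_Ioo).enorm.pow_const 2)
  have hA : ∑' k, A k < ∞ := by
    have h1 : ∑' k, A k = ∫⁻ s in Ioo 0 τ,
        ∑' k, ENNReal.ofReal ((1 + lam L k) ^ 3) * ‖F k s‖ₑ ^ 2 := by
      rw [lintegral_tsum fun k => (hFm k).const_mul _]
      exact tsum_congr fun k => (lintegral_const_mul' _ _ ENNReal.ofReal_ne_top).symm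
    have h2 : ∫⁻ s in Ioo 0 τ, ∑' k, ENNReal.ofReal ((1 + lam L k) ^ 3) * ‖F k s‖ₑ ^ 2
        ≤ ∫⁻ s in Ioo 0 τ, 2 ^ 3 * ENNReal.ofReal (∏ i, L i)⁻¹ * sqNormH (box L) 3 (u s) := by
      refine lintegral_mono_ae (ae_Ioo_of_ae_timeIoo hτ ?_)
      filter_upwards [hu.2, ae_all_iff.2 hc] with s hs hs'
      simp only [F, ← hs']
      exact hs.tsum_weight_coef_le hL
    rw [h1]
    refine h2.trans_lt ?_
    rw [lintegral_const_mul' _ _ (ENNReal.mul_ne_top (by simp) ENNReal.ofReal_ne_top)]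
    exact ENNReal.mul_lt_top (ENNReal.mul_lt_top (by simp) ENNReal.ofReal_lt_top) (hu.1.2.2 τ hτ)
  have hB : ∑' k, B k < ∞ := by
    have h1 : ∑' k, B k = ∫⁻ s in Ioo 0 τ,
        ∑' k, ENNReal.ofReal (1 + lam L k) * ‖coef L (w s) k‖ₑ ^ 2 := by
      rw [lintegral_tsum fun k => ((hwint k).1.enorm.pow_const 2).const_mul _]
      exact tsum_congr fun k => (lintegral_const_mul' _ _ ENNReal.ofReal_ne_top).symm
    have h2 : ∫⁻ s in Ioo 0 τ, ∑' k, ENNReal.ofReal (1 + lam L k) * ‖coef L (w s) k‖ₑ ^ 2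
        ≤ ∫⁻ s in Ioo 0 τ, ENNReal.ofReal (∏ i, L i)⁻¹ * sqNormH (box L) 1 (w s) :=
      lintegral_mono_ae (ae_Ioo_of_ae_timeIoo hτ (h.ae_tsum_weight_coef_le hT hL hu1 huV hw))
    rw [h1]
    refine h2.trans_lt ?_
    rw [lintegral_const_mul' _ _ ENNReal.ofReal_ne_top]
    exact ENNReal.mul_lt_top ENNReal.ofReal_lt_top (hw.2.2 τ hτ)
  set R : (Fin 3 → ℤ) → ℝ≥0∞ := fun k => 2 * A k + 2 * ENNReal.ofReal τ ^ 2 * B k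
  have hR : ∑' k, R k < ∞ := by
    rw [ENNReal.tsum_add, ENNReal.tsum_mul_left, ENNReal.tsum_mul_left]
    exact ENNReal.add_lt_top.2 ⟨ENNReal.mul_lt_top (by simp) hA,
      ENNReal.mul_lt_top (ENNReal.mul_lt_top (by simp) (by simp)) hB⟩
  have hRk : ∀ k, R k ≠ ∞ := fun k => ((ENNReal.le_tsum k).trans_lt hR).ne
  -- The Sobolev inequality is used on an interval of length `τ / (1 + lam L k)`.
  have key : ∀ k, ∀ t ∈ Icc 0 τ, τ * (1 + lam L k) ^ 2 * ‖F k t‖ ^ 2 ≤ (R k).toReal := by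
    intro k t ht
    have hk := hpos k
    have h1 := sq_enorm_le_of_eq_primitive (F := F k) (δ := τ / (1 + lam L k)) (by positivity)
      (div_le_self hτ0.le (by linarith [lam_nonneg (L := L) k])) (hwint k) (fun _ _ => rfl) ht
    have h2 := mul_le_mul_right h1 (ENNReal.ofReal ((1 + lam L k) ^ 3))
    rw [← ENNReal.ofReal_le_iff_le_toReal (hRk k)]
    calc ENNReal.ofReal (τ * (1 + lam L k) ^ 2 * ‖F k t‖ ^ 2)
        = ENNReal.ofReal ((1 + lam L k) ^ 3)
          * (ENNReal.ofReal (τ / (1 + lam L k)) * ‖F k t‖ₑ ^ 2) := by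
          rw [← ofReal_norm, ← ENNReal.ofReal_pow (norm_nonneg _),
            ← ENNReal.ofReal_mul (by positivity), ← ENNReal.ofReal_mul (by positivity)]
          congr 1
          field_simp
      _ ≤ _ := h2
      _ = R k := by
        have h3 : ENNReal.ofReal ((1 + lam L k) ^ 3) * ENNReal.ofReal (τ / (1 + lam L k)) ^ 2
            = ENNReal.ofReal τ ^ 2 * ENNReal.ofReal (1 + lam L k) := by
          rw [← ENNReal.ofReal_pow (by positivity), ← ENNReal.ofReal_pow (by positivity),
            ← ENNReal.ofReal_mul (by positivity), ← ENNReal.ofReal_mul (by positivity)]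
          congr 1
          field_simp
        have h4 : ∀ a b c d : ℝ≥0∞, a * (2 * b + 2 * c * d) = 2 * (a * b) + 2 * ((a * c) * d) :=
          fun a b c d => by ring
        rw [h4, h3]
        simp only [R, A, B]
        ring
  refine ⟨fun k => Real.sqrt ((R k).toReal / τ) / (1 + lam L k), ?_, fun k t ht => ?_⟩
  · refine summable_of_weighted hL (fun k => div_nonneg (Real.sqrt_nonneg _) (hpos k).le) ?_
    refine ((ENNReal.summable_toReal hR.ne).div_const τ).congr fun k => ?_
    have hk := hpos k
    rw [div_pow, Real.sq_sqrt (by positivity)]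
    field_simp
  · have hk := hpos k
    rw [le_div_iff₀ hk]
    refine Real.le_sqrt_of_sq_le ?_
    rw [le_div_iff₀ hτ0]
    calc _ = τ * (1 + lam L k) ^ 2 * ‖F k t‖ ^ 2 := by ring
      _ ≤ _ := key k t ht

/-- A function in `L²_loc([0, T); V³)` with a time derivative in `L²_loc([0, T); H¹(Ω))` has a
representative that is continuous in time and space. -/
theorem HasTimeDeriv.exists_continuousOn (hT : 0 < T) (hL : ∀ i, 0 < L i) (hu : MemL2locV L T 3 u)
    (hu1 : MemL2locH L T 1 u) (h : HasTimeDeriv L T u w) (hw : MemL2locH L T 1 w) :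
    ∃ uc : ℝ → E3 → ℝ, ContinuousOn (fun p : ℝ × E3 => uc p.1 p.2) (timeIco T ×ˢ univ) ∧
      (∀ᵐ t ∂volume.restrict (timeIoo T), u t =ᵐ[volume.restrict (box L)] uc t) := by
  choose c hc using fun k => h.exists_coef_eq hT k
  set F : (Fin 3 → ℤ) → ℝ → ℂ := fun k t => c k + ∫ s in (0)..t, coef L (w s) k with hF
  have hM := fun τ (hτ : τ ∈ timeIoo T) => exists_summable_bound hT hL hu hu1 h hw hc hτ
  refine ⟨fun t x => (fourierSeries L (fun k => F k t) x).re, ?_, ?_⟩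
  · refine Complex.continuous_re.comp_continuousOn (continuousOn_timeIco_prod fun τ hτ => ?_)
    obtain ⟨M, hMs, hMb⟩ := hM τ hτ
    refine continuousOn_tsum (fun k => ?_) hMs fun k p hp => ?_
    · refine ContinuousOn.mul ?_ ((continuous_character k).comp continuous_snd).continuousOn
      exact (continuousOn_const.add (continuousOn_primitive_Icc hτ.1.le
        (hw.integrableOn_coef hτ k))).comp continuousOn_fst fun p hp => hp.1
    · exact (norm_mul_character _ _ _).le.trans (hMb k p.1 hp.1)
  · filter_upwards [hu.2, ae_all_iff.2 hc,
      ae_restrict_mem (isOpen_timeIoo T).measurableSet] with t ht hct htT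
    obtain ⟨M, hMs, hMb⟩ := hM t htT
    have heq : (fun k => F k t) = coef L (u t) := funext fun k => (hct k).symm
    have hsum : Summable fun k => ‖fourierCoef L (fun x => (u t x : ℂ)) k‖ :=
      hMs.of_nonneg_of_le (fun k => norm_nonneg _) fun k => by
        have := hMb k t ⟨htT.1.le, le_rfl⟩
        rwa [← hct k] at this
    filter_upwards [ae_eq_fourierSeries hL (f := fun x => (u t x : ℂ)) ht.memLp.ofReal hsum]
      with x hx
    rw [heq]
    exact (by simpa using congrArg Complex.re hx : u t x = _)

end Continuity

/-! ### The continuous representative as a primitive in time -/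

section Primitive

variable {L : Fin 3 → ℝ} {T : EReal} {u w uc : ℝ → E3 → ℝ}

lemma continuous_slice (hc : ContinuousOn (fun p : ℝ × E3 => uc p.1 p.2) (timeIco T ×ˢ univ))
    {t : ℝ} (ht : t ∈ timeIco T) : Continuous (uc t) := by
  rw [← continuousOn_univ]
  exact hc.comp (f := fun x => ((t, x) : ℝ × E3)) (by fun_prop) fun x _ => ⟨ht, mem_univ _⟩

lemma continuousOn_time (hc : ContinuousOn (fun p : ℝ × E3 => uc p.1 p.2) (timeIco T ×ˢ univ))
    (x : E3) : ContinuousOn (fun t => uc t x) (timeIco T) :=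
  hc.comp (f := fun t => ((t, x) : ℝ × E3)) (by fun_prop) fun t ht => ⟨ht, mem_univ _⟩

lemma continuousOn_coef (hc : ContinuousOn (fun p : ℝ × E3 => uc p.1 p.2) (timeIco T ×ˢ univ))
    (k : Fin 3 → ℤ) : ContinuousOn (fun t => coef L (uc t) k) (timeIco T) := by
  refine continuousOn_timeIco fun τ hτ => ?_
  have hsub := Icc_subset_timeIco hτ
  obtain ⟨R, hR, hbox⟩ := box_subset_ball L
  obtain ⟨C, hC⟩ := ((isCompact_Icc (a := 0) (b := τ)).prod
    (isCompact_closedBall (0 : E3) R)).exists_bound_of_continuousOn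
    (hc.mono (prod_mono hsub (subset_univ _)))
  refine continuousOn_const.mul (continuousOn_of_dominated (bound := fun _ => C) (fun t ht => ?_)
    (fun t ht => ?_) (integrable_const _) (Eventually.of_forall fun x => ?_))
  · exact ((continuous_character (-k)).mul
      (Complex.continuous_ofReal.comp (continuous_slice hc (hsub ht)))).aestronglyMeasurable
  · filter_upwards [ae_restrict_mem (isOpen_box L).measurableSet] with x hx
    rw [norm_mul, norm_character, one_mul, Complex.norm_real]
    exact hC (t, x) ⟨ht, Metric.ball_subset_closedBall (hbox hx)⟩
  · exact continuousOn_const.mul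
      (Complex.continuous_ofReal.comp_continuousOn ((continuousOn_time hc x).mono hsub))

lemma MemL2locH.memLp_integral {m : ℕ} (hw : MemL2locH L T m w) {t : ℝ} (ht : t ∈ timeIoo T) :
    MemLp (fun x => ∫ s in (0)..t, w s x) 2 (volume.restrict (box L)) := by
  have hint := hw.integrable_cyl ht
  have hae : AEStronglyMeasurable (fun x => ∫ s in Ioo 0 t, w s x) (volume.restrict (box L)) :=
    hint.integral_prod_right.1
  simp only [← setIntegral_Ioo_eq_intervalIntegral ht.1.le]
  refine memLp_two_of_lintegral_sq hae ?_
  have hswap : AEMeasurable (fun p : E3 × ℝ => ‖w p.2 p.1‖ₑ ^ 2)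
      ((volume.restrict (box L)).prod (volume.restrict (Ioo 0 t))) :=
    hint.swap.1.enorm.pow_const 2
  calc ∫⁻ x in box L, ‖∫ s in Ioo 0 t, w s x‖ₑ ^ 2
      ≤ ∫⁻ x in box L, ENNReal.ofReal t * ∫⁻ s in Ioo 0 t, ‖w s x‖ₑ ^ 2 := by
        refine lintegral_mono_ae ?_
        filter_upwards [hint.prod_left_ae] with x hx
        refine (pow_le_pow_left₀ zero_le (enorm_integral_le_lintegral_enorm _) 2).trans
          ((sq_lintegral_le hx.1.enorm).trans (le_of_eq ?_))
        simp
    _ = ENNReal.ofReal t * ∫⁻ p, ‖w p.1 p.2‖ₑ ^ 2 ∂cyl L t := by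
        rw [lintegral_const_mul' _ _ ENNReal.ofReal_ne_top, ← lintegral_prod_swap]
        exact congrArg _ (lintegral_prod _ hswap).symm
    _ < ∞ := by
        refine ENNReal.mul_lt_top ENNReal.ofReal_lt_top ?_
        rw [lintegral_prod _ (hint.1.enorm.pow_const 2)]
        exact (lintegral_mono fun t => lintegral_sq_le_sqNormH _ _ _).trans_lt (hw.2.2 t ht)

lemma MemL2locH.coef_integral {m : ℕ} (hw : MemL2locH L T m w) {t : ℝ} (ht : t ∈ timeIoo T)
    (k : Fin 3 → ℤ) :
    coef L (fun x => ∫ s in (0)..t, w s x) k = ∫ s in (0)..t, coef L (w s) k := by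
  simp only [← setIntegral_Ioo_eq_intervalIntegral ht.1.le, coef, fourierCoef]
  rw [integral_const_mul, integral_integral_swap (hw.integrable_mul_coef_cyl ht k)]
  congr 1
  refine integral_congr_ae (Eventually.of_forall fun x => ?_)
  simp only
  rw [integral_const_mul, integral_complex_ofReal]

lemma coef_add {f g : E3 → ℝ} (hf : Integrable f (volume.restrict (box L)))
    (hg : Integrable g (volume.restrict (box L))) (k : Fin 3 → ℤ) :
    coef L (fun x => f x + g x) k = coef L f k + coef L g k := by
  unfold coef fourierCoef
  simp only [Complex.ofReal_add, mul_add]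
  have hf' : Integrable (fun x => (f x : ℂ)) (volume.restrict (box L)) := hf.ofReal
  have hg' : Integrable (fun x => (g x : ℂ)) (volume.restrict (box L)) := hg.ofReal
  rw [integral_add (integrable_character_mul hf' _) (integrable_character_mul hg' _), mul_add]

lemma HasTimeDeriv.ae_eq_add_integral_of_mem (h : HasTimeDeriv L T u w) (hT : 0 < T)
    (hL : ∀ i, 0 < L i)
    (hc : ContinuousOn (fun p : ℝ × E3 => uc p.1 p.2) (timeIco T ×ˢ univ))
    (huc : ∀ᵐ t ∂volume.restrict (timeIoo T), u t =ᵐ[volume.restrict (box L)] uc t)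
    {t : ℝ} (ht : t ∈ timeIoo T) :
    ∀ᵐ x ∂volume.restrict (box L), uc t x = uc 0 x + ∫ s in (0)..t, w s x := by
  have h0 : (0 : ℝ) ∈ timeIco T := ⟨le_rfl, by exact_mod_cast hT⟩
  have hI0 := memLp_of_continuous (L := L) (continuous_slice hc h0)
  have hI := h.2.1.memLp_integral ht
  have key : ∀ k, coef L (uc t) k = coef L (fun x => uc 0 x + ∫ s in (0)..t, w s x) k := by
    intro k
    obtain ⟨c, hck⟩ := h.exists_coef_eq hT k
    have heq : EqOn (fun t => coef L (uc t) k) (fun t => c + ∫ s in (0)..t, coef L (w s) k)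
        (Icc 0 t) := by
      refine Measure.eqOn_Icc_of_ae_eq volume ht.1.ne ?_
        ((continuousOn_coef hc k).mono (Icc_subset_timeIco ht))
        (continuousOn_const.add (continuousOn_primitive_Icc ht.1.le (h.2.1.integrableOn_coef ht k)))
      rw [← restrict_Ioo_eq_restrict_Icc]
      refine ae_Ioo_of_ae_timeIoo ht ?_
      filter_upwards [hck, huc] with s hs hs'
      rw [← coef_congr hs' k, hs]
    have e0 := heq ⟨le_rfl, ht.1.le⟩
    have e1 := heq ⟨ht.1.le, le_rfl⟩
    simp only [intervalIntegral.integral_same, add_zero] at e0 e1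
    rw [e1, coef_add (integrable_of_memLp hI0) (integrable_of_memLp hI), h.2.1.coef_integral ht, e0]
  filter_upwards [ae_eq_of_fourierCoef_eq hL (f := fun x => (uc t x : ℂ))
    (g := fun x => ((uc 0 x + ∫ s in (0)..t, w s x : ℝ) : ℂ))
    (memLp_of_continuous (L := L) (continuous_slice hc (timeIoo_subset_timeIco ht))).ofReal
    (hI0.add hI).ofReal key] with x hx
  exact_mod_cast hx

/-- At almost every point, the continuous representative is a primitive in time of any weak
time derivative. -/
theorem HasTimeDeriv.ae_eq_add_integral (h : HasTimeDeriv L T u w) (hT : 0 < T)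
    (hL : ∀ i, 0 < L i)
    (hc : ContinuousOn (fun p : ℝ × E3 => uc p.1 p.2) (timeIco T ×ˢ univ))
    (huc : ∀ᵐ t ∂volume.restrict (timeIoo T), u t =ᵐ[volume.restrict (box L)] uc t)
    {τ : ℝ} (hτ : τ ∈ timeIoo T) :
    ∀ᵐ x ∂volume.restrict (box L), IntegrableOn (fun s => w s x) (Ioo 0 τ) ∧
      ∀ t ∈ Icc 0 τ, uc t x = uc 0 x + ∫ s in (0)..t, w s x := by
  have hq : ∀ᵐ x ∂volume.restrict (box L), ∀ q : ℚ, (q : ℝ) ∈ Ioo 0 τ →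
      uc q x = uc 0 x + ∫ s in (0)..(q : ℝ), w s x := by
    refine ae_all_iff.2 fun q => ?_
    by_cases hq : (q : ℝ) ∈ Ioo 0 τ
    · filter_upwards [h.ae_eq_add_integral_of_mem hT hL hc huc (Ioo_subset_timeIoo hτ hq)]
        with x hx _ using hx
    · exact Eventually.of_forall fun x hq' => absurd hq' hq
  filter_upwards [hq, (h.2.1.integrable_cyl hτ).prod_left_ae] with x hx hint
  refine ⟨hint, ?_⟩
  have hc1 : ContinuousOn (fun t => uc t x) (Icc 0 τ) :=
    (continuousOn_time hc x).mono (Icc_subset_timeIco hτ)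
  have hc2 : ContinuousOn (fun t => uc 0 x + ∫ s in (0)..t, w s x) (Icc 0 τ) :=
    continuousOn_const.add (continuousOn_primitive_Icc hτ.1.le hint)
  have hE : EqOn (fun t => uc t x) (fun t => uc 0 x + ∫ s in (0)..t, w s x)
      (Ioo 0 τ ∩ range ((↑) : ℚ → ℝ)) := by
    rintro _ ⟨ht, q, rfl⟩
    exact hx q ht
  refine hE.of_subset_closure hc1 hc2 ?_ ?_
  · exact inter_subset_left.trans Ioo_subset_Icc_self
  · rw [← closure_Ioo hτ.1.ne]
    refine closure_minimal ?_ isClosed_closure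
    exact Rat.denseRange_cast.open_subset_closure_inter isOpen_Ioo

lemma ae_cylMeasure_eq (hu : AEStronglyMeasurable (fun p : ℝ × E3 => u p.1 p.2) (cylMeasure L T))
    (hc : ContinuousOn (fun p : ℝ × E3 => uc p.1 p.2) (timeIco T ×ˢ univ))
    (huc : ∀ᵐ t ∂volume.restrict (timeIoo T), u t =ᵐ[volume.restrict (box L)] uc t) :
    ∀ᵐ p ∂cylMeasure L T, u p.1 p.2 = uc p.1 p.2 := by
  have hcm : AEStronglyMeasurable (fun p : ℝ × E3 => uc p.1 p.2) (cylMeasure L T) := by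
    rw [cylMeasure, Measure.prod_restrict]
    exact (hc.mono (prod_mono timeIoo_subset_timeIco (subset_univ _))).aestronglyMeasurable
      ((isOpen_timeIoo T).measurableSet.prod (isOpen_box L).measurableSet)
  have hmk : ∀ᵐ p ∂cylMeasure L T, hu.mk _ p = hcm.mk _ p := by
    refine (Measure.ae_prod_iff_ae_ae (measurableSet_eq_fun
      hu.stronglyMeasurable_mk.measurable hcm.stronglyMeasurable_mk.measurable)).2 ?_
    filter_upwards [Measure.ae_ae_of_ae_prod hu.ae_eq_mk, Measure.ae_ae_of_ae_prod hcm.ae_eq_mk,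
      huc] with t h1 h2 h3
    filter_upwards [h1, h2, h3] with x h1 h2 h3
    rw [← h1, ← h2, h3]
  filter_upwards [hmk, hu.ae_eq_mk, hcm.ae_eq_mk] with p h1 h2 h3
  rw [h2, h1, h3]

end Primitive

/-! ### Testing the equations with nondecreasing functions of the solution -/

section Testing

variable {L : Fin 3 → ℝ}

lemma BoxPeriodic.isPeriodic {h : E3 → ℝ} (hp : BoxPeriodic L h) : IsPeriodic L h := fun i k =>
  Eventually.of_forall fun x => by
    have h1 := (hp i).zsmul k x
    have h2 : k • EuclideanSpace.single i (L i) = EuclideanSpace.single (𝕜 := ℝ) i (k * L i) := by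
      ext j
      by_cases hj : j = i <;> simp [hj]
    rwa [h2] at h1

lemma memLp_of_continuous_ball {f : E3 → ℝ} (hf : Continuous f) (R : ℝ) :
    MemLp f 2 (volume.restrict (Metric.ball 0 R)) := by
  obtain ⟨C, hC⟩ := (isCompact_closedBall (0 : E3) R).exists_bound_of_continuousOn hf.continuousOn
  have : IsFiniteMeasure (volume.restrict (Metric.ball (0 : E3) R)) :=
    ⟨by simpa using measure_ball_lt_top (μ := volume) (x := (0 : E3)) (r := R)⟩
  refine MemLp.of_bound hf.aestronglyMeasurable C ?_
  filter_upwards [ae_restrict_mem Metric.isOpen_ball.measurableSet] with x hx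
  exact hC x (Metric.ball_subset_closedBall hx)

lemma memV_one_of_contDiff {h : E3 → ℝ} (hh : ContDiff ℝ 1 h) (hp : BoxPeriodic L h) :
    MemV L 1 h :=
  ⟨h, fun R => ⟨memLp_of_continuous_ball hh.continuous R, fun i =>
    ⟨partialD i h, hasWeakDeriv_of_contDiff hh _ i,
      memLp_of_continuous_ball (continuous_partialD hh i) R⟩⟩, hp.isPeriodic, ae_eq_refl _⟩

/-- The integral over the box of a derivative of a periodic function vanishes. -/
lemma integral_box_partialD_eq_zero (hL : ∀ i, 0 < L i) {h : E3 → ℝ} (hh : ContDiff ℝ 1 h)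
    (hp : BoxPeriodic L h) (i : Fin 3) : ∫ x in box L, partialD i h x = 0 := by
  have h1 := integral_weakDeriv_mul_of_boxPeriodic hL (hasWeakDeriv_of_contDiff hh univ i) hp
    (hp.partialD i) (e := fun _ => 1) contDiff_const fun _ _ => rfl
  simpa [partialD] using h1

lemma weakDeriv_ae_eq_partialD {f U : E3 → ℝ} (hU : ContDiff ℝ 1 U)
    (hfU : f =ᵐ[volume.restrict (box L)] U) (i : Fin 3) :
    weakDeriv (box L) i f =ᵐ[volume.restrict (box L)] partialD i U :=
  ((hasWeakDeriv_of_contDiff hU (box L) i).congr hfU.symm (ae_eq_refl _)).weakDeriv_ae_eq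
    (isOpen_box L)

lemma partialD_comp {Z : ℝ → ℝ} {U : E3 → ℝ} (hZ : ContDiff ℝ 1 Z) (hU : ContDiff ℝ 1 U)
    (i : Fin 3) (x : E3) : partialD i (fun y => Z (U y)) x = deriv Z (U x) * partialD i U x := by
  have h1 := ((hZ.differentiable one_ne_zero (U x)).hasDerivAt.comp_hasFDerivAt x
    (hU.differentiable one_ne_zero x).hasFDerivAt).fderiv
  rw [partialD, partialD, show (fun y => Z (U y)) = Z ∘ U from rfl, h1]
  rfl

lemma partialD_mul {f g : E3 → ℝ} (hf : ContDiff ℝ 1 f) (hg : ContDiff ℝ 1 g)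
    (i : Fin 3) (x : E3) :
    partialD i (fun y => f y * g y) x = f x * partialD i g x + g x * partialD i f x := by
  rw [partialD, ((hf.differentiable one_ne_zero x).hasFDerivAt.fun_mul
    (hg.differentiable one_ne_zero x).hasFDerivAt).fderiv]
  rfl

/-- Transport by a divergence free periodic field does not contribute when the equation for `U` is
tested with a function of `U`: the integrand is the divergence of `H(U) v`, where `H` is a
primitive of `s Z'(s)`. -/
lemma integral_transport_eq_zero (hL : ∀ i, 0 < L i) {v : E3 → E3} (hv : MemVdiv L 3 v)
    {f U : E3 → ℝ} (hU : ContDiff ℝ 1 U) (hp : BoxPeriodic L U)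
    (hfU : f =ᵐ[volume.restrict (box L)] U) {Z : ℝ → ℝ} (hZ : ContDiff ℝ 1 Z) :
    ∫ x in box L, ∑ i, f x * v x i * weakDeriv (box L) i (fun y => Z (U y)) x = 0 := by
  choose V hV hVp hvV using fun i => (hv.1 i).exists_contDiff hL
  set H : ℝ → ℝ := fun s => ∫ r in (0)..s, r * deriv Z r
  have hcont : Continuous fun r => r * deriv Z r := continuous_id.mul (hZ.continuous_deriv le_rfl)
  have hHd : ∀ s, HasDerivAt H (s * deriv Z s) s := fun s =>
    intervalIntegral.integral_hasDerivAt_right (hcont.intervalIntegrable _ _)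
      (hcont.stronglyMeasurableAtFilter _ _) hcont.continuousAt
  have hHd' : deriv H = fun s => s * deriv Z s := funext fun s => (hHd s).deriv
  have hH : ContDiff ℝ 1 H := contDiff_one_iff_deriv.2
    ⟨fun s => (hHd s).differentiableAt, hHd' ▸ hcont⟩
  have hHU : ContDiff ℝ 1 fun x => H (U x) := hH.comp hU
  have hZU : ContDiff ℝ 1 fun x => Z (U x) := hZ.comp hU
  have hWp : ∀ i, BoxPeriodic L fun x => V i x * H (U x) := fun i j x => by
    simp only [hVp i j x, hp j x]
  have hW : ∀ i, ContDiff ℝ 1 fun x => V i x * H (U x) := fun i => (hV i).mul hHU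
  have hdiv := hv.2.1
  calc ∫ x in box L, ∑ i, f x * v x i * weakDeriv (box L) i (fun y => Z (U y)) x
      = ∫ x in box L, ∑ i, partialD i (fun y => V i y * H (U y)) x := by
        refine integral_congr_ae ?_
        filter_upwards [hfU, ae_all_iff.2 hvV, hdiv,
          ae_all_iff.2 fun i => weakDeriv_ae_eq_partialD (hV i) (hvV i) i,
          ae_all_iff.2 fun i => weakDeriv_ae_eq_partialD hZU (ae_eq_refl _) (L := L) (i := i)]
          with x h1 h2 h3 h4 h5
        simp only [h4] at h3
        simp only [h5, h1, h2, partialD_comp hZ hU, partialD_mul (hV _) hHU, partialD_comp hH hU,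
          hHd', Finset.sum_add_distrib, ← Finset.mul_sum, h3, mul_zero, add_zero]
        exact Finset.sum_congr rfl fun i _ => by ring
    _ = 0 := by
        rw [integral_finsetSum _ fun i _ => integrable_of_memLp
          (memLp_of_continuous (continuous_partialD (hW i) i))]
        exact Finset.sum_eq_zero fun i _ => integral_box_partialD_eq_zero hL (hW i) (hWp i) i

/-- Diffusion contributes with a sign when the equation for `U` is tested with a nondecreasing
function of `U`. -/
lemma integral_diffusion_nonneg {f U a : E3 → ℝ} (hU : ContDiff ℝ 1 U)
    (hfU : f =ᵐ[volume.restrict (box L)] U) {Z : ℝ → ℝ} (hZ : ContDiff ℝ 1 Z) (hmono : Monotone Z)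
    (ha : ∀ᵐ x ∂volume.restrict (box L), 0 ≤ a x) :
    0 ≤ ∫ x in box L, a x *
      ∑ i, weakDeriv (box L) i f x * weakDeriv (box L) i (fun y => Z (U y)) x := by
  refine integral_nonneg_of_ae ?_
  have hZU : ContDiff ℝ 1 fun x => Z (U x) := hZ.comp hU
  filter_upwards [ha, ae_all_iff.2 fun i => weakDeriv_ae_eq_partialD hU hfU (i := i),
    ae_all_iff.2 fun i => weakDeriv_ae_eq_partialD hZU (ae_eq_refl _) (L := L) (i := i)]
    with x h1 h2 h3
  refine mul_nonneg h1 (Finset.sum_nonneg fun i _ => ?_)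
  rw [h2, h3, partialD_comp hZ hU]
  have := mul_nonneg (hmono.deriv_nonneg (x := U x)) (sq_nonneg (partialD i U x))
  linarith

end Testing

/-! ### Comparison -/

section Comparison

variable {L : Fin 3 → ℝ}

lemma hasDerivAt_max_zero_pow (n : ℕ) (s : ℝ) :
    HasDerivAt (fun r : ℝ => max r 0 ^ (n + 2)) ((n + 2) * max s 0 ^ (n + 1)) s := by
  have h1 : HasDerivAt (fun r : ℝ => r ^ (n + 2)) ((n + 2) * s ^ (n + 1)) s := by
    simpa using hasDerivAt_pow (n + 2) s
  rcases lt_trichotomy s 0 with h | rfl | h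
  · rw [max_eq_right h.le, zero_pow (by omega), mul_zero]
    refine (hasDerivAt_const s (0 : ℝ)).congr_of_eventuallyEq ?_
    filter_upwards [Iio_mem_nhds h] with r hr
    rw [max_eq_right (le_of_lt hr), zero_pow (by omega)]
  · rw [max_self]
    rw [zero_pow (by omega), mul_zero] at h1 ⊢
    have h2 : HasDerivWithinAt (fun r : ℝ => max r 0 ^ (n + 2)) 0 (Iic 0) 0 :=
      (hasDerivWithinAt_const (0 : ℝ) (Iic 0) (0 : ℝ)).congr
        (fun r hr => by rw [max_eq_right hr, zero_pow (by omega)]) (by simp)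
    have h3 : HasDerivWithinAt (fun r : ℝ => max r 0 ^ (n + 2)) 0 (Ici 0) 0 :=
      h1.hasDerivWithinAt.congr (fun r hr => by rw [max_eq_left hr]) (by simp)
    simpa using h2.union h3
  · rw [max_eq_left h.le]
    refine h1.congr_of_eventuallyEq ?_
    filter_upwards [Ioi_mem_nhds h] with r hr
    rw [max_eq_left (le_of_lt hr)]

lemma contDiff_max_zero_pow (n : ℕ) : ContDiff ℝ 1 fun r : ℝ => max r 0 ^ (n + 2) := by
  have : deriv (fun r : ℝ => max r 0 ^ (n + 2)) = fun s : ℝ => ((n : ℝ) + 2) * max s 0 ^ (n + 1) :=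
    funext fun s => (hasDerivAt_max_zero_pow n s).deriv
  refine contDiff_one_iff_deriv.2 ⟨fun s => (hasDerivAt_max_zero_pow n s).differentiableAt, ?_⟩
  rw [this]
  fun_prop

lemma _root_.AbsolutelyContinuousOnInterval.contDiff_comp {G P : ℝ → ℝ} {a b : ℝ}
    (hP : AbsolutelyContinuousOnInterval P a b) (hG : ContDiff ℝ 1 G) :
    AbsolutelyContinuousOnInterval (fun s => G (P s)) a b := by
  obtain ⟨C, hC⟩ := hP.exists_bound
  obtain ⟨K, hK⟩ := hG.contDiffOn.exists_lipschitzOnWith one_ne_zero (convex_Icc (-C) C)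
    isCompact_Icc
  have hmem : ∀ s ∈ uIcc a b, P s ∈ Icc (-C) C := fun s hs => abs_le.1 (hC s hs)
  rw [absolutelyContinuousOnInterval_iff] at hP ⊢
  intro ε hε
  obtain ⟨δ, hδ, h⟩ := hP (ε / (K + 1)) (by positivity)
  refine ⟨δ, hδ, fun I hI hIδ => ?_⟩
  calc ∑ i ∈ Finset.range I.1, dist (G (P (I.2 i).1)) (G (P (I.2 i).2))
      ≤ ∑ i ∈ Finset.range I.1, (K + 1) * dist (P (I.2 i).1) (P (I.2 i).2) := by
        refine Finset.sum_le_sum fun i hi => ?_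
        refine (hK.dist_le_mul _ (hmem _ (hI.1 i hi).1) _ (hmem _ (hI.1 i hi).2)).trans ?_
        gcongr
        linarith
    _ = (K + 1) * ∑ i ∈ Finset.range I.1, dist (P (I.2 i).1) (P (I.2 i).2) := by
        rw [Finset.mul_sum]
    _ < (K + 1) * (ε / (K + 1)) := by
        have := h I hI hIδ
        gcongr
    _ = ε := by field_simp

/-- The chain rule for a `C¹` function of the primitive of an integrable function. -/
lemma sub_eq_integral_deriv_mul {G Q d : ℝ → ℝ} {t : ℝ} (hG : ContDiff ℝ 1 G) (ht : 0 ≤ t)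
    (hd : IntegrableOn d (Ioo 0 t)) (hQ : ∀ s ∈ Icc 0 t, Q s = Q 0 + ∫ r in (0)..s, d r) :
    G (Q t) - G (Q 0) = ∫ s in (0)..t, d s * deriv G (Q s) := by
  have hint := intervalIntegrable_of_Ioo hd ht
  set P : ℝ → ℝ := fun s => Q 0 + ∫ r in (0)..s, d r with hP
  have hac : AbsolutelyContinuousOnInterval P 0 t := by
    have h1 := hint.absolutelyContinuousOnInterval_intervalIntegral (c := 0) left_mem_uIcc
    have h2 : AbsolutelyContinuousOnInterval (fun _ : ℝ => Q 0) 0 t :=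
      (contDiff_const (n := 1)).contDiffOn.absolutelyContinuousOnInterval
    exact h2.add h1
  have h1 := (hac.contDiff_comp hG).integral_deriv_eq_sub
  rw [hQ t ⟨ht, le_rfl⟩]
  have hP0 : P 0 = Q 0 := by simp [hP]
  rw [hP0] at h1
  rw [← h1]
  refine intervalIntegral.integral_congr_ae ?_
  filter_upwards [hint.ae_hasDerivAt_integral] with s hs hst
  have hst' : s ∈ uIcc 0 t := uIoc_subset_uIcc hst
  have h2 : HasDerivAt P (d s) s := (hs hst' 0 left_mem_uIcc).const_add _
  have h3 := ((hG.differentiable one_ne_zero (P s)).hasDerivAt.comp s h2).deriv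
  rw [uIcc_of_le ht] at hst'
  rw [hQ s hst', mul_comm]
  exact h3

lemma forall_closure_box_nonpos {f : E3 → ℝ} (hf : Continuous f)
    (h : ∀ᵐ x ∂volume.restrict (box L), f x ≤ 0) : ∀ x ∈ closure (box L), f x ≤ 0 := by
  have hO : IsOpen (box L ∩ {x | 0 < f x}) := (isOpen_box L).inter (isOpen_lt continuous_const hf)
  have hnull : volume (box L ∩ {x | 0 < f x}) = 0 := by
    rw [ae_restrict_iff' (isOpen_box L).measurableSet] at h
    refine measure_mono_null (fun x hx => ?_) h
    simpa using ⟨hx.1, hx.2⟩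
  have hempty := (hO.measure_eq_zero_iff volume).1 hnull
  refine closure_minimal (fun x hx => ?_) (isClosed_le hf continuous_const)
  by_contra hx'
  exact Set.notMem_empty x (hempty ▸ mem_inter hx (mem_ofPred_eq ▸ not_le.1 hx'))

/-- If `q` is a primitive of `d` in time and `d` has a nonpositive integral against the square of
the positive part of `q` at almost every time, then `q` stays nonpositive. The quantity that does
not increase is the integral of the third power of the positive part of `q`. -/
theorem nonpos_of_integral_mul_sq_nonpos {q d : ℝ → E3 → ℝ} {s : ℝ}
    (hq : ContinuousOn (fun p : ℝ × E3 => q p.1 p.2) (Icc 0 s ×ˢ univ))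
    (hd : Integrable (fun p : ℝ × E3 => d p.1 p.2) (cyl L s))
    (heq : ∀ᵐ x ∂volume.restrict (box L), ∀ t ∈ Icc 0 s, q t x = q 0 x + ∫ r in (0)..t, d r x)
    (h0 : ∀ᵐ x ∂volume.restrict (box L), q 0 x ≤ 0)
    (hle : ∀ᵐ t ∂volume.restrict (Ioo 0 s), ∫ x in box L, d t x * max (q t x) 0 ^ 2 ≤ 0) :
    ∀ t ∈ Icc 0 s, ∀ x ∈ closure (box L), q t x ≤ 0 := by
  intro t ht
  have hslice : Continuous (q t) := by
    rw [← continuousOn_univ]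
    exact hq.comp (f := fun x => ((t, x) : ℝ × E3)) (by fun_prop) fun x _ => ⟨ht, mem_univ _⟩
  refine forall_closure_box_nonpos hslice ?_
  have hsub : Ioo 0 t ⊆ Ioo 0 s := Ioo_subset_Ioo_right ht.2
  have hcyl : cyl L t ≤ cyl L s := Measure.prod_mono (Measure.restrict_mono hsub le_rfl) le_rfl
  have hdt := hd.mono_measure hcyl
  have hint : Integrable (fun p : ℝ × E3 => d p.1 p.2 * max (q p.1 p.2) 0 ^ 2) (cyl L t) := by
    obtain ⟨R, hR, hbox⟩ := box_subset_ball L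
    have hg : ContinuousOn (fun p : ℝ × E3 => max (q p.1 p.2) 0 ^ 2) (Icc 0 s ×ˢ univ) :=
      (ContinuousOn.sup hq continuousOn_const).pow 2
    obtain ⟨C, hC⟩ := ((isCompact_Icc (a := 0) (b := s)).prod
      (isCompact_closedBall (0 : E3) R)).exists_bound_of_continuousOn
      (hg.mono (prod_mono le_rfl (subset_univ _)))
    refine hdt.mul_bdd (c := C) ?_ ?_
    · rw [cyl, Measure.prod_restrict]
      exact (hg.mono (prod_mono (hsub.trans Ioo_subset_Icc_self)
        (subset_univ _))).aestronglyMeasurable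
        (measurableSet_Ioo.prod (isOpen_box L).measurableSet)
    · rw [cyl, Measure.prod_restrict]
      filter_upwards [ae_restrict_mem (measurableSet_Ioo.prod (isOpen_box L).measurableSet)]
        with p hp
      exact hC p ⟨Ioo_subset_Icc_self (hsub hp.1), Metric.ball_subset_closedBall (hbox hp.2)⟩
  have h1 : ∀ᵐ x ∂volume.restrict (box L),
      max (q t x) 0 ^ 3 = 3 * ∫ r in Ioo 0 t, d r x * max (q r x) 0 ^ 2 := by
    filter_upwards [heq, h0, hdt.prod_left_ae] with x hx hx0 hxd
    have h2 := sub_eq_integral_deriv_mul (G := fun r => max r 0 ^ 3) (Q := fun t => q t x)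
      (contDiff_max_zero_pow 1) ht.1 hxd fun r hr => hx r ⟨hr.1, hr.2.trans ht.2⟩
    have h3 : ∀ r, deriv (fun r : ℝ => max r 0 ^ 3) r = 3 * max r 0 ^ 2 := fun r => by
      have := (hasDerivAt_max_zero_pow 1 r).deriv
      norm_num at this
      exact this
    simp only [h3, max_eq_right hx0] at h2
    rw [setIntegral_Ioo_eq_intervalIntegral ht.1, ← intervalIntegral.integral_const_mul]
    rw [zero_pow three_ne_zero, sub_zero] at h2
    rw [h2]
    exact intervalIntegral.integral_congr fun r _ => by ring
  have h4 : ∫ x in box L, max (q t x) 0 ^ 3 ≤ 0 := by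
    rw [integral_congr_ae h1, integral_const_mul, ← integral_integral_swap hint]
    refine mul_nonpos_of_nonneg_of_nonpos (by norm_num) (integral_nonpos_of_ae ?_)
    exact ae_mono (Measure.restrict_mono hsub le_rfl) hle
  have hcont : Continuous fun x => max (q t x) 0 ^ 3 := (hslice.max continuous_const).pow 3
  have h5 := (integral_eq_zero_iff_of_nonneg (fun x => by positivity)
    (integrable_of_memLp (memLp_of_continuous hcont))).1
    (le_antisymm h4 (integral_nonneg fun x => by positivity))
  filter_upwards [h5] with x hx
  have : max (q t x) 0 = 0 := pow_eq_zero_iff three_ne_zero |>.1 hx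
  exact (le_max_left _ _).trans this.le

end Comparison

/-! ### Differential inequalities for the solution -/

section Solution

variable {L : Fin 3 → ℝ} {T : EReal} {ν₀ κ₂ : ℝ} {v₀ : E3 → E3} {ω₀ b₀ : E3 → ℝ}
  {v : ℝ → E3 → E3} {ω b ωc bc : ℝ → E3 → ℝ}

lemma MemH1locH1.hasTimeDeriv {u : ℝ → E3 → ℝ} (h : MemH1locH1 L T u) :
    HasTimeDeriv L T u (timeDeriv L T u) := by
  have hex : ∃ w, HasTimeDeriv L T u w := h.2.imp fun w hw => hw.1
  rw [timeDeriv, dif_pos hex]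
  exact hex.choose_spec

/-- A convection-diffusion equation in weak form, tested with a nondecreasing function of its
solution. -/
lemma exists_integral_mul_le (hL : ∀ i, 0 < L i) {f g d a : E3 → ℝ} {w : E3 → E3}
    {R : (E3 → ℝ) → ℝ} (hf : MemV L 3 f) (hw : MemVdiv L 3 w)
    (ha : ∀ᵐ x ∂volume.restrict (box L), 0 ≤ a x) (hfg : f =ᵐ[volume.restrict (box L)] g)
    (heq : ∀ z, MemV L 1 z → (∫ x in box L, d x * z x)
      - (∫ x in box L, ∑ i, f x * w x i * weakDeriv (box L) i z x)
      + (∫ x in box L, a x * ∑ i, weakDeriv (box L) i f x * weakDeriv (box L) i z x) = R z)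
    {Z : ℝ → ℝ} (hZ : ContDiff ℝ 1 Z) (hmono : Monotone Z) :
    ∃ z : E3 → ℝ, z =ᵐ[volume.restrict (box L)] (fun x => Z (g x)) ∧
      ∫ x in box L, d x * z x ≤ R z := by
  obtain ⟨U, hU, hp, hfU⟩ := hf.exists_contDiff hL
  refine ⟨fun x => Z (U x), ?_, ?_⟩
  · filter_upwards [hfU, hfg] with x h1 h2
    rw [← h1, ← h2]
  · have hper : BoxPeriodic L fun x => Z (U x) := fun i x => by simp only [hp i x]
    rw [← heq (fun x => Z (U x)) (memV_one_of_contDiff (hZ.comp hU) hper),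
      integral_transport_eq_zero hL hw hU hp hfU hZ, sub_zero]
    exact le_add_of_nonneg_right (integral_diffusion_nonneg hU hfU hZ hmono ha)

lemma IsSolution.ae_integral_om_le (hsol : IsSolution L ν₀ κ₂ T v₀ ω₀ b₀ v ω b)
    (hL : ∀ i, 0 < L i)
    (hω : ∀ᵐ t ∂volume.restrict (timeIoo T), ω t =ᵐ[volume.restrict (box L)] ωc t)
    (hb : ∀ᵐ t ∂volume.restrict (timeIoo T), b t =ᵐ[volume.restrict (box L)] bc t) :
    ∀ᵐ t ∂volume.restrict (timeIoo T), (∀ x ∈ box L, 0 ≤ ωc t x ∧ 0 ≤ bc t x) →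
      ∀ Z : ℝ → ℝ, ContDiff ℝ 1 Z → Monotone Z →
        ∫ x in box L, timeDeriv L T ω t x * Z (ωc t x)
          ≤ ∫ x in box L, -κ₂ * ωc t x ^ 2 * Z (ωc t x) := by
  filter_upwards [hsol.eq_om, hsol.mem_X.om_space.2, hsol.mem_X.v_space.2, hω, hb]
    with t heq hV hv hωt hbt hpos Z hZ hmono
  have ha : ∀ᵐ x ∂volume.restrict (box L), 0 ≤ b t x / ω t x := by
    filter_upwards [hωt, hbt, ae_restrict_mem (isOpen_box L).measurableSet] with x h1 h2 hx
    rw [h1, h2]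
    exact div_nonneg (hpos x hx).2 (hpos x hx).1
  obtain ⟨z, hz, hle⟩ := exists_integral_mul_le hL (d := timeDeriv L T ω t)
    (R := fun z => -κ₂ * ∫ x in box L, ω t x ^ 2 * z x) hV hv ha hωt heq hZ hmono
  calc ∫ x in box L, timeDeriv L T ω t x * Z (ωc t x)
      = ∫ x in box L, timeDeriv L T ω t x * z x :=
        integral_congr_ae (by filter_upwards [hz] with x h1; rw [h1])
    _ ≤ -κ₂ * ∫ x in box L, ω t x ^ 2 * z x := hle
    _ = ∫ x in box L, -κ₂ * ωc t x ^ 2 * Z (ωc t x) := by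
        rw [← integral_const_mul]
        refine integral_congr_ae ?_
        filter_upwards [hz, hωt] with x h1 h2
        rw [h1, h2, mul_assoc]

/-- The production term `(b / ω) |D(v)|²` has a sign against nonpositive test functions. -/
lemma IsSolution.ae_integral_b_le (hsol : IsSolution L ν₀ κ₂ T v₀ ω₀ b₀ v ω b)
    (hL : ∀ i, 0 < L i)
    (hω : ∀ᵐ t ∂volume.restrict (timeIoo T), ω t =ᵐ[volume.restrict (box L)] ωc t)
    (hb : ∀ᵐ t ∂volume.restrict (timeIoo T), b t =ᵐ[volume.restrict (box L)] bc t) :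
    ∀ᵐ t ∂volume.restrict (timeIoo T), (∀ x ∈ box L, 0 ≤ ωc t x ∧ 0 ≤ bc t x) →
      ∀ Z : ℝ → ℝ, ContDiff ℝ 1 Z → Monotone Z → (∀ r, Z r ≤ 0) →
        ∫ x in box L, timeDeriv L T b t x * Z (bc t x)
          ≤ ∫ x in box L, -(bc t x * ωc t x) * Z (bc t x) := by
  filter_upwards [hsol.eq_b, hsol.mem_X.b_space.2, hsol.mem_X.v_space.2, hω, hb]
    with t heq hV hv hωt hbt hpos Z hZ hmono hZ0
  have ha : ∀ᵐ x ∂volume.restrict (box L), 0 ≤ b t x / ω t x := by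
    filter_upwards [hωt, hbt, ae_restrict_mem (isOpen_box L).measurableSet] with x h1 h2 hx
    rw [h1, h2]
    exact div_nonneg (hpos x hx).2 (hpos x hx).1
  obtain ⟨z, hz, hle⟩ := exists_integral_mul_le hL (d := timeDeriv L T b t)
    (R := fun q => - (∫ x in box L, b t x * ω t x * q x)
        + ∫ x in box L, b t x / ω t x * (∑ i, ∑ j, symGrad L (v t) i j x ^ 2) * q x)
    hV hv ha hbt heq hZ hmono
  have hprod : ∫ x in box L, b t x / ω t x * (∑ i, ∑ j, symGrad L (v t) i j x ^ 2) * z x ≤ 0 := by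
    refine integral_nonpos_of_ae ?_
    filter_upwards [ha, hz] with x h1 h2
    rw [h2]
    exact mul_nonpos_of_nonneg_of_nonpos (mul_nonneg h1 (by positivity)) (hZ0 _)
  calc ∫ x in box L, timeDeriv L T b t x * Z (bc t x)
      = ∫ x in box L, timeDeriv L T b t x * z x :=
        integral_congr_ae (by filter_upwards [hz] with x h1; rw [h1])
    _ ≤ - ∫ x in box L, b t x * ω t x * z x := by linarith
    _ = ∫ x in box L, -(bc t x * ωc t x) * Z (bc t x) := by
        rw [← integral_neg]
        refine integral_congr_ae ?_
        filter_upwards [hz, hωt, hbt] with x h1 h2 h3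
        rw [h1, h2, h3]
        ring

/-- Comparison of the continuous representative with a function of time. For `σ = 1` this gives
upper bounds and for `σ = -1` lower bounds. -/
lemma le_of_ae_integral_le {u w uc : ℝ → E3 → ℝ} {y y' : ℝ → ℝ} {σ s : ℝ}
    (hT : 0 < T) (hL : ∀ i, 0 < L i) (h : HasTimeDeriv L T u w)
    (hc : ContinuousOn (fun p : ℝ × E3 => uc p.1 p.2) (timeIco T ×ˢ univ))
    (huc : ∀ᵐ t ∂volume.restrict (timeIoo T), u t =ᵐ[volume.restrict (box L)] uc t)
    (hs : s ∈ timeIoo T)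
    (hy : ∀ t ∈ Icc 0 s, HasDerivAt y (y' t) t) (hy' : ContinuousOn y' (Icc 0 s))
    (h0 : ∀ᵐ x ∂volume.restrict (box L), σ * (uc 0 x - y 0) ≤ 0) {r : ℝ → E3 → ℝ}
    (hr : ∀ t ∈ Ioo 0 s, Continuous (r t))
    (hle : ∀ᵐ t ∂volume.restrict (Ioo 0 s), ∀ Z : ℝ → ℝ,
      (Z = fun ξ => σ * max (σ * (ξ - y t)) 0 ^ 2) →
        ∫ x in box L, w t x * Z (uc t x) ≤ ∫ x in box L, r t x * Z (uc t x))
    (hsign : ∀ t ∈ Ioo 0 s, ∀ x ∈ box L, 0 < σ * (uc t x - y t) → σ * (r t x - y' t) ≤ 0) :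
    ∀ t ∈ Icc 0 s, ∀ x ∈ closure (box L), σ * (uc t x - y t) ≤ 0 := by
  have hsub := Icc_subset_timeIco hs
  have hyc : ContinuousOn y (Icc 0 s) := fun t ht => (hy t ht).continuousAt.continuousWithinAt
  have hyint : ∀ t ∈ Icc 0 s, IntervalIntegrable y' volume 0 t := fun t ht =>
    (hy'.mono (by rw [uIcc_of_le ht.1]; exact Icc_subset_Icc_right ht.2)).intervalIntegrable
  refine nonpos_of_integral_mul_sq_nonpos (q := fun t x => σ * (uc t x - y t))
    (d := fun t x => σ * (w t x - y' t)) ?_ ?_ ?_ h0 ?_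
  · exact continuousOn_const.mul ((hc.mono (prod_mono hsub le_rfl)).sub
      (hyc.comp continuousOn_fst fun p hp => hp.1))
  · refine ((h.2.1.integrable_cyl hs).sub ?_).const_mul σ
    exact Integrable.comp_fst (((hy'.integrableOn_Icc).mono_set Ioo_subset_Icc_self)) _
  · filter_upwards [h.ae_eq_add_integral hT hL hc huc hs] with x hx t ht
    have h1 : IntervalIntegrable (fun s => w s x) volume 0 t :=
      intervalIntegrable_of_Ioo (hx.1.mono_set (Ioo_subset_Ioo_right ht.2)) ht.1
    have h2 : ∫ r in (0)..t, y' r = y t - y 0 := by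
      refine intervalIntegral.integral_eq_sub_of_hasDerivAt (fun r hr => ?_) (hyint t ht)
      rw [uIcc_of_le ht.1] at hr
      exact hy r ⟨hr.1, hr.2.trans ht.2⟩
    rw [intervalIntegral.integral_const_mul, intervalIntegral.integral_sub h1 (hyint t ht), h2,
      hx.2 t ht]
    ring
  · filter_upwards [hle, ae_Ioo_of_ae_timeIoo hs h.2.1.ae_memLp, ae_restrict_mem measurableSet_Ioo]
      with t ht hw hts
    have hcu := continuous_slice hc (hsub (Ioo_subset_Icc_self hts))
    have hrt := hr t hts
    set Z : ℝ → ℝ := fun ξ => σ * max (σ * (ξ - y t)) 0 ^ 2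
    have hZc : Continuous fun x => Z (uc t x) := by fun_prop
    have hrZ : Continuous fun x => r t x * Z (uc t x) := hrt.mul hZc
    have hyZ : Integrable (fun x => y' t * Z (uc t x)) (volume.restrict (box L)) :=
      (integrable_of_memLp (memLp_of_continuous hZc)).const_mul _
    have h1 := ht Z rfl
    have h2 : ∫ x in box L, (r t x - y' t) * Z (uc t x) ≤ 0 := by
      refine integral_nonpos_of_ae ?_
      filter_upwards [ae_restrict_mem (isOpen_box L).measurableSet] with x hx
      simp only [Z]
      rcases le_or_gt (σ * (uc t x - y t)) 0 with h0 | h0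
      · simp [max_eq_right h0]
      · have h3 := mul_nonpos_of_nonpos_of_nonneg (hsign t hts x hx h0)
          (sq_nonneg (max (σ * (uc t x - y t)) 0))
        simp only [Pi.zero_apply]
        linarith
    have hwZ : Integrable (fun x => w t x * Z (uc t x)) (volume.restrict (box L)) :=
      hw.integrable_mul (memLp_of_continuous hZc)
    calc ∫ x in box L, σ * (w t x - y' t) * max (σ * (uc t x - y t)) 0 ^ 2
        = ∫ x in box L, (w t x * Z (uc t x) - y' t * Z (uc t x)) := by
          congr 1
          funext x
          simp only [Z]
          ring
      _ = (∫ x in box L, w t x * Z (uc t x)) - ∫ x in box L, y' t * Z (uc t x) :=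
          integral_sub hwZ hyZ
      _ ≤ (∫ x in box L, r t x * Z (uc t x)) - ∫ x in box L, y' t * Z (uc t x) := by linarith
      _ = ∫ x in box L, (r t x - y' t) * Z (uc t x) := by
          rw [← integral_sub (integrable_of_memLp (memLp_of_continuous hrZ)) hyZ]
          simp only [sub_mul]
      _ ≤ 0 := h2

end Solution

/-! ### Initial values -/

section Initial

variable {L : Fin 3 → ℝ} {T : EReal} {u uc : ℝ → E3 → ℝ} {u₀ : E3 → ℝ}

instance : NeBot (ae (volume : Measure ℝ) ⊓ 𝓝[>] 0) := by
  refine inf_neBot_iff.2 fun s hs t ht => ?_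
  obtain ⟨ε, hε, hsub⟩ := mem_nhdsGT_iff_exists_Ioo_subset.1 ht
  have hne : (volume.restrict (Ioo (0 : ℝ) ε)) ≠ 0 := by
    rw [Ne, Measure.restrict_eq_zero]
    simpa using hε
  have : NeBot (ae (volume.restrict (Ioo (0 : ℝ) ε))) := ae_neBot.2 hne
  have h1 : ∀ᵐ r ∂volume.restrict (Ioo (0 : ℝ) ε), r ∈ s := ae_restrict_of_ae hs
  obtain ⟨r, hr1, hr2⟩ := (h1.and (ae_restrict_mem measurableSet_Ioo)).exists
  exact ⟨r, hr1, hsub hr2⟩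

lemma ae_eq_of_hasInitialValue (hT : 0 < T) (hu₀ : MemLp u₀ 2 (volume.restrict (box L)))
    (hc : ContinuousOn (fun p : ℝ × E3 => uc p.1 p.2) (timeIco T ×ˢ univ))
    (huc : ∀ᵐ t ∂volume.restrict (timeIoo T), u t =ᵐ[volume.restrict (box L)] uc t)
    (h : HasInitialValue L u u₀) : uc 0 =ᵐ[volume.restrict (box L)] u₀ := by
  have h0 : (0 : ℝ) ∈ timeIco T := ⟨le_rfl, by exact_mod_cast hT⟩
  have hgood : ∀ᶠ t in ae (volume : Measure ℝ) ⊓ 𝓝[>] 0,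
      t ∈ timeIoo T ∧ u t =ᵐ[volume.restrict (box L)] uc t := by
    obtain ⟨τ, hτ⟩ := exists_mem_timeIoo hT
    rw [ae_restrict_iff' (isOpen_timeIoo T).measurableSet] at huc
    have h1 : ∀ᶠ t in ae (volume : Measure ℝ) ⊓ 𝓝[>] 0, t ∈ Ioo 0 τ :=
      Eventually.filter_mono inf_le_right (Ioo_mem_nhdsGT hτ.1)
    filter_upwards [h1, huc.filter_mono inf_le_left] with t ht1 ht2
    exact ⟨Ioo_subset_timeIoo hτ ht1, ht2 (Ioo_subset_timeIoo hτ ht1)⟩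
  have hex : ∀ n : ℕ, ∃ t, (t ∈ timeIoo T ∧ u t =ᵐ[volume.restrict (box L)] uc t) ∧
      t < 1 / ((n : ℝ) + 1) ∧
      eLpNorm (fun x => u t x - u₀ x) 2 (volume.restrict (box L))
        < ENNReal.ofReal (1 / (n + 1)) := by
    intro n
    have hn : (0 : ℝ) < 1 / ((n : ℝ) + 1) := by positivity
    have h1 : ∀ᶠ t in ae (volume : Measure ℝ) ⊓ 𝓝[>] 0, t < 1 / ((n : ℝ) + 1) :=
      Eventually.filter_mono (inf_le_right.trans nhdsWithin_le_nhds) (Iio_mem_nhds hn)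
    exact (hgood.and (h1.and (h.eventually_lt_const (ENNReal.ofReal_pos.2 hn)))).exists
  choose t ht htn hlt using hex
  have ht0 : Tendsto t atTop (𝓝 0) :=
    squeeze_zero (fun n => (ht n).1.1.le) (fun n => (htn n).le)
      tendsto_one_div_add_atTop_nhds_zero_nat
  have htmem : ∀ n, t n ∈ timeIco T := fun n => timeIoo_subset_timeIco (ht n).1
  have hmeas : TendstoInMeasure (volume.restrict (box L)) (fun n => uc (t n)) atTop u₀ := by
    refine tendstoInMeasure_of_tendsto_eLpNorm (p := 2) (by simp)
      (fun n => (continuous_slice hc (htmem n)).aestronglyMeasurable) hu₀.1 ?_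
    have hlim : Tendsto (fun n : ℕ => ENNReal.ofReal (1 / ((n : ℝ) + 1))) atTop (𝓝 0) := by
      simpa using ENNReal.tendsto_ofReal tendsto_one_div_add_atTop_nhds_zero_nat
    refine tendsto_of_tendsto_of_tendsto_of_le_of_le tendsto_const_nhds hlim
      (fun _ => zero_le) fun n => ?_
    refine le_trans (le_of_eq (eLpNorm_congr_ae ?_)) (hlt n).le
    filter_upwards [(ht n).2] with x hx
    simp [hx]
  obtain ⟨φ, hφ, hlim⟩ := hmeas.exists_seq_tendsto_ae
  filter_upwards [hlim] with x hx
  refine tendsto_nhds_unique ?_ hx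
  refine ((continuousOn_time hc x) 0 h0).tendsto.comp ?_
  exact tendsto_nhdsWithin_iff.2 ⟨ht0.comp hφ.tendsto_atTop, Eventually.of_forall fun n => htmem _⟩

end Initial

/-! ### The bounds -/

section Bounds

variable {L : Fin 3 → ℝ} {T : EReal} {ν₀ κ₂ : ℝ} {v₀ : E3 → E3} {ω₀ b₀ : E3 → ℝ}
  {v : ℝ → E3 → E3} {ω b ωc bc : ℝ → E3 → ℝ}

lemma hasDerivAt_div_one_add {κ m t : ℝ} (h : 0 < 1 + κ * m * t) :
    HasDerivAt (fun t => m / (1 + κ * m * t)) (-κ * (m / (1 + κ * m * t)) ^ 2) t := by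
  have h1 : HasDerivAt (fun t => 1 + κ * m * t) (κ * m) t := by
    simpa using ((hasDerivAt_id t).const_mul (κ * m)).const_add 1
  refine ((hasDerivAt_const t m).div h1 h.ne').congr_deriv ?_
  field_simp
  ring

lemma hasDerivAt_div_rpow {κ m c t : ℝ} (hκ : 0 < κ) (h : 0 < 1 + κ * m * t) :
    HasDerivAt (fun t => c / (1 + κ * m * t) ^ (1 / κ))
      (-(c / (1 + κ * m * t) ^ (1 / κ) * (m / (1 + κ * m * t)))) t := by
  have h1 : HasDerivAt (fun t => 1 + κ * m * t) (κ * m) t := by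
    simpa using ((hasDerivAt_id t).const_mul (κ * m)).const_add 1
  have h2 := h1.rpow_const (p := 1 / κ) (Or.inl h.ne')
  have hp : 0 < (1 + κ * m * t) ^ (1 / κ) := Real.rpow_pos_of_pos h _
  refine ((hasDerivAt_const t c).div h2 hp.ne').congr_deriv ?_
  rw [Real.rpow_sub_one h.ne']
  field_simp
  ring

lemma contDiff_max_sq (σ y : ℝ) : ContDiff ℝ 1 fun ξ : ℝ => σ * max (σ * (ξ - y)) 0 ^ 2 := by
  have h : ContDiff ℝ 1 fun ξ : ℝ => σ * (ξ - y) := by fun_prop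
  exact contDiff_const.mul ((contDiff_max_zero_pow 0).comp h)

lemma monotone_max_sq {σ : ℝ} (hσ : σ = 1 ∨ σ = -1) (y : ℝ) :
    Monotone fun ξ : ℝ => σ * max (σ * (ξ - y)) 0 ^ 2 := by
  intro ξ η h
  rcases hσ with rfl | rfl
  · simp only [one_mul]
    gcongr
  · have : max (-1 * (η - y)) 0 ^ 2 ≤ max (-1 * (ξ - y)) 0 ^ 2 := by
      gcongr ?_ ^ 2
      exact max_le_max (by linarith) le_rfl
    simp only
    linarith

/-- The bounds hold on `[0, s]` as long as `ω` and `b` are positive on `(0, s)`. -/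
lemma IsSolution.bounds_of_pos (hsol : IsSolution L ν₀ κ₂ T v₀ ω₀ b₀ v ω b)
    (hT : 0 < T) (hL : ∀ i, 0 < L i) (hκ₂ : 0 < κ₂) {b_min ω_min ω_max : ℝ}
    (hω_min : 0 < ω_min) (hω_max : 0 < ω_max)
    (hωc : ContinuousOn (fun p : ℝ × E3 => ωc p.1 p.2) (timeIco T ×ˢ univ))
    (hbc : ContinuousOn (fun p : ℝ × E3 => bc p.1 p.2) (timeIco T ×ˢ univ))
    (hω : ∀ᵐ t ∂volume.restrict (timeIoo T), ω t =ᵐ[volume.restrict (box L)] ωc t)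
    (hb : ∀ᵐ t ∂volume.restrict (timeIoo T), b t =ᵐ[volume.restrict (box L)] bc t)
    (hω0 : ∀ᵐ x ∂volume.restrict (box L), ω_min ≤ ωc 0 x ∧ ωc 0 x ≤ ω_max)
    (hb0 : ∀ᵐ x ∂volume.restrict (box L), b_min ≤ bc 0 x)
    {s : ℝ} (hs : s ∈ timeIoo T)
    (hpos : ∀ t ∈ Ioo 0 s, ∀ x ∈ box L, 0 ≤ ωc t x ∧ 0 ≤ bc t x) :
    ∀ t ∈ Icc 0 s, ∀ x ∈ closure (box L),
      ω_min / (1 + κ₂ * ω_min * t) ≤ ωc t x ∧ ωc t x ≤ ω_max / (1 + κ₂ * ω_max * t) ∧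
        b_min / (1 + κ₂ * ω_max * t) ^ (1 / κ₂) ≤ bc t x := by
  have hden : ∀ m, 0 < m → ∀ t ∈ Icc 0 s, 0 < 1 + κ₂ * m * t := fun m hm t ht => by
    have := mul_nonneg (mul_pos hκ₂ hm).le ht.1
    linarith
  have hdiv : ∀ m, 0 < m → ∀ t ∈ Icc 0 s, 0 < m / (1 + κ₂ * m * t) := fun m hm t ht =>
    div_pos hm (hden m hm t ht)
  have hcont : ∀ m, 0 < m → ContinuousOn (fun t => m / (1 + κ₂ * m * t)) (Icc 0 s) :=
    fun m hm t ht => (hasDerivAt_div_one_add (hden m hm t ht)).continuousAt.continuousWithinAt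
  have hder : ∀ m, 0 < m → ∀ t ∈ Icc 0 s, HasDerivAt (fun t => m / (1 + κ₂ * m * t))
      (-κ₂ * (m / (1 + κ₂ * m * t)) ^ 2) t := fun m hm t ht =>
    hasDerivAt_div_one_add (hden m hm t ht)
  have hcont' : ∀ m, 0 < m →
      ContinuousOn (fun t => -κ₂ * (m / (1 + κ₂ * m * t)) ^ 2) (Icc 0 s) :=
    fun m hm => continuousOn_const.mul ((hcont m hm).pow 2)
  have hmem : ∀ t ∈ Ioo 0 s, t ∈ timeIco T := fun t ht =>
    Icc_subset_timeIco hs (Ioo_subset_Icc_self ht)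
  have hωs : ∀ t ∈ Ioo 0 s, Continuous fun x => -κ₂ * ωc t x ^ 2 := fun t ht =>
    continuous_const.mul ((continuous_slice hωc (hmem t ht)).pow 2)
  have hωle : ∀ σ : ℝ, σ = 1 ∨ σ = -1 → ∀ y : ℝ → ℝ, ∀ᵐ t ∂volume.restrict (Ioo 0 s), ∀ Z : ℝ → ℝ,
      (Z = fun ξ => σ * max (σ * (ξ - y t)) 0 ^ 2) →
        ∫ x in box L, timeDeriv L T ω t x * Z (ωc t x)
          ≤ ∫ x in box L, -κ₂ * ωc t x ^ 2 * Z (ωc t x) := by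
    intro σ hσ y
    filter_upwards [ae_Ioo_of_ae_timeIoo hs (hsol.ae_integral_om_le hL hω hb),
      ae_restrict_mem measurableSet_Ioo] with t ht hts Z hZ
    subst hZ
    exact ht (hpos t hts) _ (contDiff_max_sq σ (y t)) (monotone_max_sq hσ (y t))
  have hom := hsol.mem_X.om_time.hasTimeDeriv
  have hup : ∀ t ∈ Icc 0 s, ∀ x ∈ closure (box L), ωc t x ≤ ω_max / (1 + κ₂ * ω_max * t) := by
    have := le_of_ae_integral_le (σ := 1) hT hL hom hωc hω hs (hder ω_max hω_max)
      (hcont' ω_max hω_max) (by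
        filter_upwards [hω0] with x hx
        simpa using hx.2) hωs (hωle 1 (Or.inl rfl) _) (fun t ht x hx h => by
          have h1 := hdiv ω_max hω_max t (Ioo_subset_Icc_self ht)
          have h2 : (ω_max / (1 + κ₂ * ω_max * t)) ^ 2 ≤ ωc t x ^ 2 :=
            pow_le_pow_left₀ h1.le (by linarith) 2
          have := mul_le_mul_of_nonneg_left h2 hκ₂.le
          linarith)
    intro t ht x hx
    have := this t ht x hx
    linarith
  have hlow : ∀ t ∈ Icc 0 s, ∀ x ∈ closure (box L), ω_min / (1 + κ₂ * ω_min * t) ≤ ωc t x := by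
    have := le_of_ae_integral_le (σ := -1) hT hL hom hωc hω hs (hder ω_min hω_min)
      (hcont' ω_min hω_min) (by
        filter_upwards [hω0] with x hx
        have := hx.1
        simp only [mul_zero, add_zero, div_one]
        linarith) hωs (hωle (-1) (Or.inr rfl) _) (fun t ht x hx h => by
          have h2 : ωc t x ^ 2 ≤ (ω_min / (1 + κ₂ * ω_min * t)) ^ 2 :=
            pow_le_pow_left₀ (hpos t ht x hx).1 (by linarith) 2
          have := mul_le_mul_of_nonneg_left h2 hκ₂.le
          linarith)
    intro t ht x hx
    have := this t ht x hx
    linarith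
  have hblow : ∀ t ∈ Icc 0 s, ∀ x ∈ closure (box L),
      b_min / (1 + κ₂ * ω_max * t) ^ (1 / κ₂) ≤ bc t x := by
    have hder' : ∀ t ∈ Icc 0 s, HasDerivAt (fun t => b_min / (1 + κ₂ * ω_max * t) ^ (1 / κ₂))
        (-(b_min / (1 + κ₂ * ω_max * t) ^ (1 / κ₂) * (ω_max / (1 + κ₂ * ω_max * t)))) t :=
      fun t ht => hasDerivAt_div_rpow hκ₂ (hden ω_max hω_max t ht)
    have := le_of_ae_integral_le (σ := -1) hT hL hsol.mem_X.b_time.hasTimeDeriv hbc hb hs hder'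
      (ContinuousOn.neg (ContinuousOn.mul (fun t ht =>
        (hder' t ht).continuousAt.continuousWithinAt) (hcont ω_max hω_max))) (by
        filter_upwards [hb0] with x hx
        simp only [mul_zero, add_zero, Real.one_rpow, div_one]
        linarith) (r := fun t x => -(bc t x * ωc t x)) (fun t ht =>
          ((continuous_slice hbc (hmem t ht)).mul (continuous_slice hωc (hmem t ht))).neg) (by
        filter_upwards [ae_Ioo_of_ae_timeIoo hs (hsol.ae_integral_b_le hL hω hb),
          ae_restrict_mem measurableSet_Ioo] with t ht hts Z hZ
        subst hZ
        refine ht (hpos t hts) _ (contDiff_max_sq (-1) _) (monotone_max_sq (Or.inr rfl) _)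
          fun r => ?_
        have := sq_nonneg (max (-1 * (r - b_min / (1 + κ₂ * ω_max * t) ^ (1 / κ₂))) 0)
        linarith) (fun t ht x hx h => by
          have h1 := hup t (Ioo_subset_Icc_self ht) x (subset_closure hx)
          have h2 := mul_le_mul
            (show bc t x ≤ b_min / (1 + κ₂ * ω_max * t) ^ (1 / κ₂) by linarith) h1
            (hpos t ht x hx).1 (((hpos t ht x hx).2).trans (by linarith))
          linarith)
    intro t ht x hx
    have := this t ht x hx
    linarith
  exact fun t ht x hx => ⟨hlow t ht x hx, hup t ht x hx, hblow t ht x hx⟩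

end Bounds

end Kolmogorov

theorem proposition1
    (L : Fin 3 → ℝ) (hL : ∀ i, 0 < L i)
    (ν₀ κ₂ : ℝ) (hν₀ : 0 < ν₀) (hκ₂ : 0 < κ₂)
    (b_min ω_min ω_max : ℝ) (hb_min : 0 < b_min) (hω_min : 0 < ω_min) (hω_max : 0 < ω_max)
    (v₀ : Kolmogorov.E3 → Kolmogorov.E3) (ω₀ b₀ : Kolmogorov.E3 → ℝ)
    (hv₀ : Kolmogorov.MemVdiv L 2 v₀)
    (hω₀ : Kolmogorov.MemV L 2 ω₀) (hb₀ : Kolmogorov.MemV L 2 b₀)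
    (hb₀_low : ∀ᵐ x ∂volume.restrict (Kolmogorov.box L), b_min ≤ b₀ x)
    (hω₀_bounds : ∀ᵐ x ∂volume.restrict (Kolmogorov.box L), ω_min ≤ ω₀ x ∧ ω₀ x ≤ ω_max)
    (T : EReal) (hT : 0 < T)
    (v : ℝ → Kolmogorov.E3 → Kolmogorov.E3) (ω b : ℝ → Kolmogorov.E3 → ℝ)
    (hsol : Kolmogorov.IsSolution L ν₀ κ₂ T v₀ ω₀ b₀ v ω b) :
    ∃ ωc bc : ℝ → Kolmogorov.E3 → ℝ,
      ContinuousOn (fun p : ℝ × Kolmogorov.E3 => ωc p.1 p.2)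
        (Kolmogorov.timeIco T ×ˢ closure (Kolmogorov.box L)) ∧
      ContinuousOn (fun p : ℝ × Kolmogorov.E3 => bc p.1 p.2)
        (Kolmogorov.timeIco T ×ˢ closure (Kolmogorov.box L)) ∧
      (∀ᵐ p ∂Kolmogorov.cylMeasure L T, ω p.1 p.2 = ωc p.1 p.2) ∧
      (∀ᵐ p ∂Kolmogorov.cylMeasure L T, b p.1 p.2 = bc p.1 p.2) ∧
      ∀ t ∈ Kolmogorov.timeIco T, ∀ x ∈ closure (Kolmogorov.box L),
        ω_min / (1 + κ₂ * ω_min * t) ≤ ωc t x ∧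
        ωc t x ≤ ω_max / (1 + κ₂ * ω_max * t) ∧
        b_min / (1 + κ₂ * ω_max * t) ^ (1 / κ₂) ≤ bc t x := by
  have h0 : (0 : ℝ) ∈ Kolmogorov.timeIco T := ⟨le_rfl, by exact_mod_cast hT⟩
  obtain ⟨w, hw, hw1⟩ := hsol.mem_X.om_time.2
  obtain ⟨z, hz, hz1⟩ := hsol.mem_X.b_time.2
  obtain ⟨ωc, hωc, hω⟩ := hw.exists_continuousOn hT hL hsol.mem_X.om_space hsol.mem_X.om_time.1 hw1
  obtain ⟨bc, hbc, hb⟩ := hz.exists_continuousOn hT hL hsol.mem_X.b_space hsol.mem_X.b_time.1 hz1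
  have hω0 : ∀ᵐ x ∂volume.restrict (Kolmogorov.box L), ω_min ≤ ωc 0 x ∧ ωc 0 x ≤ ω_max := by
    filter_upwards [hω₀_bounds,
      Kolmogorov.ae_eq_of_hasInitialValue hT hω₀.memLp hωc hω hsol.init_om] with x h1 h2
    rwa [h2]
  have hb0 : ∀ᵐ x ∂volume.restrict (Kolmogorov.box L), b_min ≤ bc 0 x := by
    filter_upwards [hb₀_low,
      Kolmogorov.ae_eq_of_hasInitialValue hT hb₀.memLp hbc hb hsol.init_b] with x h1 h2
    rwa [h2]
  -- The bounds at time `s` follow from nonnegativity on `(0, s)`; at `s = 0` it is the assumption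
  -- on the initial data.
  have hbounds : ∀ s ∈ Kolmogorov.timeIco T,
      (∀ t ∈ Ioo 0 s, ∀ x ∈ Kolmogorov.box L, 0 ≤ ωc t x ∧ 0 ≤ bc t x) →
      ∀ x ∈ closure (Kolmogorov.box L),
        ω_min / (1 + κ₂ * ω_min * s) ≤ ωc s x ∧
        ωc s x ≤ ω_max / (1 + κ₂ * ω_max * s) ∧
        b_min / (1 + κ₂ * ω_max * s) ^ (1 / κ₂) ≤ bc s x := by
    intro s hs hpos x hx
    rcases hs.1.eq_or_lt with rfl | hs0
    · have hωx := Kolmogorov.continuous_slice hωc h0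
      have h1 := Kolmogorov.forall_closure_box_nonpos (f := fun x => ω_min - ωc 0 x)
        (continuous_const.sub hωx) (by filter_upwards [hω0] with x hx using sub_nonpos.2 hx.1) x hx
      have h2 := Kolmogorov.forall_closure_box_nonpos (f := fun x => ωc 0 x - ω_max)
        (hωx.sub continuous_const) (by filter_upwards [hω0] with x hx using sub_nonpos.2 hx.2) x hx
      have h3 := Kolmogorov.forall_closure_box_nonpos (f := fun x => b_min - bc 0 x)
        (continuous_const.sub (Kolmogorov.continuous_slice hbc h0))
        (by filter_upwards [hb0] with x hx using sub_nonpos.2 hx) x hx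
      simpa using ⟨sub_nonpos.1 h1, sub_nonpos.1 h2, sub_nonpos.1 h3⟩
    · exact hsol.bounds_of_pos hT hL hκ₂ hω_min hω_max hωc hbc hω hb hω0 hb0 ⟨hs0, hs.2⟩ hpos
        s ⟨hs0.le, le_rfl⟩ x hx
  have hpos_of : ∀ s ∈ Kolmogorov.timeIco T,
      (∀ t ∈ Ioo 0 s, ∀ x ∈ Kolmogorov.box L, 0 ≤ ωc t x ∧ 0 ≤ bc t x) →
      ∀ x ∈ closure (Kolmogorov.box L), 0 < min (ωc s x) (bc s x) := by
    intro s hs hpos x hx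
    have hs0 := hs.1
    obtain ⟨h1, -, h3⟩ := hbounds s hs hpos x hx
    exact lt_min (lt_of_lt_of_le (by positivity) h1) (lt_of_lt_of_le (by positivity) h3)
  -- There is no first time at which `min ωc bc` fails to be positive.
  have hpos : ∀ t ∈ Kolmogorov.timeIco T, ∀ x ∈ closure (Kolmogorov.box L),
      0 < min (ωc t x) (bc t x) := by
    intro t ht x hx
    by_contra hle
    set m : ℝ × Kolmogorov.E3 → ℝ := fun p => min (ωc p.1 p.2) (bc p.1 p.2)
    have hIcc : Icc 0 t ⊆ Kolmogorov.timeIco T := fun r hr =>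
      ⟨hr.1, lt_of_le_of_lt (by exact_mod_cast hr.2) ht.2⟩
    have hcompact : IsCompact (Icc 0 t ×ˢ closure (Kolmogorov.box L)) :=
      isCompact_Icc.prod (Kolmogorov.isBounded_box L).isCompact_closure
    have hm : ContinuousOn m (Icc 0 t ×ˢ closure (Kolmogorov.box L)) :=
      (ContinuousOn.inf hωc hbc).mono (prod_mono hIcc (subset_univ _))
    have hK : IsCompact ((Icc 0 t ×ˢ closure (Kolmogorov.box L)) ∩ m ⁻¹' Iic 0) :=
      hcompact.of_isClosed_subset
        (hm.preimage_isClosed_of_isClosed hcompact.isClosed isClosed_Iic) inter_subset_left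
    obtain ⟨r, ⟨⟨r, y⟩, ⟨⟨hr, hy⟩, hry⟩, rfl⟩, hmin⟩ := (hK.image continuous_fst).exists_isLeast
      ⟨t, (t, x), ⟨⟨⟨ht.1, le_rfl⟩, hx⟩, not_lt.1 hle⟩, rfl⟩
    refine absurd (hpos_of r (hIcc hr) (fun s hs x' hx' => ?_) y hy) (not_lt.2 hry)
    by_contra hneg
    refine absurd (hmin ⟨(s, x'), ⟨⟨⟨hs.1.le, hs.2.le.trans hr.2⟩, subset_closure hx'⟩, ?_⟩, rfl⟩)
      (not_le.2 hs.2)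
    by_contra hm0
    have hlt : 0 < min (ωc s x') (bc s x') := not_le.1 hm0
    have := lt_min_iff.1 hlt
    exact hneg ⟨this.1.le, this.2.le⟩
  refine ⟨ωc, bc, hωc.mono (prod_mono le_rfl (subset_univ _)),
    hbc.mono (prod_mono le_rfl (subset_univ _)),
    Kolmogorov.ae_cylMeasure_eq hsol.mem_X.om_space.1.1 hωc hω,
    Kolmogorov.ae_cylMeasure_eq hsol.mem_X.b_space.1.1 hbc hb, fun t ht x hx => ?_⟩
  refine hbounds t ht (fun s hs x' hx' => ?_) x hx
  have := lt_min_iff.1 (hpos s ⟨hs.1.le, lt_trans (by exact_mod_cast hs.2) ht.2⟩ x'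
    (subset_closure hx'))
  exact ⟨this.1.le, this.2.le⟩
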